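/- Let $R$ be a principal ideal domain, and let $\mathrm{Aff}_R$ be the category of affine schemes over $R$, i.e. the opposite of the category $\mathrm{cAlg}_R$ of commutative unital $R$-algebras. A tangent structure $\mathbb{T}=(T,p,z,s,l,c)$ on a category consists of an endofunctor $T$; a natural projection $p_M\colon TM\to M$ whose $n$-fold pullbacks $T_nM$ along itself exist and are preserved by all iterates $T^k$; and natural transformations $z_M\colon M\to TM$ (zero), $s_M\colon T_2M\to TM$ (sum), $l_M\colon TM\to T^2M$ (vertical lift) and $c_M\colon T^2M\to T^2M$ (canonical flip), satisfying the axioms of Cockett and Cruttwell: $(p,z,s)$ is an additive bundle (a commutative monoid over $M$); $(z,l)\colon(p,z,s)\to(Tp,Tz,Ts)$ and $(\mathrm{id},c)\colon(p_T,z_T,s_T)\to(Tp,Tz,Ts)$ are additive bundle morphisms; $Tl\circ l=l_T\circ l$, $c\circ c=\mathrm{id}$, $Tc\circ c_T\circ Tc=c_T\circ Tc\circ c_T$, $c\circ l=l$ and $c_T\circ Tc\circ l_T=Tl\circ c$; and the vertical lift is universal, i.e. the square with sides $Ts_M\circ\langle l_M\pi_1,z_{TM}\pi_2\rangle\colon T_2M\to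 T^2M$, $p_M\pi_1\colon T_2M\to M$, $Tp_M$ and $z_M$ is a pullback. In a category with finite products, an object $D$ represents an endofunctor $F$ if $F$ is right adjoint to $D\times-$ (so $F\cong(-)^D$), and $\mathbb{T}$ is representable if for every $n\ge 1$ the functor $T_n$ is represented by some object $D_n$. An isomorphism of tangent structures on the same category is a natural isomorphism of the tangent bundle functors compatible with $p,z,s,l,c$. Let $\mathbb{T}^\circ$ be the Kähler-differential tangent structure on $\mathrm{Aff}_R$: its tangent bundle functor sends $\mathrm{Spec}\,A$ to $\mathrm{Spec}(\mathrm{Sym}_A\,\Omega_{A/R})$, and on algebras its structure maps are given by $p\colon a\mapsto a$; $z\colon a\mapsto a,\ da\mapsto 0$; $s\colon a\mapsto a,\ da\mapsto \pi_1(da)+\pi_2(da)$; $l\colon a\mapsto a,\ da\mapsto 0,\ d'a\mapsto 0,\ d'da\mapsto da$; $c\colon a\mapsto a,\ da\mapsto d'a,\ d'a\mapsto da,\ d'da\mapsto d'da$, where $d$ and $d'$ are the universal derivations of the first and the second application of the functor. The trivial tangent structure has the identity functor as tangent bundle functor and identities as structure maps. Then, up to isomorphism of tangent structures, there are exactly two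 representable tangent structures on $\mathrm{Aff}_R$: the trivial one, whose tangent bundle functor is represented by the terminal object $\mathrm{Spec}\,R$, and $\mathbb{T}^\circ$, whose tangent bundle functor is represented by $\mathrm{Spec}\,R[\varepsilon]$, where $R[\varepsilon]=R[x]/(x^2)$. That is, both are representable, they are not isomorphic, and every representable tangent structure on $\mathrm{Aff}_R$ is isomorphic to one of them. In particular, this holds for the category $\mathrm{Aff}=\mathrm{Aff}_{\mathbb{Z}}$ of affine schemes. -/

import Mathlib

open CategoryTheory Limits Opposite MonoidalCategory
open scoped DualNumber KaehlerDifferential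

universe v u

namespace TangentCategory

noncomputable section General

variable {C : Type u} [Category.{v} C]

/-- The `k`-fold iterate `Tᵏ` of an endofunctor. -/
def iter (T : C ⥤ C) : ℕ → (C ⥤ C)
  | 0 => 𝟭 C
  | k + 1 => iter T k ⋙ T

/-- The diagram of `n` copies of `p_M : T M ⟶ M`, whose limit is the `n`-fold pullback `Tₙ M`. -/
abbrev fiberDiagram {T : C ⥤ C} (p : T ⟶ 𝟭 C) (n : ℕ) (M : C) : WidePullbackShape (Fin n) ⥤ C :=
  WidePullbackShape.wideCospan M (fun _ : Fin n => T.obj M) (fun _ => p.app M)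

/-- All `n`-fold pullbacks of `p_M : T M ⟶ M` along itself exist, and they are preserved by all
iterates of `T`. -/
class HasFiberPowers {T : C ⥤ C} (p : T ⟶ 𝟭 C) : Prop where
  hasLimit : ∀ (n : ℕ) (M : C), HasLimit (fiberDiagram p n M)
  preserves : ∀ (k n : ℕ) (M : C), PreservesLimit (fiberDiagram p n M) (iter T k)

attribute [instance] HasFiberPowers.hasLimit HasFiberPowers.preserves

variable {T : C ⥤ C}

/-- The cone over the diagram of `n` copies of `p_M` given by a base map `b` and maps `f i`. -/
abbrev fiberCone (p : T ⟶ 𝟭 C) {n : ℕ} {M X : C} (b : X ⟶ M) (f : Fin n → (X ⟶ T.obj M))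
    (w : ∀ i, f i ≫ p.app M = b) : Cone (fiberDiagram p n M) :=
  WidePullbackShape.mkCone (F := fiberDiagram p n M) b f w

variable (p : T ⟶ 𝟭 C) [HasFiberPowers p]

/-- The natural map between the diagrams of copies of `p_M` and of `p_N` induced by `f : M ⟶ N`. -/
def fiberDiagramMap (p : T ⟶ 𝟭 C) (n : ℕ) {M N : C} (f : M ⟶ N) :
    fiberDiagram p n M ⟶ fiberDiagram p n N where
  app
    | none => f
    | some _ => T.map f
  naturality i j g := by
    change WidePullbackShape.Hom i j at g
    cases g with
    | id =>
      change (fiberDiagram p n M).map (𝟙 i) ≫ _ = _ ≫ (fiberDiagram p n N).map (𝟙 i)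
      rw [CategoryTheory.Functor.map_id, CategoryTheory.Functor.map_id, Category.id_comp,
        Category.comp_id]
    | term i => exact (p.naturality f).symm

/-- The functor `Tₙ`, sending `M` to the `n`-fold pullback of `p_M` along itself. -/
def fiberPower (n : ℕ) : C ⥤ C where
  obj M := limit (fiberDiagram p n M)
  map f := limMap (fiberDiagramMap p n f)
  map_id M := limit.hom_ext fun j => by
    rw [limMap_π, Category.id_comp]
    cases j with
    | none => exact Category.comp_id _
    | some i => exact (congrArg (_ ≫ ·) (T.map_id M)).trans (Category.comp_id _)
  map_comp f g := limit.hom_ext fun j => by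
    rw [limMap_π, Category.assoc, limMap_π, ← Category.assoc, limMap_π, Category.assoc]
    cases j with
    | none => rfl
    | some i => exact congrArg (_ ≫ ·) (T.map_comp f g)

/-- The projections `πᵢ : Tₙ M ⟶ T M`. -/
def proj {n : ℕ} (i : Fin n) (M : C) : (fiberPower p n).obj M ⟶ T.obj M :=
  limit.π (fiberDiagram p n M) (some i)

/-- The projection `Tₙ M ⟶ M` to the base. -/
def base (n : ℕ) (M : C) : (fiberPower p n).obj M ⟶ M :=
  limit.π (fiberDiagram p n M) none

lemma proj_p {n : ℕ} (i : Fin n) (M : C) : proj p i M ≫ p.app M = base p n M :=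
  limit.w (fiberDiagram p n M) (WidePullbackShape.Hom.term i)

lemma proj_w {n : ℕ} (i j : Fin n) (M : C) : proj p i M ≫ p.app M = proj p j M ≫ p.app M :=
  (proj_p p i M).trans (proj_p p j M).symm

lemma fiberPower_map_proj {n : ℕ} (i : Fin n) {M N : C} (f : M ⟶ N) :
    (fiberPower p n).map f ≫ proj p i N = proj p i M ≫ T.map f :=
  limMap_π (fiberDiagramMap p n f) (some i)

lemma fiberPower_map_base {n : ℕ} {M N : C} (f : M ⟶ N) :
    (fiberPower p n).map f ≫ base p n N = base p n M ≫ f :=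
  limMap_π (fiberDiagramMap p n f) none

lemma fiberPower_hom_ext {n : ℕ} {M X : C} {g h : X ⟶ (fiberPower p n).obj M}
    (hb : g ≫ base p n M = h ≫ base p n M) (hp : ∀ i, g ≫ proj p i M = h ≫ proj p i M) : g = h :=
  limit.hom_ext (F := fiberDiagram p n M) fun j => by
    cases j with
    | none => exact hb
    | some i => exact hp i

/-- The pairing `⟨f, g⟩ : X ⟶ T₂ M` of two maps that agree after `p_M`. -/
def pair {M X : C} (f g : X ⟶ T.obj M) (w : f ≫ p.app M = g ≫ p.app M) :
    X ⟶ (fiberPower p 2).obj M :=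
  limit.lift (fiberDiagram p 2 M)
    (fiberCone p (f ≫ p.app M) ![f, g] (Fin.forall_fin_two.2 ⟨rfl, w.symm⟩))

lemma pair_fst {M X : C} (f g : X ⟶ T.obj M) (w : f ≫ p.app M = g ≫ p.app M) :
    pair p f g w ≫ proj p 0 M = f :=
  limit.lift_π (F := fiberDiagram p 2 M) _ (some 0)

lemma pair_snd {M X : C} (f g : X ⟶ T.obj M) (w : f ≫ p.app M = g ≫ p.app M) :
    pair p f g w ≫ proj p 1 M = g :=
  limit.lift_π (F := fiberDiagram p 2 M) _ (some 1)

lemma pair_s_p {M X : C} (s : (fiberPower p 2).obj M ⟶ T.obj M)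
    (hs : s ≫ p.app M = proj p 0 M ≫ p.app M) (f g : X ⟶ T.obj M)
    (w : f ≫ p.app M = g ≫ p.app M) : (pair p f g w ≫ s) ≫ p.app M = f ≫ p.app M := by
  rw [Category.assoc, hs, ← Category.assoc, pair_fst]

/-- The image under `T` of the limit cone defining `T₂ M` is a limit cone. -/
def isLimitMap (n : ℕ) (M : C) : IsLimit (T.mapCone (limit.cone (fiberDiagram p n M))) :=
  isLimitOfPreserves (iter T 1) (limit.isLimit (fiberDiagram p n M))

/-- The pairing `⟨f, g⟩ : X ⟶ T (T₂ M)` of two maps to `T (T M)` that agree after `T p_M`,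
where `T (T₂ M)` is regarded as the pullback of `T p_M` along itself. -/
def pairT {M X : C} (f g : X ⟶ T.obj (T.obj M))
    (w : f ≫ T.map (p.app M) = g ≫ T.map (p.app M)) : X ⟶ T.obj ((fiberPower p 2).obj M) :=
  (isLimitMap p 2 M).lift (WidePullbackShape.mkCone (F := fiberDiagram p 2 M ⋙ T)
    (f ≫ T.map (p.app M)) ![f, g] (Fin.forall_fin_two.2 ⟨rfl, w.symm⟩))

lemma pairT_fst {M X : C} (f g : X ⟶ T.obj (T.obj M))
    (w : f ≫ T.map (p.app M) = g ≫ T.map (p.app M)) :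
    pairT p f g w ≫ T.map (proj p 0 M) = f :=
  (isLimitMap p 2 M).fac _ (some 0)

lemma pairT_snd {M X : C} (f g : X ⟶ T.obj (T.obj M))
    (w : f ≫ T.map (p.app M) = g ≫ T.map (p.app M)) :
    pairT p f g w ≫ T.map (proj p 1 M) = g :=
  (isLimitMap p 2 M).fac _ (some 1)

lemma lift_w (z : 𝟭 C ⟶ T) {M : C} (l : T.obj M ⟶ T.obj (T.obj M))
    (hl : l ≫ T.map (p.app M) = p.app M ≫ z.app M) :
    (proj p 0 M ≫ l) ≫ T.map (p.app M) =
      (proj p (n := 2) 1 M ≫ z.app (T.obj M)) ≫ T.map (p.app M) := by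
  have h : p.app M ≫ z.app M = z.app (T.obj M) ≫ T.map (p.app M) := z.naturality (p.app M)
  rw [Category.assoc, Category.assoc, hl, ← h, ← Category.assoc, ← Category.assoc, proj_p, proj_p]

end General

/-- A tangent structure `(T, p, z, s, l, c)` on a category. -/
structure TangentStructure (C : Type u) [Category.{v} C] where
  /-- the tangent bundle functor -/
  T : C ⥤ C
  /-- the projection -/
  p : T ⟶ 𝟭 C
  /-- the `n`-fold pullbacks `Tₙ` of the projection exist and are preserved by the iterates `Tᵏ` -/
  [fiberPowers : HasFiberPowers p]
  /-- the zero morphism -/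
  z : 𝟭 C ⟶ T
  /-- the sum morphism -/
  s : fiberPower p 2 ⟶ T
  /-- the vertical lift -/
  l : T ⟶ T ⋙ T
  /-- the canonical flip -/
  c : T ⋙ T ⟶ T ⋙ T
  -- `(p, z, s)` is an additive bundle
  z_p : ∀ M, z.app M ≫ p.app M = 𝟙 M
  s_p : ∀ M, s.app M ≫ p.app M = proj p 0 M ≫ p.app M
  s_comm : ∀ M, pair p (proj p 1 M) (proj p 0 M) (proj_w p 1 0 M) ≫ s.app M = s.app M
  s_assoc : ∀ M,
    pair p (pair p (proj p (n := 3) 0 M) (proj p 1 M) (proj_w p 0 1 M) ≫ s.app M) (proj p 2 M)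
      ((pair_s_p p _ (s_p M) _ _ _).trans (proj_w p 0 2 M)) ≫ s.app M =
    pair p (proj p (n := 3) 0 M) (pair p (proj p 1 M) (proj p 2 M) (proj_w p 1 2 M) ≫ s.app M)
      ((proj_w p 0 1 M).trans (pair_s_p p _ (s_p M) _ _ _).symm) ≫ s.app M
  zero_s : ∀ M, pair p (p.app M ≫ z.app M) (𝟙 (T.obj M)) (by
      rw [Category.assoc, z_p]; exact (Category.comp_id _).trans (Category.id_comp _).symm) ≫
    s.app M = 𝟙 (T.obj M)
  -- `(z, l) : (p, z, s) ⟶ (T p, T z, T s)` is an additive bundle morphism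
  l_p : ∀ M, l.app M ≫ T.map (p.app M) = p.app M ≫ z.app M
  z_l : ∀ M, z.app M ≫ l.app M = z.app M ≫ T.map (z.app M)
  s_l : ∀ M,
    pairT p (proj p 0 M ≫ l.app M) (proj p 1 M ≫ l.app M) (by
      simp only [Category.assoc, l_p]; simp only [← Category.assoc, proj_p]) ≫ T.map (s.app M) =
    s.app M ≫ l.app M
  -- `(𝟙, c) : (p_T, z_T, s_T) ⟶ (T p, T z, T s)` is an additive bundle morphism
  c_p : ∀ M, c.app M ≫ T.map (p.app M) = p.app (T.obj M)
  z_c : ∀ M, z.app (T.obj M) ≫ c.app M = T.map (z.app M)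
  s_c : ∀ M,
    pairT p (proj p 0 (T.obj M) ≫ c.app M) (proj p 1 (T.obj M) ≫ c.app M) (by
      simp only [Category.assoc, c_p]; exact proj_w p 0 1 (T.obj M)) ≫ T.map (s.app M) =
    s.app (T.obj M) ≫ c.app M
  -- coassociativity of the lift, involutivity of the flip, and the Yang-Baxter equation
  l_l : ∀ M, l.app M ≫ T.map (l.app M) = l.app M ≫ l.app (T.obj M)
  c_c : ∀ M, c.app M ≫ c.app M = 𝟙 (T.obj (T.obj M))
  c_braid : ∀ M, T.map (c.app M) ≫ c.app (T.obj M) ≫ T.map (c.app M) =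
    c.app (T.obj M) ≫ T.map (c.app M) ≫ c.app (T.obj M)
  -- compatibility of the lift with the flip
  l_c : ∀ M, l.app M ≫ c.app M = l.app M
  l_c_c : ∀ M, l.app (T.obj M) ≫ T.map (c.app M) ≫ c.app (T.obj M) = c.app M ≫ T.map (l.app M)
  -- universality of the vertical lift
  universal : ∀ M, IsPullback
    (pairT p (proj p 0 M ≫ l.app M) (proj p 1 M ≫ z.app (T.obj M))
      (lift_w p z (l.app M) (l_p M)) ≫ T.map (s.app M))
    (proj p 0 M ≫ p.app M) (T.map (p.app M)) (z.app M)

attribute [instance] TangentStructure.fiberPowers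

namespace TangentStructure
variable {C : Type u} [Category.{v} C]

/-- The functor `Tₙ` of a tangent structure. -/
noncomputable def Tn (𝕋 : TangentStructure C) (n : ℕ) : C ⥤ C := fiberPower 𝕋.p n

/-- An isomorphism between two tangent structures on the same category: a natural isomorphism
between the tangent bundle functors that is compatible with all the structure. -/
structure Iso (𝕊 𝕋 : TangentStructure C) where
  /-- the isomorphism of tangent bundle functors -/
  iso : 𝕊.T ≅ 𝕋.T
  p : ∀ M, iso.hom.app M ≫ 𝕋.p.app M = 𝕊.p.app M
  z : ∀ M, 𝕊.z.app M ≫ iso.hom.app M = 𝕋.z.app M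
  s : ∀ M, pair 𝕋.p (proj 𝕊.p 0 M ≫ iso.hom.app M) (proj 𝕊.p 1 M ≫ iso.hom.app M) (by
      rw [Category.assoc, Category.assoc, p]; exact proj_w 𝕊.p 0 1 M) ≫ 𝕋.s.app M =
    𝕊.s.app M ≫ iso.hom.app M
  l : ∀ M, 𝕊.l.app M ≫ (iso.hom ◫ iso.hom).app M = iso.hom.app M ≫ 𝕋.l.app M
  c : ∀ M, 𝕊.c.app M ≫ (iso.hom ◫ iso.hom).app M = (iso.hom ◫ iso.hom).app M ≫ 𝕋.c.app M

/-- The object `D` represents the endofunctor `F`: the functor `F` is right adjoint to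
`D × -`, i.e. `F` is the exponential functor `(-)^D`. -/
def Represents [CartesianMonoidalCategory C] (D : C) (F : C ⥤ C) : Prop :=
  Nonempty (tensorLeft D ⊣ F)

/-- A tangent structure is representable if for every `n ≥ 1` the functor `Tₙ` is represented
by some object `Dₙ`. -/
def IsRepresentable [CartesianMonoidalCategory C] (𝕋 : TangentStructure C) : Prop :=
  ∀ n : ℕ, 0 < n → ∃ D : C, Represents D (𝕋.Tn n)

end TangentStructure

/-! ### The trivial tangent structure -/

section Trivial
variable (C : Type u) [Category.{v} C]

/-- The `n`-fold pullback of the identity of `M` along itself is `M`, and every functor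
preserves it. -/
def trivialIsLimit (F : C ⥤ C) (n : ℕ) (M : C) :
    IsLimit (F.mapCone (fiberCone (𝟙 (𝟭 C)) (n := n) (𝟙 M) (fun _ => 𝟙 M)
      (fun _ => Category.id_comp _))) where
  lift s := s.π.app none
  fac s j := by
    cases j with
    | none => exact (congrArg (s.π.app none ≫ ·) (F.map_id M)).trans (Category.comp_id _)
    | some i =>
      exact (congrArg (s.π.app none ≫ ·) (F.map_id M)).trans ((Category.comp_id _).trans
        ((s.w (WidePullbackShape.Hom.term i)).symm.trans
          ((congrArg (s.π.app (some i) ≫ ·) (F.map_id M)).trans (Category.comp_id _))))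
  uniq s m hm :=
    ((congrArg (m ≫ ·) (F.map_id M)).trans (Category.comp_id _)).symm.trans (hm none)

instance : HasFiberPowers (𝟙 (𝟭 C)) where
  hasLimit n M := ⟨⟨_, trivialIsLimit C (𝟭 C) n M⟩⟩
  preserves k n M := preservesLimit_of_preserves_limit_cone
    (h := (trivialIsLimit C (𝟭 C) n M : IsLimit (fiberCone _ _ _ _)))
    (trivialIsLimit C (iter (𝟭 C) k) n M)

lemma trivial_proj {n : ℕ} (i : Fin n) (M : C) : proj (𝟙 (𝟭 C)) i M = base (𝟙 (𝟭 C)) n M :=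
  (Category.comp_id _).symm.trans (proj_p (𝟙 (𝟭 C)) i M)

lemma trivial_pair {M X : C} (f g : X ⟶ M) (w : f ≫ 𝟙 M = g ≫ 𝟙 M) :
    pair (𝟙 (𝟭 C)) f g w ≫ base (𝟙 (𝟭 C)) 2 M = f := by
  rw [← trivial_proj C 0]; exact pair_fst ..

lemma trivial_pairT {M X : C} (f g : X ⟶ M) (w : f ≫ 𝟙 M = g ≫ 𝟙 M) :
    pairT (𝟙 (𝟭 C)) f g w ≫ base (𝟙 (𝟭 C)) 2 M = f := by
  rw [← trivial_proj C 0]; exact pairT_fst ..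

lemma trivial_isIso_base (M : C) : IsIso (base (𝟙 (𝟭 C)) 2 M) := by
  refine ⟨pair (𝟙 (𝟭 C)) (𝟙 M) (𝟙 M) rfl, ?_, trivial_pair C _ _ _⟩
  have h : (base (𝟙 (𝟭 C)) 2 M ≫ pair (𝟙 (𝟭 C)) (𝟙 M) (𝟙 M) rfl) ≫ base (𝟙 (𝟭 C)) 2 M =
      𝟙 _ ≫ base (𝟙 (𝟭 C)) 2 M := by
    rw [Category.assoc, trivial_pair, Category.id_comp]; exact Category.comp_id _
  exact fiberPower_hom_ext _ h fun i => by rw [trivial_proj]; exact h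

/-- The trivial tangent structure: the tangent bundle functor is the identity functor, and all
the structure maps are identities (up to the canonical isomorphism `T₂ M ≅ M`). -/
noncomputable def trivialTangentStructure : TangentStructure C where
  T := 𝟭 C
  p := 𝟙 (𝟭 C)
  z := 𝟙 (𝟭 C)
  s := { app := fun M => base (𝟙 (𝟭 C)) 2 M
         naturality := fun _ _ f => fiberPower_map_base _ f }
  l := 𝟙 (𝟭 C)
  c := 𝟙 (𝟭 C)
  z_p M := Category.id_comp _
  s_p M := congrArg (· ≫ 𝟙 M) (trivial_proj C 0 M).symm
  s_comm M := (trivial_pair C _ _ _).trans (trivial_proj C 1 M)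
  s_assoc M := (trivial_pair C _ _ _).trans ((trivial_pair C _ _ _).trans
    (trivial_pair C _ _ _).symm)
  zero_s M := (trivial_pair C _ _ _).trans (Category.id_comp _)
  l_p M := rfl
  z_l M := rfl
  s_l M := (trivial_pairT C _ _ _).trans (congrArg (· ≫ 𝟙 M) (trivial_proj C 0 M))
  c_p M := Category.id_comp _
  z_c M := Category.id_comp _
  s_c M := (trivial_pairT C _ _ _).trans (congrArg (· ≫ 𝟙 M) (trivial_proj C 0 M))
  l_l M := rfl
  c_c M := Category.id_comp _
  c_braid M := rfl
  l_c M := Category.id_comp _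
  l_c_c M := (congrArg (𝟙 M ≫ ·) (Category.id_comp (𝟙 M)))
  universal M := by
    have h1 : pairT (𝟙 (𝟭 C)) (proj (𝟙 (𝟭 C)) 0 M ≫ 𝟙 M) (proj (𝟙 (𝟭 C)) 1 M ≫ 𝟙 M)
        (by rw [trivial_proj, trivial_proj]) ≫ base (𝟙 (𝟭 C)) 2 M = base (𝟙 (𝟭 C)) 2 M :=
      (trivial_pairT C _ _ _).trans ((Category.comp_id _).trans (trivial_proj C 0 M))
    have h2 : proj (𝟙 (𝟭 C)) 0 M ≫ 𝟙 M = base (𝟙 (𝟭 C)) 2 M :=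
      (Category.comp_id _).trans (trivial_proj C 0 M)
    have := trivial_isIso_base C M
    have key : IsPullback (base (𝟙 (𝟭 C)) 2 M) (base (𝟙 (𝟭 C)) 2 M) (𝟙 M) (𝟙 M) :=
      IsPullback.of_horiz_isIso ⟨rfl⟩
    rw [← h2] at key
    nth_rewrite 1 [h2, ← h1] at key
    exact key

end Trivial


/-! ### The tangent structure of Kähler differentials on affine schemes -/

noncomputable section Kaehler

/-- The tangent algebra `Sym_A Ω_{A/R}` of a commutative `R`-algebra `A`. -/
def TanAlg (R A : Type u) [CommRing R] [CommRing A] [Algebra R A] : Type u :=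
  SymmetricAlgebra A Ω[A⁄R]

namespace TanAlg

variable {R : Type u} [CommRing R] {A B B' : Type u} [CommRing A] [Algebra R A]
  [CommRing B] [Algebra R B] [CommRing B'] [Algebra R B']

instance : CommRing (TanAlg R A) := inferInstanceAs (CommRing (SymmetricAlgebra A Ω[A⁄R]))

instance : Algebra A (TanAlg R A) := inferInstanceAs (Algebra A (SymmetricAlgebra A Ω[A⁄R]))

instance : Algebra R (TanAlg R A) := inferInstanceAs (Algebra R (SymmetricAlgebra A Ω[A⁄R]))

instance : IsScalarTower R A (TanAlg R A) :=
  inferInstanceAs (IsScalarTower R A (SymmetricAlgebra A Ω[A⁄R]))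

variable (R A) in
/-- The canonical map from the module of Kähler differentials to its symmetric algebra. -/
def ι : Ω[A⁄R] →ₗ[A] TanAlg R A := SymmetricAlgebra.ι A Ω[A⁄R]

/-- The universal property of the symmetric algebra. -/
def symLift {B : Type u} [CommRing B] [Algebra A B] (φ : Ω[A⁄R] →ₗ[A] B) : TanAlg R A →ₐ[A] B := SymmetricAlgebra.lift φ

lemma symLift_ι {B : Type u} [CommRing B] [Algebra A B] (φ : Ω[A⁄R] →ₗ[A] B) (x : Ω[A⁄R]) :
    symLift φ (ι R A x) = φ x :=
  SymmetricAlgebra.lift_ι_apply φ x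

variable (R A) in
/-- The structure map `A → Sym_A Ω_{A/R}`. -/
def incl : A →ₐ[R] TanAlg R A := IsScalarTower.toAlgHom R A _

variable (R A) in
/-- The universal derivation, seen as a map `A → Sym_A Ω_{A/R}`. -/
def d : A →ₗ[R] TanAlg R A :=
  ((ι R A).restrictScalars R).comp (KaehlerDifferential.D R A).toLinearMap

lemma d_mul (a b : A) : d R A (a * b) = incl R A a * d R A b + incl R A b * d R A a := by
  simp [d, incl, Algebra.smul_def]

/-- The linear map `δ` is a derivation along the algebra map `f`. -/
structure IsDer (f : A →ₐ[R] B) (δ : A →ₗ[R] B) : Prop where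
  leibniz : ∀ a b, δ (a * b) = f a * δ b + f b * δ a

/-- The algebra map `a ↦ f a + δ a • ε` for `δ` a derivation along `f`. -/
def mkDual (f : A →ₐ[R] B) (δ : A →ₗ[R] B)
    (h : IsDer f δ) : A →ₐ[R] B[ε] :=
  AlgHom.ofLinearMap
    ((TrivSqZeroExt.inlAlgHom R B B).toLinearMap.comp f.toLinearMap +
      ((TrivSqZeroExt.inrHom B B).restrictScalars R).comp δ)
    (by
      have h1 := h.leibniz 1 1
      have h2 : δ 1 = 0 := by simpa using h1
      ext <;> simp [h2])
    (fun a b => by ext <;> simp [h.leibniz, mul_comm])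

@[simp] lemma fst_mkDual (f : A →ₐ[R] B) (δ : A →ₗ[R] B)
    (h : IsDer f δ) (a : A) : (mkDual f δ h a).fst = f a := by
  simp [mkDual]

@[simp] lemma snd_mkDual (f : A →ₐ[R] B) (δ : A →ₗ[R] B)
    (h : IsDer f δ) (a : A) : (mkDual f δ h a).snd = δ a := by
  simp [mkDual]

/-- The algebra map `Sym_A Ω_{A/R} → B` with `a ↦ f a` and `da ↦ δ a`,
for `δ` a derivation along `f`. -/
def lift (f : A →ₐ[R] B) (δ : A →ₗ[R] B)
    (h : IsDer f δ) : TanAlg R A →ₐ[R] B :=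
  letI : Algebra A B := f.toRingHom.toAlgebra
  haveI : IsScalarTower R A B := IsScalarTower.of_algebraMap_eq fun r => (f.commutes r).symm
  (symLift
    (Derivation.mk' δ h.leibniz).liftKaehlerDifferential).restrictScalars R

@[simp] lemma lift_incl (f : A →ₐ[R] B) (δ : A →ₗ[R] B)
    (h : IsDer f δ) (a : A) : lift f δ h (incl R A a) = f a := by
  let _ : Algebra A B := f.toRingHom.toAlgebra
  have : IsScalarTower R A B := IsScalarTower.of_algebraMap_eq fun r => (f.commutes r).symm
  exact AlgHom.commutes (symLift
    (Derivation.mk' δ h.leibniz).liftKaehlerDifferential) a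

@[simp] lemma lift_d (f : A →ₐ[R] B) (δ : A →ₗ[R] B)
    (h : IsDer f δ) (a : A) : lift f δ h (d R A a) = δ a := by
  let _ : Algebra A B := f.toRingHom.toAlgebra
  have : IsScalarTower R A B := IsScalarTower.of_algebraMap_eq fun r => (f.commutes r).symm
  refine (symLift_ι (Derivation.mk' δ h.leibniz).liftKaehlerDifferential _).trans ?_
  exact Derivation.liftKaehlerDifferential_comp_D _ a

lemma hom_ext {f g : TanAlg R A →ₐ[R] B} (h1 : ∀ a, f (incl R A a) = g (incl R A a))
    (h2 : ∀ a, f (d R A a) = g (d R A a)) : f = g := by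
  let _ : Algebra A B := (f.comp (incl R A)).toRingHom.toAlgebra
  have : IsScalarTower R A B :=
    IsScalarTower.of_algebraMap_eq fun r => ((f.comp (incl R A)).commutes r).symm
  let f' : TanAlg R A →ₐ[A] B := { f with commutes' := fun a => rfl }
  let g' : TanAlg R A →ₐ[A] B := { g with commutes' := fun a => (h1 a).symm }
  have h : f' = g' := by
    apply SymmetricAlgebra.algHom_ext
    apply Derivation.liftKaehlerDifferential_unique
    ext a
    exact h2 a
  ext x
  exact congrArg (fun k : TanAlg R A →ₐ[A] B => k x) h

/-- The functoriality of the tangent algebra: `a ↦ f a` and `da ↦ d (f a)`. -/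
def map (f : A →ₐ[R] B) : TanAlg R A →ₐ[R] TanAlg R B :=
  lift ((incl R B).comp f) ((d R B).comp f.toLinearMap) ⟨by intro a b; simp [d_mul]⟩

@[simp] lemma map_incl (f : A →ₐ[R] B) (a : A) : map f (incl R A a) = incl R B (f a) := by
  simp [map]

@[simp] lemma map_d (f : A →ₐ[R] B) (a : A) : map f (d R A a) = d R B (f a) := by
  simp [map]

/-- Algebra maps `A → B[ε]` correspond to algebra maps `Sym_A Ω_{A/R} → B`. -/
def liftDual (g : A →ₐ[R] B[ε]) : TanAlg R A →ₐ[R] B :=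
  lift ((TrivSqZeroExt.fstHom R B B).comp g)
    (((TrivSqZeroExt.sndHom B B).restrictScalars R).comp g.toLinearMap) ⟨by
      intro a b; simp [mul_comm]⟩

@[simp] lemma liftDual_incl (g : A →ₐ[R] B[ε]) (a : A) :
    liftDual g (incl R A a) = (g a).fst := by simp [liftDual]

@[simp] lemma liftDual_d (g : A →ₐ[R] B[ε]) (a : A) :
    liftDual g (d R A a) = (g a).snd := by simp [liftDual]

/-- Algebra maps `Sym_A Ω_{A/R} → B` correspond to algebra maps `A → B[ε]`. -/
def toDual (f : TanAlg R A →ₐ[R] B) : A →ₐ[R] B[ε] :=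
  mkDual (f.comp (incl R A)) (f.toLinearMap.comp (d R A)) ⟨by intro a b; simp [d_mul]⟩

@[simp] lemma fst_toDual (f : TanAlg R A →ₐ[R] B) (a : A) :
    (toDual f a).fst = f (incl R A a) := by simp [toDual]

@[simp] lemma snd_toDual (f : TanAlg R A →ₐ[R] B) (a : A) :
    (toDual f a).snd = f (d R A a) := by simp [toDual]

/-- The functoriality of the dual numbers. -/
def dualMap (f : B →ₐ[R] B') : B[ε] →ₐ[R] B'[ε] :=
  mkDual (f.comp (TrivSqZeroExt.fstHom R B B))
    (f.toLinearMap.comp ((TrivSqZeroExt.sndHom B B).restrictScalars R))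
    ⟨by intro a b; simp [mul_comm]⟩

@[simp] lemma fst_dualMap (f : B →ₐ[R] B') (x : B[ε]) : (dualMap f x).fst = f x.fst := by
  simp [dualMap]

@[simp] lemma snd_dualMap (f : B →ₐ[R] B') (x : B[ε]) : (dualMap f x).snd = f x.snd := by
  simp [dualMap]

lemma liftDual_toDual (f : TanAlg R A →ₐ[R] B) : liftDual (toDual f) = f := by
  apply hom_ext <;> intro a <;> simp

lemma toDual_liftDual (g : A →ₐ[R] B[ε]) : toDual (liftDual g) = g := by
  apply AlgHom.ext; intro a; apply TrivSqZeroExt.ext <;> simp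

lemma liftDual_comp (f : A →ₐ[R] B) (g : B →ₐ[R] B'[ε]) :
    liftDual (g.comp f) = (liftDual g).comp (map f) := by
  apply hom_ext <;> intro a <;> simp

lemma toDual_comp (f : TanAlg R A →ₐ[R] B) (g : B →ₐ[R] B') :
    toDual (g.comp f) = (dualMap g).comp (toDual f) := by
  apply AlgHom.ext; intro a; apply TrivSqZeroExt.ext <;> simp

lemma dualMap_id : dualMap (AlgHom.id R B) = AlgHom.id R B[ε] := by
  apply AlgHom.ext; intro a; apply TrivSqZeroExt.ext <;> simp

lemma dualMap_comp {B'' : Type u} [CommRing B''] [Algebra R B''] (f : B →ₐ[R] B')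
    (g : B' →ₐ[R] B'') : dualMap (g.comp f) = (dualMap g).comp (dualMap f) := by
  apply AlgHom.ext; intro a; apply TrivSqZeroExt.ext <;> simp

variable (R A) in
/-- The zero morphism: `a ↦ a` and `da ↦ 0`. -/
def zero : TanAlg R A →ₐ[R] A := lift (AlgHom.id R A) 0 ⟨by intro a b; simp⟩

@[simp] lemma zero_incl (a : A) : zero R A (incl R A a) = a := by simp [zero]
@[simp] lemma zero_d (a : A) : zero R A (d R A a) = 0 := by simp [zero]

variable (R A) in
/-- The vertical lift: `a ↦ a`, `da ↦ 0`, `d(a) ↦ 0` and `d(da) ↦ da`, where `d` denotes both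
universal derivations. -/
def vlift : TanAlg R (TanAlg R A) →ₐ[R] TanAlg R A :=
  liftDual (liftDual (mkDual ((TrivSqZeroExt.inlAlgHom R _ _).comp (incl R A))
    (((TrivSqZeroExt.inrHom _ (TanAlg R A)).restrictScalars R).comp (d R A)) ⟨by
      intro a b; ext <;> simp [d_mul, mul_comm]⟩))

@[simp] lemma vlift_incl_incl (a : A) : vlift R A (incl R _ (incl R A a)) = incl R A a := by
  simp [vlift]
@[simp] lemma vlift_incl_d (a : A) : vlift R A (incl R _ (d R A a)) = 0 := by
  simp [vlift]
@[simp] lemma vlift_d_incl (a : A) : vlift R A (d R _ (incl R A a)) = 0 := by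
  simp [vlift]
@[simp] lemma vlift_d_d (a : A) : vlift R A (d R _ (d R A a)) = d R A a := by
  simp [vlift]

variable (R A) in
/-- The canonical flip: `a ↦ a`, `da ↦ d(a)`, `d(a) ↦ da` and `d(da) ↦ d(da)`, where `d` denotes
both universal derivations. -/
def flip : TanAlg R (TanAlg R A) →ₐ[R] TanAlg R (TanAlg R A) :=
  liftDual (liftDual (mkDual
    (mkDual ((incl R _).comp (incl R A)) ((incl R _).toLinearMap.comp (d R A)) ⟨by
      intro a b; simp [d_mul]⟩)
    (((TrivSqZeroExt.inlAlgHom R _ _).toLinearMap.comp ((d R _).comp (incl R A).toLinearMap)) +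
      ((TrivSqZeroExt.inrHom _ (TanAlg R (TanAlg R A))).restrictScalars R).comp
        ((d R _).comp (d R A)))
    ⟨by
      intro a b
      ext
      · simp [d_mul]
      · simp [d_mul]; ring⟩))

@[simp] lemma flip_incl_incl (a : A) :
    flip R A (incl R _ (incl R A a)) = incl R _ (incl R A a) := by simp [flip]
@[simp] lemma flip_incl_d (a : A) :
    flip R A (incl R _ (d R A a)) = d R _ (incl R A a) := by simp [flip]
@[simp] lemma flip_d_incl (a : A) :
    flip R A (d R _ (incl R A a)) = incl R _ (d R A a) := by simp [flip]
@[simp] lemma flip_d_d (a : A) :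
    flip R A (d R _ (d R A a)) = d R _ (d R A a) := by simp [flip]

lemma hom_ext2 {f g : TanAlg R (TanAlg R A) →ₐ[R] B}
    (h1 : ∀ a, f (incl R _ (incl R A a)) = g (incl R _ (incl R A a)))
    (h2 : ∀ a, f (incl R _ (d R A a)) = g (incl R _ (d R A a)))
    (h3 : ∀ a, f (d R _ (incl R A a)) = g (d R _ (incl R A a)))
    (h4 : ∀ a, f (d R _ (d R A a)) = g (d R _ (d R A a))) : f = g := by
  rw [← liftDual_toDual f, ← liftDual_toDual g]
  congr 1
  apply hom_ext <;> intro a <;> apply TrivSqZeroExt.ext <;> simp [h1, h2, h3, h4]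

lemma hom_ext3 {f g : TanAlg R (TanAlg R (TanAlg R A)) →ₐ[R] B}
    (h1 : ∀ a, f (incl R _ (incl R _ (incl R A a))) = g (incl R _ (incl R _ (incl R A a))))
    (h2 : ∀ a, f (incl R _ (incl R _ (d R A a))) = g (incl R _ (incl R _ (d R A a))))
    (h3 : ∀ a, f (incl R _ (d R _ (incl R A a))) = g (incl R _ (d R _ (incl R A a))))
    (h4 : ∀ a, f (incl R _ (d R _ (d R A a))) = g (incl R _ (d R _ (d R A a))))
    (h5 : ∀ a, f (d R _ (incl R _ (incl R A a))) = g (d R _ (incl R _ (incl R A a))))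
    (h6 : ∀ a, f (d R _ (incl R _ (d R A a))) = g (d R _ (incl R _ (d R A a))))
    (h7 : ∀ a, f (d R _ (d R _ (incl R A a))) = g (d R _ (d R _ (incl R A a))))
    (h8 : ∀ a, f (d R _ (d R _ (d R A a))) = g (d R _ (d R _ (d R A a)))) : f = g := by
  rw [← liftDual_toDual f, ← liftDual_toDual g]
  congr 1
  apply hom_ext2 <;> intro a <;> apply TrivSqZeroExt.ext <;>
    simp [h1, h2, h3, h4, h5, h6, h7, h8]

lemma zero_natural (f : A →ₐ[R] B) : f.comp (zero R A) = (zero R B).comp (map f) := by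
  apply hom_ext <;> intro a <;> simp

lemma vlift_natural (f : A →ₐ[R] B) :
    (map f).comp (vlift R A) = (vlift R B).comp (map (map f)) := by
  apply hom_ext2 <;> intro a <;> simp

lemma flip_natural (f : A →ₐ[R] B) :
    (map (map f)).comp (flip R A) = (flip R B).comp (map (map f)) := by
  apply hom_ext2 <;> intro a <;> simp

variable (R A)

lemma zero_comp_incl : (zero R A).comp (incl R A) = AlgHom.id R A := by
  ext a; simp

lemma vlift_comp_map_incl : (vlift R A).comp (map (incl R A)) = (incl R A).comp (zero R A) := by
  apply hom_ext <;> intro a <;> simp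

lemma zero_comp_vlift : (zero R A).comp (vlift R A) = (zero R A).comp (map (zero R A)) := by
  apply hom_ext2 <;> intro a <;> simp

lemma flip_comp_map_incl : (flip R A).comp (map (incl R A)) = incl R (TanAlg R A) := by
  apply hom_ext <;> intro a <;> simp

lemma zero_comp_flip : (zero R (TanAlg R A)).comp (flip R A) = map (zero R A) := by
  apply hom_ext2 <;> intro a <;> simp

lemma vlift_comp_map_vlift :
    (vlift R A).comp (map (vlift R A)) = (vlift R A).comp (vlift R (TanAlg R A)) := by
  apply hom_ext3 <;> intro a <;> simp

lemma flip_comp_flip : (flip R A).comp (flip R A) = AlgHom.id R _ := by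
  apply hom_ext2 <;> intro a <;> simp

lemma flip_braid :
    (map (flip R A)).comp ((flip R (TanAlg R A)).comp (map (flip R A))) =
      (flip R (TanAlg R A)).comp ((map (flip R A)).comp (flip R (TanAlg R A))) := by
  apply hom_ext3 <;> intro a <;> simp

lemma vlift_comp_flip : (vlift R A).comp (flip R A) = vlift R A := by
  apply hom_ext2 <;> intro a <;> simp

lemma vlift_flip_flip :
    (vlift R (TanAlg R A)).comp ((map (flip R A)).comp (flip R (TanAlg R A))) =
      (flip R A).comp (map (vlift R A)) := by
  apply hom_ext3 <;> intro a <;> simp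

end TanAlg


section Structure

variable (R : Type u) [CommRing R]

/-- The category of affine schemes over `R`, as the opposite of the category of commutative
`R`-algebras. -/
abbrev Aff : Type (u + 1) := (CommAlgCat.{u} R)ᵒᵖ

/-- The functor `A ↦ Sym_A Ω_{A/R}` on commutative `R`-algebras. -/
def tanFunctor : CommAlgCat.{u} R ⥤ CommAlgCat.{u} R where
  obj A := .of R (TanAlg R A)
  map f := CommAlgCat.ofHom (TanAlg.map f.hom)
  map_id A := by
    apply CommAlgCat.hom_ext
    apply TanAlg.hom_ext <;> intro a <;> simp
  map_comp f g := by
    apply CommAlgCat.hom_ext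
    apply TanAlg.hom_ext <;> intro a <;> simp

/-- The functor `B ↦ B[ε]` on commutative `R`-algebras. -/
def dualFunctor : CommAlgCat.{u} R ⥤ CommAlgCat.{u} R where
  obj B := .of R B[ε]
  map f := CommAlgCat.ofHom (TanAlg.dualMap f.hom)
  map_id _ := CommAlgCat.hom_ext TanAlg.dualMap_id
  map_comp f g := CommAlgCat.hom_ext (TanAlg.dualMap_comp f.hom g.hom)

/-- The functor `A ↦ Sym_A Ω_{A/R}` is left adjoint to `B ↦ B[ε]`. -/
def tanAdj : tanFunctor R ⊣ dualFunctor R :=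
  Adjunction.mkOfHomEquiv
    { homEquiv := fun _ _ =>
        { toFun := fun f => CommAlgCat.ofHom (TanAlg.toDual f.hom)
          invFun := fun g => CommAlgCat.ofHom (TanAlg.liftDual g.hom)
          left_inv := fun f => CommAlgCat.hom_ext (TanAlg.liftDual_toDual f.hom)
          right_inv := fun g => CommAlgCat.hom_ext (TanAlg.toDual_liftDual g.hom) }
      homEquiv_naturality_left_symm := fun f g =>
        CommAlgCat.hom_ext (TanAlg.liftDual_comp f.hom g.hom)
      homEquiv_naturality_right := fun f g =>
        CommAlgCat.hom_ext (TanAlg.toDual_comp f.hom g.hom) }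

/-- The projection `T ⟶ 𝟭` on affine schemes, given by `A → Sym_A Ω_{A/R}`. -/
def kProj : (tanFunctor R).op ⟶ 𝟭 (Aff R) where
  app X := (CommAlgCat.ofHom (TanAlg.incl R X.unop)).op
  naturality X Y f := by
    apply Quiver.Hom.unop_inj
    apply CommAlgCat.hom_ext
    ext a
    exact (TanAlg.map_incl f.unop.hom a)

instance (k : ℕ) : (iter (tanFunctor R).op k).IsRightAdjoint := by
  have h : (tanFunctor R).op.IsRightAdjoint := (tanAdj R).op.isRightAdjoint
  induction k with
  | zero => exact inferInstanceAs (𝟭 (Aff R)).IsRightAdjoint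
  | succ k ih => exact inferInstanceAs (iter (tanFunctor R).op k ⋙ (tanFunctor R).op).IsRightAdjoint

instance : HasFiberPowers (kProj R) where
  hasLimit _ _ := inferInstance
  preserves _ _ _ := inferInstance

variable {R}

/-- The coordinate algebra of `Tₙ X`. -/
abbrev coordTn (n : ℕ) (X : Aff R) : Type u := ((fiberPower (kProj R) n).obj X).unop

/-- The algebra map dual to `πᵢ`. -/
def cproj {n : ℕ} (i : Fin n) (X : Aff R) : TanAlg R X.unop →ₐ[R] coordTn n X :=
  (proj (kProj R) i X).unop.hom

/-- The algebra map dual to the base map. -/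
def cbase (n : ℕ) (X : Aff R) : X.unop →ₐ[R] coordTn n X :=
  (base (kProj R) n X).unop.hom

@[simp] lemma cproj_incl {n : ℕ} (i : Fin n) (X : Aff R) (a : X.unop) :
    cproj i X (TanAlg.incl R X.unop a) = cbase n X a :=
  congrArg (fun h => h.unop.hom a) (proj_p (kProj R) i X)

lemma coordTn_ext {n : ℕ} {X : Aff R} {B : Type u} [CommRing B] [Algebra R B]
    {f g : coordTn n X →ₐ[R] B} (hb : ∀ a, f (cbase n X a) = g (cbase n X a))
    (hp : ∀ i a, f (cproj i X (TanAlg.d R X.unop a)) = g (cproj i X (TanAlg.d R X.unop a))) :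
    f = g := by
  have key : (CommAlgCat.ofHom f).op = (CommAlgCat.ofHom g).op := by
    refine fiberPower_hom_ext (kProj R) (X := op (CommAlgCat.of R B)) ?_ fun i => ?_
    · exact Quiver.Hom.unop_inj (CommAlgCat.hom_ext (AlgHom.ext hb))
    · refine Quiver.Hom.unop_inj (CommAlgCat.hom_ext (TanAlg.hom_ext (fun a => ?_) (hp i)))
      change f (cproj i X _) = g (cproj i X _)
      rw [cproj_incl, hb]
  exact congrArg (fun h => h.unop.hom) key

section Pairs

variable {X : Aff R} {B : Type u} [CommRing B] [Algebra R B]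

/-- The algebra map dual to a pairing into `T₂ X`. -/
def cpair (f g : TanAlg R X.unop →ₐ[R] B)
    (w : f.comp (TanAlg.incl R X.unop) = g.comp (TanAlg.incl R X.unop)) : coordTn 2 X →ₐ[R] B :=
  (pair (kProj R) (X := op (CommAlgCat.of R B)) (CommAlgCat.ofHom f).op (CommAlgCat.ofHom g).op
    (Quiver.Hom.unop_inj (CommAlgCat.hom_ext w))).unop.hom

variable (f g : TanAlg R X.unop →ₐ[R] B)
    (w : f.comp (TanAlg.incl R X.unop) = g.comp (TanAlg.incl R X.unop))

@[simp] lemma cpair_cproj0 (x : TanAlg R X.unop) : cpair f g w (cproj 0 X x) = f x :=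
  congrArg (fun h => h.unop.hom x) (pair_fst (kProj R) (X := op (CommAlgCat.of R B)) _ _ _)

@[simp] lemma cpair_cproj1 (x : TanAlg R X.unop) : cpair f g w (cproj 1 X x) = g x :=
  congrArg (fun h => h.unop.hom x) (pair_snd (kProj R) (X := op (CommAlgCat.of R B)) _ _ _)

@[simp] lemma cpair_cbase (a : X.unop) :
    cpair f g w (cbase 2 X a) = f (TanAlg.incl R X.unop a) := by
  rw [← cproj_incl 0, cpair_cproj0]

end Pairs

section PairsT

variable {X : Aff R} {B : Type u} [CommRing B] [Algebra R B]

/-- The algebra map dual to a pairing into `T (T₂ X)`. -/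
def cpairT (f g : TanAlg R (TanAlg R X.unop) →ₐ[R] B)
    (w : f.comp (TanAlg.map (TanAlg.incl R X.unop)) =
      g.comp (TanAlg.map (TanAlg.incl R X.unop))) : TanAlg R (coordTn 2 X) →ₐ[R] B :=
  (pairT (kProj R) (X := op (CommAlgCat.of R B)) (CommAlgCat.ofHom f).op (CommAlgCat.ofHom g).op
    (Quiver.Hom.unop_inj (CommAlgCat.hom_ext w))).unop.hom

variable (f g : TanAlg R (TanAlg R X.unop) →ₐ[R] B)
    (w : f.comp (TanAlg.map (TanAlg.incl R X.unop)) =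
      g.comp (TanAlg.map (TanAlg.incl R X.unop)))

@[simp] lemma cpairT_map0 (x : TanAlg R (TanAlg R X.unop)) :
    cpairT f g w (TanAlg.map (cproj 0 X) x) = f x :=
  congrArg (fun h => h.unop.hom x) (pairT_fst (kProj R) (X := op (CommAlgCat.of R B)) _ _ _)

@[simp] lemma cpairT_map1 (x : TanAlg R (TanAlg R X.unop)) :
    cpairT f g w (TanAlg.map (cproj 1 X) x) = g x :=
  congrArg (fun h => h.unop.hom x) (pairT_snd (kProj R) (X := op (CommAlgCat.of R B)) _ _ _)

@[simp] lemma cpairT_incl_cproj0 (x : TanAlg R X.unop) :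
    cpairT f g w (TanAlg.incl R _ (cproj 0 X x)) = f (TanAlg.incl R _ x) := by
  rw [← TanAlg.map_incl, cpairT_map0]

@[simp] lemma cpairT_incl_cproj1 (x : TanAlg R X.unop) :
    cpairT f g w (TanAlg.incl R _ (cproj 1 X x)) = g (TanAlg.incl R _ x) := by
  rw [← TanAlg.map_incl, cpairT_map1]

@[simp] lemma cpairT_d_cproj0 (x : TanAlg R X.unop) :
    cpairT f g w (TanAlg.d R _ (cproj 0 X x)) = f (TanAlg.d R _ x) := by
  rw [← TanAlg.map_d, cpairT_map0]

@[simp] lemma cpairT_d_cproj1 (x : TanAlg R X.unop) :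
    cpairT f g w (TanAlg.d R _ (cproj 1 X x)) = g (TanAlg.d R _ x) := by
  rw [← TanAlg.map_d, cpairT_map1]

@[simp] lemma cpairT_incl_cbase (a : X.unop) :
    cpairT f g w (TanAlg.incl R _ (cbase 2 X a)) = f (TanAlg.incl R _ (TanAlg.incl R _ a)) := by
  rw [← cproj_incl 0, cpairT_incl_cproj0]

@[simp] lemma cpairT_d_cbase (a : X.unop) :
    cpairT f g w (TanAlg.d R _ (cbase 2 X a)) = f (TanAlg.d R _ (TanAlg.incl R _ a)) := by
  rw [← cproj_incl 0, cpairT_d_cproj0]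

end PairsT

/-- The algebra map dual to the sum morphism: `a ↦ a` and `da ↦ π₀(da) + π₁(da)`. -/
def csum (X : Aff R) : TanAlg R X.unop →ₐ[R] coordTn 2 X :=
  TanAlg.lift (cbase 2 X)
    ((cproj 0 X).toLinearMap.comp (TanAlg.d R X.unop) +
      (cproj 1 X).toLinearMap.comp (TanAlg.d R X.unop))
    ⟨by intro a b; simp [TanAlg.d_mul]; ring⟩

@[simp] lemma csum_incl (X : Aff R) (a : X.unop) :
    csum X (TanAlg.incl R X.unop a) = cbase 2 X a := by simp [csum]

@[simp] lemma csum_d (X : Aff R) (a : X.unop) :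
    csum X (TanAlg.d R X.unop a) =
      cproj 0 X (TanAlg.d R X.unop a) + cproj 1 X (TanAlg.d R X.unop a) := by simp [csum]


lemma csum_natural {X Y : Aff R} (f : X ⟶ Y) :
    (((fiberPower (kProj R) 2).map f).unop.hom).comp (csum Y) =
      (csum X).comp (TanAlg.map f.unop.hom) := by
  have hb : ∀ a, ((fiberPower (kProj R) 2).map f).unop.hom (cbase 2 Y a) =
      cbase 2 X (f.unop.hom a) := fun a =>
    congrArg (fun h => h.unop.hom a) (fiberPower_map_base (kProj R) (n := 2) f)
  have hp : ∀ i x, ((fiberPower (kProj R) 2).map f).unop.hom (cproj i Y x) =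
      cproj i X (TanAlg.map f.unop.hom x) := fun i x =>
    congrArg (fun h => h.unop.hom x) (fiberPower_map_proj (kProj R) i f)
  apply TanAlg.hom_ext <;> intro a <;> simp [hb, hp]

lemma csum_comp_incl (X : Aff R) :
    (csum X).comp (TanAlg.incl R X.unop) = (cproj 0 X).comp (TanAlg.incl R X.unop) := by
  ext a; simp

lemma cproj_w {n : ℕ} (i j : Fin n) (X : Aff R) :
    (cproj i X).comp (TanAlg.incl R X.unop) = (cproj j X).comp (TanAlg.incl R X.unop) := by
  ext a; simp

lemma csum_comm (X : Aff R) :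
    (cpair (cproj 1 X) (cproj 0 X) (cproj_w 1 0 X)).comp (csum X) = csum X := by
  apply TanAlg.hom_ext <;> intro a <;> simp [add_comm]

lemma csum_assoc (X : Aff R) :
    (cpair (B := coordTn 3 X) ((cpair (cproj 0 X) (cproj 1 X) (cproj_w 0 1 X)).comp (csum X))
      (cproj 2 X) (by ext a; simp)).comp (csum X) =
    (cpair (B := coordTn 3 X) (cproj 0 X)
      ((cpair (cproj 1 X) (cproj 2 X) (cproj_w 1 2 X)).comp (csum X))
      (by ext a; simp)).comp (csum X) := by
  apply TanAlg.hom_ext <;> intro a <;> simp [add_assoc]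

lemma csum_zero (X : Aff R) :
    (cpair ((TanAlg.incl R X.unop).comp (TanAlg.zero R X.unop))
      (AlgHom.id R (TanAlg R X.unop)) (by ext a; simp)).comp (csum X) = AlgHom.id R _ := by
  apply TanAlg.hom_ext <;> intro a <;> simp

lemma csum_vlift (X : Aff R) :
    (cpairT ((cproj 0 X).comp (TanAlg.vlift R X.unop))
      ((cproj 1 X).comp (TanAlg.vlift R X.unop)) (by
        apply TanAlg.hom_ext <;> intro a <;> simp)).comp (TanAlg.map (csum X)) =
    (csum X).comp (TanAlg.vlift R X.unop) := by
  apply TanAlg.hom_ext2 <;> intro a <;> simp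

lemma csum_flip (X : Aff R) :
    (cpairT ((cproj 0 (op (.of R (TanAlg R X.unop)))).comp (TanAlg.flip R X.unop))
      ((cproj 1 (op (.of R (TanAlg R X.unop)))).comp (TanAlg.flip R X.unop)) (by
        rw [AlgHom.comp_assoc, AlgHom.comp_assoc, TanAlg.flip_comp_map_incl]
        exact cproj_w 0 1 (op (.of R (TanAlg R X.unop))))).comp (TanAlg.map (csum X)) =
    (csum (op (.of R (TanAlg R X.unop)))).comp (TanAlg.flip R X.unop) := by
  have e1 : ∀ a : TanAlg R X.unop, csum (op (.of R (TanAlg R X.unop))) (TanAlg.incl R _ a) =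
      cbase 2 (op (.of R (TanAlg R X.unop))) a := csum_incl (op (.of R (TanAlg R X.unop)))
  have e2 : ∀ a : TanAlg R X.unop, csum (op (.of R (TanAlg R X.unop))) (TanAlg.d R _ a) =
      cproj 0 (op (.of R (TanAlg R X.unop))) (TanAlg.d R _ a) +
        cproj 1 (op (.of R (TanAlg R X.unop))) (TanAlg.d R _ a) :=
    csum_d (op (.of R (TanAlg R X.unop)))
  have e3 : ∀ (i : Fin 2) (a : TanAlg R X.unop),
      cproj i (op (.of R (TanAlg R X.unop))) (TanAlg.incl R _ a) =
      cbase 2 (op (.of R (TanAlg R X.unop))) a := fun i => cproj_incl i (op (.of R (TanAlg R X.unop)))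
  apply TanAlg.hom_ext2 <;> intro a <;> simp [e1, e2, e3]

lemma cuniv_w (X : Aff R) :
    ((cproj (n := 2) 0 X).comp (TanAlg.vlift R X.unop)).comp
      (TanAlg.map (TanAlg.incl R X.unop)) =
    ((cproj 1 X).comp (TanAlg.zero R (TanAlg R X.unop))).comp
      (TanAlg.map (TanAlg.incl R X.unop)) := by
  apply TanAlg.hom_ext <;> intro a <;> simp

/-- The dual of the comparison map in the universality of the vertical lift. -/
def cuniv (X : Aff R) : TanAlg R (TanAlg R X.unop) →ₐ[R] coordTn 2 X :=
  (cpairT ((cproj 0 X).comp (TanAlg.vlift R X.unop))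
    ((cproj 1 X).comp (TanAlg.zero R (TanAlg R X.unop))) (cuniv_w X)).comp (TanAlg.map (csum X))

/-- The algebra map out of `T₂` induced by a map killing the elements `d(a)`. -/
def cunivLift {X : Aff R} {B : Type u} [CommRing B] [Algebra R B]
    (u : TanAlg R (TanAlg R X.unop) →ₐ[R] B)
    (h : ∀ a, u (TanAlg.d R _ (TanAlg.incl R X.unop a)) = 0) : coordTn 2 X →ₐ[R] B :=
  cpair
    (TanAlg.lift ((u.comp (TanAlg.incl R _)).comp (TanAlg.incl R _))
      (u.toLinearMap.comp ((TanAlg.d R _).comp (TanAlg.d R _)))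
      ⟨by intro a b; simp [TanAlg.d_mul, h]⟩)
    (u.comp (TanAlg.incl R _))
    (by ext a; simp)

lemma isPullback_cuniv (X : Aff R) :
    IsPullback (C := Aff R) (CommAlgCat.ofHom (cuniv X)).op
      (CommAlgCat.ofHom ((cproj 0 X).comp (TanAlg.incl R X.unop))).op
      (CommAlgCat.ofHom (TanAlg.map (TanAlg.incl R X.unop))).op
      (CommAlgCat.ofHom (TanAlg.zero R X.unop)).op := by
  have hw : (cuniv X).comp (TanAlg.map (TanAlg.incl R X.unop)) =
      ((cproj 0 X).comp (TanAlg.incl R X.unop)).comp (TanAlg.zero R X.unop) := by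
    apply TanAlg.hom_ext <;> intro a <;> simp [cuniv]
  have hs : ∀ s : PullbackCone (C := Aff R)
      (CommAlgCat.ofHom (TanAlg.map (TanAlg.incl R X.unop))).op
      (CommAlgCat.ofHom (TanAlg.zero R X.unop)).op,
      s.fst.unop.hom.comp (TanAlg.map (TanAlg.incl R X.unop)) =
        s.snd.unop.hom.comp (TanAlg.zero R X.unop) :=
    fun s => congrArg (fun h => h.unop.hom) s.condition
  have h0 : ∀ (s : PullbackCone (C := Aff R)
      (CommAlgCat.ofHom (TanAlg.map (TanAlg.incl R X.unop))).op
      (CommAlgCat.ofHom (TanAlg.zero R X.unop)).op) (a : X.unop), s.fst.unop.hom (TanAlg.d R _ (TanAlg.incl R X.unop a)) = 0 := by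
    intro s a
    have := DFunLike.congr_fun (hs s) (TanAlg.d R _ a)
    simpa using this
  refine ⟨⟨Quiver.Hom.unop_inj (CommAlgCat.hom_ext hw)⟩,
    ⟨PullbackCone.IsLimit.mk _
      (fun s => (CommAlgCat.ofHom (cunivLift (X := X) s.fst.unop.hom (h0 s))).op) ?_ ?_ ?_⟩⟩
  · intro s
    refine Quiver.Hom.unop_inj (CommAlgCat.hom_ext ?_)
    change (cunivLift (X := X) s.fst.unop.hom (h0 s)).comp (cuniv X) = s.fst.unop.hom
    apply TanAlg.hom_ext2 <;> intro a <;> simp [cuniv, cunivLift, h0]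
  · intro s
    refine Quiver.Hom.unop_inj (CommAlgCat.hom_ext ?_)
    change (cunivLift (X := X) s.fst.unop.hom (h0 s)).comp
      ((cproj 0 X).comp (TanAlg.incl R X.unop)) = s.snd.unop.hom
    apply AlgHom.ext
    intro a
    have := DFunLike.congr_fun (hs s) (TanAlg.incl R _ a)
    simpa [cunivLift] using this
  · intro s m h1 h2
    refine Quiver.Hom.unop_inj (CommAlgCat.hom_ext ?_)
    change m.unop.hom = cunivLift (X := X) s.fst.unop.hom (h0 s)
    have e1 : m.unop.hom.comp (cuniv X) = s.fst.unop.hom := congrArg (fun h => h.unop.hom) h1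
    rw [← DFunLike.coe_fn_eq] at e1
    apply coordTn_ext
    · intro a
      have := congrFun e1 (TanAlg.incl R _ (TanAlg.incl R _ a))
      simpa [cuniv, cunivLift] using this
    · intro i a
      fin_cases i
      · have := congrFun e1 (TanAlg.d R _ (TanAlg.d R _ a))
        simpa [cuniv, cunivLift] using this
      · have := congrFun e1 (TanAlg.incl R _ (TanAlg.d R _ a))
        simpa [cuniv, cunivLift] using this

lemma aff_ext {A B : CommAlgCat.{u} R} {f g : A →ₐ[R] B} (h : f = g) :
    (CommAlgCat.ofHom f).op = (CommAlgCat.ofHom g).op := by rw [h]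

lemma aff_comp_incl {X Y : Aff R} {f g : X ⟶ (tanFunctor R).op.obj Y}
    (w : f ≫ (kProj R).app Y = g ≫ (kProj R).app Y) :
    f.unop.hom.comp (TanAlg.incl R Y.unop) = g.unop.hom.comp (TanAlg.incl R Y.unop) :=
  congrArg (fun h => h.unop.hom) w

variable (R) in
/-- The tangent structure on affine schemes over `R` whose tangent bundle functor sends `Spec A`
to `Spec (Sym_A Ω_{A/R})`. -/
def kaehlerTangentStructure : TangentStructure (Aff R) where
  T := (tanFunctor R).op
  p := kProj R
  z :=
    { app := fun X => (CommAlgCat.ofHom (TanAlg.zero R X.unop)).op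
      naturality := fun _ _ f => aff_ext (TanAlg.zero_natural f.unop.hom) }
  s :=
    { app := fun X => (CommAlgCat.ofHom (csum X)).op
      naturality := fun _ _ f => aff_ext (csum_natural f) }
  l :=
    { app := fun X => (CommAlgCat.ofHom (TanAlg.vlift R X.unop)).op
      naturality := fun _ _ f => aff_ext (TanAlg.vlift_natural f.unop.hom) }
  c :=
    { app := fun X => (CommAlgCat.ofHom (TanAlg.flip R X.unop)).op
      naturality := fun _ _ f => aff_ext (TanAlg.flip_natural f.unop.hom) }
  z_p X := aff_ext (TanAlg.zero_comp_incl R X.unop)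
  s_p X := aff_ext (csum_comp_incl X)
  s_comm X := aff_ext (csum_comm X)
  s_assoc X := aff_ext (csum_assoc X)
  zero_s X := aff_ext (csum_zero X)
  l_p X := aff_ext (TanAlg.vlift_comp_map_incl R X.unop)
  z_l X := aff_ext (TanAlg.zero_comp_vlift R X.unop)
  s_l X := aff_ext (csum_vlift X)
  c_p X := aff_ext (TanAlg.flip_comp_map_incl R X.unop)
  z_c X := aff_ext (TanAlg.zero_comp_flip R X.unop)
  s_c X := aff_ext (csum_flip X)
  l_l X := aff_ext (TanAlg.vlift_comp_map_vlift R X.unop)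
  c_c X := aff_ext (TanAlg.flip_comp_flip R X.unop)
  c_braid X := aff_ext (TanAlg.flip_braid R X.unop)
  l_c X := aff_ext (TanAlg.vlift_comp_flip R X.unop)
  l_c_c X := aff_ext (TanAlg.vlift_flip_flip R X.unop)
  universal X := isPullback_cuniv X

end Structure
end Kaehler

end TangentCategory

namespace TangentCategory

/-! ### Tangent structures transposed along a left adjoint of `T` -/

noncomputable section Mates

variable {C : Type u} [Category.{v} C] (𝕋 : TangentStructure C)

/-! Representability for n = 1 makes `T` right adjoint to the product with some Spec E, that is, to
the opposite of E ⊗ -. Every structure map then has a mate pointing the other way, and on algebras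
these become natural maps E ⊗ B → B (projection), B → E ⊗ B (zero), E ⊗ B → E ⊗ E ⊗ B (lift) and an
involution of E ⊗ E ⊗ B (flip). The proof is a classification of such algebras E.

The addition carries no information: a natural, commutative, unital operation on algebra maps that
agree over the base is induced by one algebra map out of a fibre product P ×_B P, and additivity of
that map forces the formula f + g - ζπf (`eq_add_sub_of_natural`). As it is also multiplicative and
(x, 0)(0, y) = 0, the kernel of the projection has square zero.

Since E ⊗ - has a left adjoint on algebras, it preserves products and injections. Comparison with
R^E shows that E is a finite module, and with X ↦ rX on R[X] that it is torsion-free; over a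
principal ideal domain it is therefore free. The projection is given by an augmentation E → R: its
restriction to B is substitution into a polynomial, which the zero section forces to be X
(`tProj_one_tmul_X`).

Let I be the augmentation ideal. Universality of the vertical lift says that the lift is an
isomorphism I ≅ I ⊗ I (`existsUnique_coLift`), so the rank n of I satisfies n = n². If n = 0 the
projection is invertible and the structure is trivial. If n = 1, then I² = 0 gives E ≅ R[ε], and the
generator can be rescaled to an e whose lift is e ⊗ e.

What remains is rigidity: with projection and lift normalised, all other components of the zero,
lift and flip are forced by the axioms up to natural derivations B → B, and these vanish
(`eq_zero_of_natural_derivation`). The Kähler structure is normalised in the same sense, hence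
isomorphic to the given one (`IsStandard.nonempty_iso`). Its representability in all degrees comes
from representing `Tₙ` by the square-zero extension of R by Rⁿ. -/

lemma pair_comp {T : C ⥤ C} (p : T ⟶ 𝟭 C) [HasFiberPowers p] {M X Y : C} (h : Y ⟶ X)
    (f g : X ⟶ T.obj M) (w : f ≫ p.app M = g ≫ p.app M) :
    h ≫ pair p f g w = pair p (h ≫ f) (h ≫ g) (by simp only [Category.assoc, w]) := by
  apply fiberPower_hom_ext
  · rw [← proj_p p 0, ← Category.assoc, ← Category.assoc, Category.assoc h, pair_fst, pair_fst]
  · rw [Fin.forall_fin_two]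
    simp only [Category.assoc, pair_fst, pair_snd, and_self]

lemma pair_map {T : C ⥤ C} (p : T ⟶ 𝟭 C) [HasFiberPowers p] {M N X : C} (h : M ⟶ N)
    (f g : X ⟶ T.obj M) (w : f ≫ p.app M = g ≫ p.app M) (w') :
    pair p f g w ≫ (fiberPower p 2).map h = pair p (f ≫ T.map h) (g ≫ T.map h) w' := by
  apply fiberPower_hom_ext
  · rw [← proj_p p 0, ← Category.assoc, ← Category.assoc, Category.assoc (pair p f g w),
      fiberPower_map_proj, ← Category.assoc, pair_fst, pair_fst]
  · rw [Fin.forall_fin_two]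
    simp only [Category.assoc, pair_fst, pair_snd, fiberPower_map_proj]
    simp only [← Category.assoc, pair_fst, pair_snd, and_self]

lemma comp_pairT {T : C ⥤ C} (p : T ⟶ 𝟭 C) [HasFiberPowers p] {M X Y : C} (h : Y ⟶ X)
    (f g : X ⟶ T.obj (T.obj M)) (w : f ≫ T.map (p.app M) = g ≫ T.map (p.app M)) :
    h ≫ pairT p f g w = pairT p (h ≫ f) (h ≫ g) (by simp only [Category.assoc, w]) := by
  refine (isLimitMap p 2 M).hom_ext fun j => ?_
  have h0 : (h ≫ pairT p f g w) ≫ T.map (proj p 0 M) =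
      pairT p (h ≫ f) (h ≫ g) (by simp only [Category.assoc, w]) ≫ T.map (proj p 0 M) := by
    rw [Category.assoc, pairT_fst, pairT_fst]
  cases j with
  | none =>
    change _ ≫ T.map (base p 2 M) = _ ≫ T.map (base p 2 M)
    rw [← proj_p p 0, T.map_comp, ← Category.assoc, h0, Category.assoc]
  | some i =>
    revert i
    rw [Fin.forall_fin_two]
    refine ⟨h0, ?_⟩
    change _ ≫ T.map (proj p 1 M) = _ ≫ T.map (proj p 1 M)
    rw [Category.assoc, pairT_snd, pairT_snd]

lemma pair_eta {T : C ⥤ C} (p : T ⟶ 𝟭 C) [HasFiberPowers p] {M X : C}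
    (k : X ⟶ (fiberPower p 2).obj M) :
    pair p (k ≫ proj p 0 M) (k ≫ proj p 1 M) (by simp only [Category.assoc, proj_p]) = k := by
  apply fiberPower_hom_ext
  · simp only [← proj_p p 0]
    rw [← Category.assoc, pair_fst, Category.assoc]
  · rw [Fin.forall_fin_two]
    simp only [pair_fst, pair_snd, and_self]

/-- The sum of two generalized points of the tangent bundle over the same base point. -/
def TangentStructure.add {X M : C} (f g : X ⟶ 𝕋.T.obj M)
    (w : f ≫ 𝕋.p.app M = g ≫ 𝕋.p.app M) : X ⟶ 𝕋.T.obj M :=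
  pair 𝕋.p f g w ≫ 𝕋.s.app M

namespace TangentStructure

lemma add_map {X M N : C} (h : M ⟶ N) (f g : X ⟶ 𝕋.T.obj M)
    (w : f ≫ 𝕋.p.app M = g ≫ 𝕋.p.app M) (w') :
    𝕋.add f g w ≫ 𝕋.T.map h = 𝕋.add (f ≫ 𝕋.T.map h) (g ≫ 𝕋.T.map h) w' := by
  rw [add, Category.assoc, ← 𝕋.s.naturality, ← Category.assoc, pair_map]; rfl

lemma add_comm {X M : C} (f g : X ⟶ 𝕋.T.obj M)
    (w : f ≫ 𝕋.p.app M = g ≫ 𝕋.p.app M) : 𝕋.add f g w = 𝕋.add g f w.symm := by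
  rw [add, ← 𝕋.s_comm, ← Category.assoc, pair_comp]
  simp only [pair_fst, pair_snd]; rfl

lemma zero_add {X M : C} (f : X ⟶ 𝕋.T.obj M) (w) :
    𝕋.add (f ≫ 𝕋.p.app M ≫ 𝕋.z.app M) f w = f := by
  have := congrArg (f ≫ ·) (𝕋.zero_s M)
  simp only [← Category.assoc, pair_comp, Category.comp_id] at this
  simp only [add, ← Category.assoc]
  exact this

variable {𝕋} {L : C ⥤ C} (adj : L ⊣ 𝕋.T)

/-- The transpose of a generalized point of the tangent bundle. -/
def tr {X M : C} (f : X ⟶ 𝕋.T.obj M) : L.obj X ⟶ M := (adj.homEquiv X M).symm f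

/-- The generalized point of the tangent bundle with a given transpose. -/
def pt {X M : C} (a : L.obj X ⟶ M) : X ⟶ 𝕋.T.obj M := adj.homEquiv X M a

@[simp] lemma tr_pt {X M : C} (a : L.obj X ⟶ M) : tr adj (pt adj a) = a :=
  (adj.homEquiv X M).symm_apply_apply a

@[simp] lemma pt_tr {X M : C} (f : X ⟶ 𝕋.T.obj M) : pt adj (tr adj f) = f :=
  (adj.homEquiv X M).apply_symm_apply f

lemma tr_comp {X Y M : C} (h : Y ⟶ X) (f : X ⟶ 𝕋.T.obj M) :
    tr adj (h ≫ f) = L.map h ≫ tr adj f := adj.homEquiv_naturality_left_symm h f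

lemma tr_map {X M N : C} (f : X ⟶ 𝕋.T.obj M) (h : M ⟶ N) :
    tr adj (f ≫ 𝕋.T.map h) = tr adj f ≫ h := adj.homEquiv_naturality_right_symm f h

lemma pt_comp {X M N : C} (a : L.obj X ⟶ M) (h : M ⟶ N) :
    pt adj (a ≫ h) = pt adj a ≫ 𝕋.T.map h := adj.homEquiv_naturality_right a h

lemma map_pt {X Y M : C} (h : Y ⟶ X) (a : L.obj X ⟶ M) :
    pt adj (L.map h ≫ a) = h ≫ pt adj a := adj.homEquiv_naturality_left h a

/-- The Yoneda principle behind all mates: every point factors through the generic one, so by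
naturality a structure map is determined by its effect on that point. -/
lemma eq_pt_comp {X M : C} (f : X ⟶ 𝕋.T.obj M) :
    f = pt adj (𝟙 (L.obj X)) ≫ 𝕋.T.map (tr adj f) := by
  rw [← pt_comp, Category.id_comp, pt_tr]

lemma tr_injective {X M : C} {f g : X ⟶ 𝕋.T.obj M} (h : tr adj f = tr adj g) : f = g :=
  (adj.homEquiv X M).symm.injective h

/-- The twofold transpose of a generalized point of the second tangent bundle. -/
def tr2 {X M : C} (f : X ⟶ 𝕋.T.obj (𝕋.T.obj M)) : L.obj (L.obj X) ⟶ M := tr adj (tr adj f)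

/-- The generalized point of the second tangent bundle with a given twofold transpose. -/
def pt2 {X M : C} (a : L.obj (L.obj X) ⟶ M) : X ⟶ 𝕋.T.obj (𝕋.T.obj M) := pt adj (pt adj a)

@[simp] lemma tr2_pt2 {X M : C} (a : L.obj (L.obj X) ⟶ M) : tr2 adj (pt2 adj a) = a := by
  simp [tr2, pt2]

lemma tr2_injective {X M : C} {f g : X ⟶ 𝕋.T.obj (𝕋.T.obj M)} (h : tr2 adj f = tr2 adj g) :
    f = g := tr_injective adj (tr_injective adj h)

lemma tr2_comp {X Y M : C} (h : Y ⟶ X) (f : X ⟶ 𝕋.T.obj (𝕋.T.obj M)) :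
    tr2 adj (h ≫ f) = L.map (L.map h) ≫ tr2 adj f := by
  rw [tr2, tr_comp, tr_comp]; rfl

lemma tr2_map {X M N : C} (f : X ⟶ 𝕋.T.obj (𝕋.T.obj M)) (h : M ⟶ N) :
    tr2 adj (f ≫ 𝕋.T.map (𝕋.T.map h)) = tr2 adj f ≫ h := by
  rw [tr2, tr_map, tr_map]; rfl

lemma eq_pt2_comp {X M : C} (f : X ⟶ 𝕋.T.obj (𝕋.T.obj M)) :
    f = pt2 adj (𝟙 (L.obj (L.obj X))) ≫ 𝕋.T.map (𝕋.T.map (tr2 adj f)) := by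
  apply tr2_injective adj
  rw [tr2_map, tr2_pt2, Category.id_comp]

/-- The mate of the projection. -/
def mp (X : C) : X ⟶ L.obj X := pt adj (𝟙 (L.obj X)) ≫ 𝕋.p.app (L.obj X)

/-- The mate of the zero morphism. -/
def mz (X : C) : L.obj X ⟶ X := tr adj (𝕋.z.app X)

/-- The mate of the vertical lift. -/
def ml (X : C) : L.obj (L.obj X) ⟶ L.obj X :=
  tr2 adj (pt adj (𝟙 (L.obj X)) ≫ 𝕋.l.app (L.obj X))

/-- The mate of the canonical flip. -/
def mc (X : C) : L.obj (L.obj X) ⟶ L.obj (L.obj X) :=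
  tr2 adj (pt2 adj (𝟙 (L.obj (L.obj X))) ≫ 𝕋.c.app (L.obj (L.obj X)))

lemma comp_p {X M : C} (f : X ⟶ 𝕋.T.obj M) : f ≫ 𝕋.p.app M = mp adj X ≫ tr adj f := by
  conv_lhs => rw [eq_pt_comp adj f, Category.assoc, 𝕋.p.naturality, ← Category.assoc]
  rfl

lemma tr_comp_z {X M : C} (h : X ⟶ M) : tr adj (h ≫ 𝕋.z.app M) = mz adj X ≫ h := by
  have : h ≫ 𝕋.z.app M = 𝕋.z.app X ≫ 𝕋.T.map h := 𝕋.z.naturality h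
  rw [this, tr_map]; rfl

lemma tr2_comp_l {X M : C} (f : X ⟶ 𝕋.T.obj M) :
    tr2 adj (f ≫ 𝕋.l.app M) = ml adj X ≫ tr adj f := by
  have : 𝕋.T.map (tr adj f) ≫ 𝕋.l.app M =
    𝕋.l.app (L.obj X) ≫ 𝕋.T.map (𝕋.T.map (tr adj f)) := 𝕋.l.naturality (tr adj f)
  conv_lhs => rw [eq_pt_comp adj f, Category.assoc, this, ← Category.assoc, tr2_map]
  rfl

lemma tr2_comp_c {X M : C} (f : X ⟶ 𝕋.T.obj (𝕋.T.obj M)) :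
    tr2 adj (f ≫ 𝕋.c.app M) = mc adj X ≫ tr2 adj f := by
  have : 𝕋.T.map (𝕋.T.map (tr2 adj f)) ≫ 𝕋.c.app M =
    𝕋.c.app (L.obj (L.obj X)) ≫ 𝕋.T.map (𝕋.T.map (tr2 adj f)) := 𝕋.c.naturality (tr2 adj f)
  conv_lhs => rw [eq_pt2_comp adj f, Category.assoc, this, ← Category.assoc, tr2_map]
  rfl

/-- Transposing twice reverses the order of the two copies of the functor: the outer projection p_T
becomes L applied to the mate, while T p becomes the mate at L X (`tr_comp_map_p`). -/
lemma tr_comp_p {X M : C} (f : X ⟶ 𝕋.T.obj (𝕋.T.obj M)) :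
    tr adj (f ≫ 𝕋.p.app (𝕋.T.obj M)) = L.map (mp adj X) ≫ tr2 adj f := by
  rw [comp_p adj, tr_comp]; rfl

lemma tr_comp_map_p {X M : C} (f : X ⟶ 𝕋.T.obj (𝕋.T.obj M)) :
    tr adj (f ≫ 𝕋.T.map (𝕋.p.app M)) = mp adj (L.obj X) ≫ tr2 adj f := by
  rw [tr_map, comp_p adj]; rfl

lemma tr2_comp_z {X M : C} (f : X ⟶ 𝕋.T.obj M) :
    tr2 adj (f ≫ 𝕋.z.app (𝕋.T.obj M)) = L.map (mz adj X) ≫ tr adj f := by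
  rw [tr2, tr_comp_z, tr_comp]

lemma tr2_comp_map_z {X M : C} (f : X ⟶ 𝕋.T.obj M) :
    tr2 adj (f ≫ 𝕋.T.map (𝕋.z.app M)) = mz adj (L.obj X) ≫ tr adj f := by
  rw [tr2, tr_map, tr_comp_z]

lemma mp_natural {X Y : C} (h : X ⟶ Y) : mp adj X ≫ L.map h = h ≫ mp adj Y := by
  have := comp_p adj (h ≫ pt adj (𝟙 (L.obj Y)))
  rw [tr_comp, tr_pt, Category.comp_id, Category.assoc] at this
  exact this.symm

lemma mz_natural {X Y : C} (h : X ⟶ Y) : mz adj X ≫ h = L.map h ≫ mz adj Y := by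
  rw [← tr_comp_z, tr_comp]; rfl

lemma ml_natural {X Y : C} (h : X ⟶ Y) :
    ml adj X ≫ L.map h = L.map (L.map h) ≫ ml adj Y := by
  have := tr2_comp_l adj (h ≫ pt adj (𝟙 (L.obj Y)))
  rw [tr_comp, tr_pt, Category.comp_id, Category.assoc, tr2_comp] at this
  exact this.symm

lemma mc_natural {X Y : C} (h : X ⟶ Y) :
    mc adj X ≫ L.map (L.map h) = L.map (L.map h) ≫ mc adj Y := by
  have h1 : tr2 adj ((h ≫ pt2 adj (𝟙 (L.obj (L.obj Y)))) ≫ 𝕋.c.app _) =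
      L.map (L.map h) ≫ mc adj Y := by rw [Category.assoc, tr2_comp]; rfl
  have h2 : tr2 adj (h ≫ pt2 adj (𝟙 (L.obj (L.obj Y)))) = L.map (L.map h) := by
    rw [tr2_comp, tr2_pt2, Category.comp_id]
  rw [← h1, tr2_comp_c, h2]

lemma mp_mz (X : C) : mp adj X ≫ mz adj X = 𝟙 X := by
  rw [mz, ← comp_p, 𝕋.z_p]

lemma mp_ml (X : C) : mp adj (L.obj X) ≫ ml adj X = mz adj X ≫ mp adj X := by
  have := congrArg (fun k => tr adj (pt adj (𝟙 (L.obj X)) ≫ k)) (𝕋.l_p (L.obj X))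
  simp only [← Category.assoc, tr_comp_map_p, tr2_comp_l, comp_p adj, tr_pt] at this
  rw [Category.comp_id] at this
  refine this.trans ((tr_comp_z adj _).trans ?_)
  rw [Category.comp_id]

lemma mp_mc (X : C) : mp adj (L.obj X) ≫ mc adj X = L.map (mp adj X) := by
  have := congrArg (fun k => tr adj (pt2 adj (𝟙 (L.obj (L.obj X))) ≫ k))
    (𝕋.c_p (L.obj (L.obj X)))
  simp only [← Category.assoc, tr_comp_map_p, tr2_comp_c, tr2_pt2] at this
  rw [Category.comp_id] at this
  refine this.trans ((tr_comp_p adj _).trans ?_)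
  rw [tr2_pt2, Category.comp_id]

lemma mc_mc (X : C) : mc adj X ≫ mc adj X = 𝟙 _ := by
  have := congrArg (fun k => tr2 adj (pt2 adj (𝟙 (L.obj (L.obj X))) ≫ k))
    (𝕋.c_c (L.obj (L.obj X)))
  simp only [← Category.assoc, tr2_comp_c] at this
  simp only [Category.comp_id, tr2_pt2] at this
  exact this

lemma mc_ml (X : C) : mc adj X ≫ ml adj X = ml adj X := by
  have := congrArg (fun k => tr2 adj (pt adj (𝟙 (L.obj X)) ≫ k)) (𝕋.l_c (L.obj X))
  simp only [← Category.assoc, tr2_comp_c, tr2_comp_l] at this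
  simpa only [Category.comp_id, tr_pt] using this

lemma mc_map_mz (X : C) : mc adj X ≫ L.map (mz adj X) = mz adj (L.obj X) := by
  have := congrArg (fun k => tr2 adj (pt adj (𝟙 (L.obj X)) ≫ k)) (𝕋.z_c (L.obj X))
  simp only [← Category.assoc, tr2_comp_c, tr2_comp_map_z, tr2_comp_z] at this
  simpa only [Category.comp_id, tr_pt] using this

/-- The transpose of the sum of two points given by their transposes. -/
def msum {X M : C} (a b : L.obj X ⟶ M) (w : mp adj X ≫ a = mp adj X ≫ b) : L.obj X ⟶ M :=
  tr adj (𝕋.add (pt adj a) (pt adj b) (by rw [comp_p adj, comp_p adj, tr_pt, tr_pt, w]))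

lemma tr_add {X M : C} (f g : X ⟶ 𝕋.T.obj M) (w : f ≫ 𝕋.p.app M = g ≫ 𝕋.p.app M) :
    tr adj (𝕋.add f g w) =
      msum adj (tr adj f) (tr adj g) (by rw [← comp_p, ← comp_p, w]) := by
  simp [msum]

/-- Naturality, together with `msum_comm` and `msum_zero`, supplies the three hypotheses of
`eq_add_sub_of_natural`. -/
lemma msum_comp {X M N : C} (a b : L.obj X ⟶ M) (w : mp adj X ≫ a = mp adj X ≫ b) (h : M ⟶ N)
    (w') : msum adj a b w ≫ h = msum adj (a ≫ h) (b ≫ h) w' := by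
  rw [msum, ← tr_map, add_map, tr_add]
  · simp only [tr_map, tr_pt]
  · rw [comp_p adj, comp_p adj, tr_map, tr_map, tr_pt, tr_pt, w']

lemma msum_comm {X M : C} (a b : L.obj X ⟶ M) (w : mp adj X ≫ a = mp adj X ≫ b) :
    msum adj a b w = msum adj b a w.symm := by
  rw [msum, add_comm]; rfl

lemma msum_zero {X M : C} (a : L.obj X ⟶ M) (w) :
    msum adj (mz adj X ≫ mp adj X ≫ a) a w = a := by
  have w0 : (pt adj a ≫ 𝕋.p.app M ≫ 𝕋.z.app M) ≫ 𝕋.p.app M = pt adj a ≫ 𝕋.p.app M := by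
    simp only [Category.assoc, 𝕋.z_p]; exact congrArg _ (Category.comp_id _)
  have h := congrArg (tr adj) (zero_add 𝕋 (pt adj a) w0)
  have e : tr adj (pt adj a ≫ 𝕋.p.app M ≫ 𝕋.z.app M) = mz adj X ≫ mp adj X ≫ a := by
    rw [← Category.assoc, comp_p adj, tr_comp_z, tr_pt]
  rw [tr_add] at h
  simp only [e, tr_pt] at h
  exact h

/-- One transposition removes the outer `T`, turning the fibrewise sum T s into the ordinary sum of
points over L X. -/
lemma tr2_add_map {X M : C} (f g : X ⟶ 𝕋.T.obj (𝕋.T.obj M))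
    (w : f ≫ 𝕋.T.map (𝕋.p.app M) = g ≫ 𝕋.T.map (𝕋.p.app M)) :
    tr2 adj (pairT 𝕋.p f g w ≫ 𝕋.T.map (𝕋.s.app M)) =
      msum adj (tr2 adj f) (tr2 adj g) (by rw [← tr_comp_map_p, ← tr_comp_map_p, w]) := by
  have e1 : tr adj (pairT 𝕋.p f g w) ≫ proj 𝕋.p 0 M = tr adj f := by rw [← tr_map, pairT_fst]
  have e2 : tr adj (pairT 𝕋.p f g w) ≫ proj 𝕋.p 1 M = tr adj g := by rw [← tr_map, pairT_snd]
  have hw : tr adj f ≫ 𝕋.p.app M = tr adj g ≫ 𝕋.p.app M := by rw [← tr_map, ← tr_map, w]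
  have e : tr adj (pairT 𝕋.p f g w) = pair 𝕋.p (tr adj f) (tr adj g) hw := by
    rw [← pair_eta 𝕋.p (tr adj (pairT 𝕋.p f g w))]
    simp only [e1, e2]
  rw [tr2, tr_map, e]
  exact tr_add adj (tr adj f) (tr adj g) hw

/-- The universality of the vertical lift, in terms of mates. -/
lemma existsUnique_msum {X M : C} (t : L.obj (L.obj X) ⟶ M) (b : X ⟶ M)
    (h : mp adj (L.obj X) ≫ t = mz adj X ≫ b) :
    (∃ (a₁ a₂ : L.obj X ⟶ M) (_ : mp adj X ≫ a₁ = b) (_ : mp adj X ≫ a₂ = b), ∃ w,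
      msum adj (ml adj X ≫ a₁) (L.map (mz adj X) ≫ a₂) w = t) ∧
    (∀ (a₁ a₂ a₁' a₂' : L.obj X ⟶ M) (_ : mp adj X ≫ a₁ = b) (_ : mp adj X ≫ a₂ = b)
      (_ : mp adj X ≫ a₁' = b) (_ : mp adj X ≫ a₂' = b) (w w'),
      msum adj (ml adj X ≫ a₁) (L.map (mz adj X) ≫ a₂) w = t →
      msum adj (ml adj X ≫ a₁') (L.map (mz adj X) ≫ a₂') w' = t → a₁ = a₁' ∧ a₂ = a₂') := by
  -- The comparison map of the universality square, composed with a point of `T₂ M` and transposed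
  -- twice.
  have key : ∀ k : X ⟶ (fiberPower 𝕋.p 2).obj M, ∃ w,
      tr2 adj (k ≫ pairT 𝕋.p (proj 𝕋.p 0 M ≫ 𝕋.l.app M) (proj 𝕋.p 1 M ≫ 𝕋.z.app (𝕋.T.obj M))
        (lift_w 𝕋.p 𝕋.z (𝕋.l.app M) (𝕋.l_p M)) ≫ 𝕋.T.map (𝕋.s.app M)) =
      msum adj (ml adj X ≫ tr adj (k ≫ proj 𝕋.p 0 M))
        (L.map (mz adj X) ≫ tr adj (k ≫ proj 𝕋.p 1 M)) w := by
    intro k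
    have w0 := congrArg (k ≫ ·) (lift_w 𝕋.p 𝕋.z (𝕋.l.app M) (𝕋.l_p M))
    simp only [← Category.assoc] at w0
    have e : k ≫ pairT 𝕋.p (proj 𝕋.p 0 M ≫ 𝕋.l.app M) (proj 𝕋.p 1 M ≫ 𝕋.z.app (𝕋.T.obj M))
        (lift_w 𝕋.p 𝕋.z (𝕋.l.app M) (𝕋.l_p M)) =
      pairT 𝕋.p ((k ≫ proj 𝕋.p 0 M) ≫ 𝕋.l.app M)
        ((k ≫ proj 𝕋.p 1 M) ≫ 𝕋.z.app (𝕋.T.obj M)) w0 := by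
      rw [comp_pairT]; simp only [Category.assoc]
    refine ⟨by rw [← tr2_comp_l, ← tr2_comp_z, ← tr_comp_map_p, ← tr_comp_map_p, w0], ?_⟩
    rw [← Category.assoc, e, tr2_add_map]
    simp only [tr2_comp_l, tr2_comp_z]
  have hp : ∀ (k : X ⟶ (fiberPower 𝕋.p 2).obj M) (i : Fin 2),
      mp adj X ≫ tr adj (k ≫ proj 𝕋.p i M) = k ≫ base 𝕋.p 2 M := by
    intro k i
    rw [← comp_p, Category.assoc, proj_p]
  constructor
  · have sq : pt2 adj t ≫ 𝕋.T.map (𝕋.p.app M) = b ≫ 𝕋.z.app M := by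
      apply tr_injective adj
      rw [tr_comp_map_p, tr2_pt2]
      exact h.trans (tr_comp_z adj b).symm
    obtain ⟨k, k1, k2⟩ := (𝕋.universal M).exists_lift (pt2 adj t) b sq
    rw [proj_p] at k2
    obtain ⟨w, hk⟩ := key k
    refine ⟨_, _, (hp k 0).trans k2, (hp k 1).trans k2, w, ?_⟩
    rw [← hk, k1, tr2_pt2]
  · intro a₁ a₂ a₁' a₂' h1 h2 h1' h2' w w' e e'
    have q : pt adj a₁ ≫ 𝕋.p.app M = pt adj a₂ ≫ 𝕋.p.app M := by
      rw [comp_p adj, comp_p adj, tr_pt, tr_pt, h1, h2]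
    have q' : pt adj a₁' ≫ 𝕋.p.app M = pt adj a₂' ≫ 𝕋.p.app M := by
      rw [comp_p adj, comp_p adj, tr_pt, tr_pt, h1', h2']
    obtain ⟨w0, hk⟩ := key (pair 𝕋.p (pt adj a₁) (pt adj a₂) q)
    obtain ⟨w0', hk'⟩ := key (pair 𝕋.p (pt adj a₁') (pt adj a₂') q')
    simp only [pair_fst, pair_snd, tr_pt] at hk hk'
    have : pair 𝕋.p (pt adj a₁) (pt adj a₂) q = pair 𝕋.p (pt adj a₁') (pt adj a₂') q' := by
      apply (𝕋.universal M).hom_ext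
      · apply tr2_injective adj
        rw [hk, hk', e, e']
      · simp only [← Category.assoc, pair_fst]
        rw [comp_p adj, comp_p adj, tr_pt, tr_pt, h1, h1']
    constructor
    · have := congrArg (fun k => tr adj (k ≫ proj 𝕋.p 0 M)) this
      simpa only [pair_fst, tr_pt] using this
    · have := congrArg (fun k => tr adj (k ≫ proj 𝕋.p 1 M)) this
      simpa only [pair_snd, tr_pt] using this

end TangentStructure

end Mates

/-! ### Isomorphisms of tangent structures from their mates -/

noncomputable section MatesIso

variable {C : Type u} [Category.{v} C]

namespace TangentStructure

/-- A tangent structure whose projection is invertible is trivial. -/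
def isoTrivial (𝕋 : TangentStructure C) (h : ∀ M, IsIso (𝕋.p.app M)) :
    Iso 𝕋 (trivialTangentStructure C) where
  iso :=
    NatIso.ofComponents (fun M => @asIso _ _ _ _ (𝕋.p.app M) (h M)) fun f => 𝕋.p.naturality f
  p M := Category.comp_id _
  z M := 𝕋.z_p M
  s M := (trivial_pair C _ _ _).trans (𝕋.s_p M).symm
  l M := by
    change 𝕋.l.app M ≫ 𝕋.p.app (𝕋.T.obj M) ≫ 𝕋.p.app M = 𝕋.p.app M ≫ 𝟙 M
    -- Naturality of p at p itself replaces p_T by T p before the second p, so that the axiom on l ≫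
    -- T p applies; the same device handles the flip.
    have e : 𝕋.T.map (𝕋.p.app M) ≫ 𝕋.p.app M = 𝕋.p.app (𝕋.T.obj M) ≫ 𝕋.p.app M :=
      𝕋.p.naturality (𝕋.p.app M)
    rw [← e, ← Category.assoc, 𝕋.l_p, Category.assoc]
    exact congrArg (𝕋.p.app M ≫ ·) (𝕋.z_p M)
  c M := by
    change 𝕋.c.app M ≫ 𝕋.p.app (𝕋.T.obj M) ≫ 𝕋.p.app M =
      (𝕋.p.app (𝕋.T.obj M) ≫ 𝕋.p.app M) ≫ 𝟙 M
    have e : 𝕋.T.map (𝕋.p.app M) ≫ 𝕋.p.app M = 𝕋.p.app (𝕋.T.obj M) ≫ 𝕋.p.app M :=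
      𝕋.p.naturality (𝕋.p.app M)
    rw [← e, ← Category.assoc, 𝕋.c_p, e]
    exact (Category.comp_id _).symm

variable {𝕊 𝕋 : TangentStructure C} {L : C ⥤ C} (adj : L ⊣ 𝕊.T) (adj' : L ⊣ 𝕋.T)

/-- The comparison of two tangent bundle functors with the same left adjoint. -/
def compare : 𝕊.T ≅ 𝕋.T := adj.rightAdjointUniq adj'

lemma tr_compare {X M : C} (f : X ⟶ 𝕊.T.obj M) :
    tr adj' (f ≫ (compare adj adj').hom.app M) = tr adj f := by
  have h : tr adj' ((compare adj adj').hom.app M) = adj.counit.app M :=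
    Adjunction.homEquiv_symm_rightAdjointUniq_hom_app adj adj' M
  rw [tr_comp, h]
  exact (adj.homEquiv_counit X M f).symm

lemma tr2_compare {X M : C} (f : X ⟶ 𝕊.T.obj (𝕊.T.obj M)) :
    tr2 adj' (f ≫ ((compare adj adj').hom ◫ (compare adj adj').hom).app M) = tr2 adj f := by
  rw [NatTrans.hcomp_app, ← Category.assoc, tr2, tr_map, tr_compare, tr_compare]; rfl

lemma compare_p (hp : ∀ X, mp adj X = mp adj' X) (M : C) :
    (compare adj adj').hom.app M ≫ 𝕋.p.app M = 𝕊.p.app M := by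
  have h1 := tr_compare adj adj' (𝟙 (𝕊.T.obj M))
  have h2 := comp_p adj (𝟙 (𝕊.T.obj M))
  rw [Category.id_comp] at h1 h2
  rw [comp_p adj', h1, h2, hp]

/-- Two tangent structures are isomorphic if their tangent bundle functors have a common left
adjoint along which their structure maps have the same mates. -/
def isoOfMates (hp : ∀ X, mp adj X = mp adj' X) (hz : ∀ X, mz adj X = mz adj' X)
    (hs : ∀ {X M : C} (a b : L.obj X ⟶ M) (w w'), msum adj a b w = msum adj' a b w')
    (hl : ∀ X, ml adj X = ml adj' X) (hc : ∀ X, mc adj X = mc adj' X) : Iso 𝕊 𝕋 where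
  iso := compare adj adj'
  p := compare_p adj adj' hp
  z M := tr_injective adj' (by rw [tr_compare]; exact hz M)
  s M := by
    apply tr_injective adj'
    rw [tr_compare]
    refine (tr_add adj' _ _ _).trans ?_
    simp only [tr_compare]
    rw [← hs _ _ (by rw [← comp_p, ← comp_p, proj_w]), ← tr_add adj _ _ (proj_w 𝕊.p 0 1 M)]
    congr 1
    have := pair_eta 𝕊.p (𝟙 ((fiberPower 𝕊.p 2).obj M))
    simp only [Category.id_comp] at this
    rw [add, this, Category.id_comp]
  l M := by
    apply tr2_injective adj'
    rw [tr2_compare, tr2_comp_l, ← Category.comp_id ((compare adj adj').hom.app M)]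
    have h1 := tr_compare adj adj' (𝟙 (𝕊.T.obj M))
    have h2 := tr2_comp_l adj (𝟙 (𝕊.T.obj M))
    rw [Category.id_comp] at h1 h2
    rw [Category.comp_id, h1, h2, hl]
  c M := by
    apply tr2_injective adj'
    have h1 := tr2_compare adj adj' (𝟙 (𝕊.T.obj (𝕊.T.obj M)))
    have h2 := tr2_comp_c adj (𝟙 (𝕊.T.obj (𝕊.T.obj M)))
    rw [Category.id_comp] at h1 h2
    rw [tr2_compare, tr2_comp_c, h1, h2, hc]; rfl

end TangentStructure

end MatesIso

namespace TangentStructure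

/-- The inverse of p_M is the point whose transpose is the inverse of the mate at M. -/
lemma isIso_p_of_isIso_mp {C : Type u} [Category.{v} C] {𝕋 : TangentStructure C} {L : C ⥤ C}
    (adj : L ⊣ 𝕋.T) (h : ∀ X, IsIso (mp adj X)) (M : C) : IsIso (𝕋.p.app M) := by
  refine ⟨pt adj (inv (mp adj M)), ?_, ?_⟩
  · apply tr_injective adj
    have e := mp_natural adj (𝕋.p.app M)
    have e' := comp_p adj (𝟙 (𝕋.T.obj M))
    rw [Category.id_comp] at e'
    rw [tr_comp, tr_pt, ← cancel_epi (mp adj (𝕋.T.obj M)), ← e', ← Category.assoc]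
    refine (congrArg (· ≫ inv (mp adj M)) e).trans ?_
    rw [Category.assoc]
    exact (congrArg _ (IsIso.hom_inv_id _)).trans (Category.comp_id _)
  · rw [comp_p adj, tr_pt]
    exact IsIso.hom_inv_id _

end TangentStructure

/-! ### Uniqueness of the addition -/

section SumFormula

variable {R : Type u} [CommRing R]

/-- A natural, commutative and unital operation on pairs of algebra maps into `P` that agree
after `π` is given by addition relative to the zero section `ζ ∘ π`. -/
lemma eq_add_sub_of_natural {P B : Type u} [CommRing P] [Algebra R P] [CommRing B] [Algebra R B]
    (π : P →ₐ[R] B) (ζ : B →ₐ[R] P) (hπζ : ∀ b, π (ζ b) = b)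
    (S : ∀ (A : Type u) [CommRing A] [Algebra R A] (f g : A →ₐ[R] P),
      π.comp f = π.comp g → A →ₐ[R] P)
    (nat : ∀ (A A' : Type u) [CommRing A] [Algebra R A] [CommRing A'] [Algebra R A']
      (h : A' →ₐ[R] A) (f g : A →ₐ[R] P) (w w'),
      (S A f g w).comp h = S A' (f.comp h) (g.comp h) w')
    (comm : ∀ (A : Type u) [CommRing A] [Algebra R A] (f g : A →ₐ[R] P) (w w'),
      S A f g w = S A g f w')
    (unit : ∀ (A : Type u) [CommRing A] [Algebra R A] (f : A →ₐ[R] P) (w),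
      S A ((ζ.comp π).comp f) f w = f)
    (A : Type u) [CommRing A] [Algebra R A] (f g : A →ₐ[R] P) (w) (a : A) :
    S A f g w a = f a + g a - ζ (π (f a)) := by
  -- Q is the fibre product P ×_B P. By naturality S is governed by its value σ : Q → P on the two
  -- projections. The unit law fixes σ on pairs (ζπx, x), and commutativity then fixes it on pairs
  -- (x, ζπx).
  let Q : Subalgebra R (P × P) := AlgHom.equalizer (π.comp (AlgHom.fst R P P))
    (π.comp (AlgHom.snd R P P))
  let q₁ : Q →ₐ[R] P := (AlgHom.fst R P P).comp Q.val
  let q₂ : Q →ₐ[R] P := (AlgHom.snd R P P).comp Q.val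
  have wq : π.comp q₁ = π.comp q₂ := AlgHom.ext fun x => x.2
  let k : A →ₐ[R] Q := (f.prod g).codRestrict Q fun x => DFunLike.congr_fun w x
  have hk : S A f g w = (S Q q₁ q₂ wq).comp k :=
    (nat Q A k q₁ q₂ wq w).symm
  let j : P →ₐ[R] Q := ((ζ.comp π).prod (AlgHom.id R P)).codRestrict Q fun x => by
    change π (ζ (π x)) = π x
    rw [hπζ]
  let j' : P →ₐ[R] Q := ((AlgHom.id R P).prod (ζ.comp π)).codRestrict Q fun x => by
    change π x = π (ζ (π x))
    rw [hπζ]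
  have wj : π.comp ((ζ.comp π).comp (AlgHom.id R P)) = π.comp (AlgHom.id R P) :=
    AlgHom.ext fun x => hπζ _
  have hj : (S Q q₁ q₂ wq).comp j = AlgHom.id R P :=
    (nat Q P j q₁ q₂ wq wj).trans (unit P (AlgHom.id R P) wj)
  have hj' : (S Q q₁ q₂ wq).comp j' = AlgHom.id R P :=
    (nat Q P j' q₁ q₂ wq wj.symm).trans
      ((comm P _ _ wj.symm wj).trans (unit P (AlgHom.id R P) wj))
  -- Every element (x, y) of Q is (x, ζπx) + (ζπx, y) - (ζπx, ζπx), so additivity of σ leaves no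
  -- freedom.
  have hd : k a = j' (f a) + j (g a) - j (ζ (π (f a))) := by
    have wa : π (f a) = π (g a) := DFunLike.congr_fun w a
    apply Subtype.ext
    apply Prod.ext
    · change f a = f a + ζ (π (g a)) - ζ (π (ζ (π (f a))))
      rw [hπζ, wa, add_sub_cancel_right]
    · change g a = ζ (π (f a)) + g a - ζ (π (f a))
      ring
  have h1 : ∀ x, S Q q₁ q₂ wq (j x) = x := fun x => DFunLike.congr_fun hj x
  have h2 : ∀ x, S Q q₁ q₂ wq (j' x) = x := fun x => DFunLike.congr_fun hj' x
  rw [hk]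
  change S Q q₁ q₂ wq (k a) = _
  rw [hd, map_sub, map_add, h1, h1, h2]

end SumFormula

/-! ### The mates as natural maps of algebras -/

noncomputable section AlgMates

variable {R : Type u} [CommRing R] {𝕋 : TangentStructure (Aff R)}
  {F : CommAlgCat.{u} R ⥤ CommAlgCat.{u} R} (adj : F.op ⊣ 𝕋.T)

open TangentStructure

/-- The algebra map dual to the mate of the projection. -/
def aProj (B : CommAlgCat.{u} R) : F.obj B →ₐ[R] B := (mp adj (op B)).unop.hom

/-- The algebra map dual to the mate of the zero morphism. -/
def aZero (B : CommAlgCat.{u} R) : B →ₐ[R] F.obj B := (mz adj (op B)).unop.hom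

/-- The algebra map dual to the mate of the vertical lift. -/
def aLift (B : CommAlgCat.{u} R) : F.obj B →ₐ[R] F.obj (F.obj B) := (ml adj (op B)).unop.hom

/-- The algebra map dual to the mate of the canonical flip. -/
def aFlip (B : CommAlgCat.{u} R) : F.obj (F.obj B) →ₐ[R] F.obj (F.obj B) :=
  (mc adj (op B)).unop.hom

lemma aff_congr {A B : CommAlgCat.{u} R} {f g : (op B : Aff R) ⟶ op A} (h : f = g) (a : A) :
    f.unop.hom a = g.unop.hom a := by rw [h]

variable {B B' : CommAlgCat.{u} R}

lemma aProj_natural (h : B ⟶ B') (x : F.obj B) :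
    aProj adj B' ((F.map h).hom x) = h.hom (aProj adj B x) :=
  aff_congr (mp_natural adj h.op) x

lemma aZero_natural (h : B ⟶ B') (x : B) :
    aZero adj B' (h.hom x) = (F.map h).hom (aZero adj B x) :=
  aff_congr (mz_natural adj h.op) x

lemma aLift_natural (h : B ⟶ B') (x : F.obj B) :
    aLift adj B' ((F.map h).hom x) = (F.map (F.map h)).hom (aLift adj B x) :=
  aff_congr (ml_natural adj h.op) x

lemma aFlip_natural (h : B ⟶ B') (x : F.obj (F.obj B)) :
    aFlip adj B' ((F.map (F.map h)).hom x) = (F.map (F.map h)).hom (aFlip adj B x) :=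
  aff_congr (mc_natural adj h.op) x

lemma aProj_aZero (b : B) : aProj adj B (aZero adj B b) = b :=
  aff_congr (mp_mz adj (op B)) b

lemma aProj_aLift (x : F.obj B) : aProj adj (F.obj B) (aLift adj B x) = aZero adj B (aProj adj B x) :=
  aff_congr (mp_ml adj (op B)) x

lemma aProj_aFlip (x : F.obj (F.obj B)) :
    aProj adj (F.obj B) (aFlip adj B x) = (F.map (CommAlgCat.ofHom (aProj adj B))).hom x :=
  aff_congr (mp_mc adj (op B)) x

lemma aFlip_aFlip (x : F.obj (F.obj B)) : aFlip adj B (aFlip adj B x) = x :=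
  aff_congr (mc_mc adj (op B)) x

lemma aFlip_aLift (x : F.obj B) : aFlip adj B (aLift adj B x) = aLift adj B x :=
  aff_congr (mc_ml adj (op B)) x

lemma aFlip_map_aZero (x : F.obj B) :
    aFlip adj B ((F.map (CommAlgCat.ofHom (aZero adj B))).hom x) = aZero adj (F.obj B) x :=
  aff_congr (mc_map_mz adj (op B)) x

lemma map_aProj_aFlip (x : F.obj (F.obj B)) :
    (F.map (CommAlgCat.ofHom (aProj adj B))).hom (aFlip adj B x) = aProj adj (F.obj B) x := by
  rw [← aProj_aFlip, aFlip_aFlip]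

/-- The flip exchanges the two projections and fixes the lift, so the second projection of a lift is
computed by the first. -/
lemma map_aProj_aLift (x : F.obj B) :
    (F.map (CommAlgCat.ofHom (aProj adj B))).hom (aLift adj B x) = aZero adj B (aProj adj B x) := by
  rw [← aProj_aFlip, aFlip_aLift, aProj_aLift]

/-- `eq_add_sub_of_natural` for the fibre product of two copies of F X over X: the sum is determined
by the projection and the zero section. -/
lemma msum_apply {X M : Aff R} (f g : F.op.obj X ⟶ M) (w : mp adj X ≫ f = mp adj X ≫ g)
    (a : M.unop) : (msum adj f g w).unop.hom a =
      (show F.obj X.unop from f.unop.hom a) + (show F.obj X.unop from g.unop.hom a) -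
        aZero adj X.unop (aProj adj X.unop (f.unop.hom a)) := by
  have W : ∀ {A : Type u} [CommRing A] [Algebra R A] {f g : A →ₐ[R] F.obj X.unop},
      (aProj adj X.unop).comp f = (aProj adj X.unop).comp g →
      mp adj X ≫ (CommAlgCat.ofHom f).op = mp adj X ≫ (CommAlgCat.ofHom g).op :=
    fun w => Quiver.Hom.unop_inj (CommAlgCat.hom_ext w)
  refine eq_add_sub_of_natural (aProj adj X.unop) (aZero adj X.unop) (aProj_aZero adj)
    (fun A _ _ f g w => (msum adj (M := op (.of R A)) (CommAlgCat.ofHom f).op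
      (CommAlgCat.ofHom g).op (W w)).unop.hom) ?_ ?_ ?_ M.unop f.unop.hom g.unop.hom
    (congrArg (fun h => h.unop.hom) w) a
  · intro A A' _ _ _ _ h f g w w'
    exact congrArg (fun h => h.unop.hom) (msum_comp adj (M := op (.of R A)) (N := op (.of R A'))
      (CommAlgCat.ofHom f).op (CommAlgCat.ofHom g).op (W w) (CommAlgCat.ofHom h).op (W w'))
  · intro A _ _ f g w w'
    exact congrArg (fun h => h.unop.hom) (msum_comm adj (M := op (.of R A))
      (CommAlgCat.ofHom f).op (CommAlgCat.ofHom g).op (W w))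
  · intro A _ _ f w
    exact congrArg (fun h => h.unop.hom) (msum_zero adj (M := op (.of R A))
      (CommAlgCat.ofHom f).op (W w))

/-- The kernel of the projection has square zero. -/
lemma mul_eq_zero_of_aProj {x y : F.obj B} (hx : aProj adj B x = 0) (hy : aProj adj B y = 0) :
    x * y = 0 := by
  let Q : Subalgebra R (F.obj B × F.obj B) :=
    AlgHom.equalizer ((aProj adj B).comp (AlgHom.fst R _ _)) ((aProj adj B).comp (AlgHom.snd R _ _))
  let q₁ : Q →ₐ[R] F.obj B := (AlgHom.fst R _ _).comp Q.val
  let q₂ : Q →ₐ[R] F.obj B := (AlgHom.snd R _ _).comp Q.val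
  have wq : mp adj (op B) ≫ (CommAlgCat.ofHom q₁).op = mp adj (op B) ≫ (CommAlgCat.ofHom q₂).op :=
    Quiver.Hom.unop_inj (CommAlgCat.hom_ext (AlgHom.ext fun x => x.2))
  have key : ∀ z : Q, (msum adj (M := op (.of R Q)) (CommAlgCat.ofHom q₁).op
      (CommAlgCat.ofHom q₂).op wq).unop.hom z =
      q₁ z + q₂ z - aZero adj B (aProj adj B (q₁ z)) := msum_apply adj _ _ wq
  -- The universal sum is an algebra map sending (x, 0) to x and (0, y) to y; the product of these
  -- two elements is 0.
  let u : Q := ⟨(x, 0), by change aProj adj B x = aProj adj B 0; rw [hx, map_zero]⟩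
  let v : Q := ⟨(0, y), by change aProj adj B 0 = aProj adj B y; rw [hy, map_zero]⟩
  have huv : u * v = 0 := Subtype.ext (Prod.ext (mul_zero x) (zero_mul y))
  have hu := key u
  have hv := key v
  have e1 : q₁ u = x := rfl
  have e2 : q₂ u = 0 := rfl
  have e3 : q₁ v = 0 := rfl
  have e4 : q₂ v = y := rfl
  rw [e1, e2, hx, map_zero, add_zero, sub_zero] at hu
  rw [e3, e4, map_zero, map_zero, _root_.zero_add, sub_zero] at hv
  rw [← hu, ← hv, ← map_mul, huv, map_zero]

/-- The universality of the vertical lift, in terms of elements. -/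
lemma existsUnique_lift (t : F.obj (F.obj B)) (b : B) (h : aProj adj (F.obj B) t = aZero adj B b) :
    ∃! x : F.obj B × F.obj B, (aProj adj B x.1 = b ∧ aProj adj B x.2 = b) ∧
      aLift adj B x.1 + (F.map (CommAlgCat.ofHom (aZero adj B))).hom x.2 - aZero adj _ (aZero adj B b) = t := by
  -- Maps into the affine line are elements, so probing universality with M = Spec R[X] gives a
  -- statement about elements.
  let M : Aff R := op (.of R (Polynomial R))
  let hom : ∀ {A : CommAlgCat.{u} R}, A → ((op A : Aff R) ⟶ M) := fun {A} y =>
    (CommAlgCat.ofHom (Polynomial.aeval y : Polynomial R →ₐ[R] A)).op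
  have hX : ∀ {A : CommAlgCat.{u} R} (y : A), (hom y).unop.hom (Polynomial.X : Polynomial R) = y :=
    fun y => Polynomial.aeval_X y
  have ext : ∀ {A : CommAlgCat.{u} R} {f g : (op A : Aff R) ⟶ M},
      f.unop.hom (Polynomial.X : Polynomial R) = g.unop.hom (Polynomial.X : Polynomial R) → f = g :=
    fun h => Quiver.Hom.unop_inj (CommAlgCat.hom_ext (Polynomial.algHom_ext h))
  have hh : mp adj (F.op.obj (op B)) ≫ hom t = mz adj (op B) ≫ hom b := by
    apply ext
    change aProj adj (F.obj B) ((hom t).unop.hom (Polynomial.X : Polynomial R)) =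
      aZero adj B ((hom b).unop.hom (Polynomial.X : Polynomial R))
    rw [hX, hX, h]
  have sum : ∀ (a₁ a₂ : F.op.obj (op B) ⟶ M) (w) (_ : aProj adj B
      (a₁.unop.hom (Polynomial.X : Polynomial R)) = b),
      (msum adj (ml adj (op B) ≫ a₁) (F.op.map (mz adj (op B)) ≫ a₂) w).unop.hom
        (Polynomial.X : Polynomial R) = aLift adj B (a₁.unop.hom (Polynomial.X : Polynomial R)) +
        (F.map (CommAlgCat.ofHom (aZero adj B))).hom (a₂.unop.hom (Polynomial.X : Polynomial R)) -
        aZero adj _ (aZero adj B b) := by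
    intro a₁ a₂ w hb
    rw [msum_apply]
    change aLift adj B (a₁.unop.hom (Polynomial.X : Polynomial R)) +
        (F.map (CommAlgCat.ofHom (aZero adj B))).hom (a₂.unop.hom (Polynomial.X : Polynomial R)) -
        aZero adj _ (aProj adj _ (aLift adj B (a₁.unop.hom (Polynomial.X : Polynomial R)))) = _
    rw [aProj_aLift, hb]
  have base : ∀ y : F.obj B, aProj adj B y = b → mp adj (op B) ≫ hom y = hom b := by
    intro y hy
    apply ext
    change aProj adj B ((hom y).unop.hom (Polynomial.X : Polynomial R)) =
      (hom b).unop.hom (Polynomial.X : Polynomial R)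
    rw [hX, hX, hy]
  have W : ∀ y y' : F.obj B, aProj adj B y = b → aProj adj B y' = b →
      mp adj (F.op.obj (op B)) ≫ ml adj (op B) ≫ hom y =
        mp adj (F.op.obj (op B)) ≫ F.op.map (mz adj (op B)) ≫ hom y' := by
    intro y y' hy hy'
    rw [← Category.assoc, ← Category.assoc, mp_ml, mp_natural, Category.assoc, Category.assoc,
      base y hy, base y' hy']
  obtain ⟨⟨a₁, a₂, h1, h2, w, ht⟩, huniq⟩ := existsUnique_msum adj (hom t) (hom b) hh
  have h1' : aProj adj B (a₁.unop.hom (Polynomial.X : Polynomial R)) = b :=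
    (aff_congr h1 (Polynomial.X : Polynomial R)).trans (hX b)
  have h2' : aProj adj B (a₂.unop.hom (Polynomial.X : Polynomial R)) = b :=
    (aff_congr h2 (Polynomial.X : Polynomial R)).trans (hX b)
  refine ⟨(a₁.unop.hom (Polynomial.X : Polynomial R), a₂.unop.hom (Polynomial.X : Polynomial R)),
    ⟨⟨h1', h2'⟩, ?_⟩, ?_⟩
  · rw [← sum a₁ a₂ w h1', ht, hX]
  · rintro ⟨y₁, y₂⟩ ⟨⟨hy1, hy2⟩, hy⟩
    have hy' : msum adj (ml adj (op B) ≫ hom y₁) (F.op.map (mz adj (op B)) ≫ hom y₂)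
        (W y₁ y₂ hy1 hy2) = hom t := by
      apply ext
      rw [sum _ _ _ (by rw [hX, hy1]), hX, hX, hX, hy]
    obtain ⟨e1, e2⟩ := huniq _ _ _ _ (base y₁ hy1) (base y₂ hy2) h1 h2 _ w hy' ht
    rw [← e1, ← e2, hX, hX]

lemma isIso_p_of_bijective (h : ∀ B, Function.Bijective (aProj adj B)) (M : Aff R) :
    IsIso (𝕋.p.app M) := by
  refine isIso_p_of_isIso_mp adj (fun X => ?_) M
  have := (CommAlgCat.isoMk (AlgEquiv.ofBijective (aProj adj X.unop) (h X.unop))).op.isIso_hom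
  exact this

end AlgMates

/-! ### Exponentiable affine schemes: finiteness and torsion-freeness -/

noncomputable section Exponentiable

open TangentStructure
open scoped TensorProduct

variable {R : Type u} [CommRing R]

section Adjoint

variable {G : Aff R ⥤ Aff R} {F : CommAlgCat.{u} R ⥤ CommAlgCat.{u} R} (adj : F.op ⊣ G)

/-- The morphism from an affine scheme to the affine line given by a function. -/
def homLine {B : CommAlgCat.{u} R} (b : B) : (op B : Aff R) ⟶ op (.of R (Polynomial R)) :=
  (CommAlgCat.ofHom (Polynomial.aeval b : Polynomial R →ₐ[R] B)).op

lemma homLine_X {B : CommAlgCat.{u} R} (b : B) :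
    (homLine b).unop.hom (Polynomial.X : Polynomial R) = b := Polynomial.aeval_X b

lemma comp_homLine {B B' : CommAlgCat.{u} R} (h : B ⟶ B') (b : B) :
    h.op ≫ homLine b = homLine (h.hom b) :=
  Quiver.Hom.unop_inj (CommAlgCat.hom_ext (Polynomial.algHom_ext (by
    change h.hom ((homLine b).unop.hom (Polynomial.X : Polynomial R)) =
      (homLine (h.hom b)).unop.hom (Polynomial.X : Polynomial R)
    rw [homLine_X, homLine_X])))

lemma homLine_injective {B : CommAlgCat.{u} R} {b b' : B} (h : homLine b = homLine b') :
    b = b' := by rw [← homLine_X b, h, homLine_X]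

include adj in
/-- A functor on algebras with a left adjoint preserves injections. -/
lemma map_injective_of_adjunction {B B' : CommAlgCat.{u} R} (h : B ⟶ B')
    (hh : Function.Injective h.hom) : Function.Injective (F.map h).hom := by
  intro x y hxy
  -- Elements of F B are maps from its spectrum to the affine line; once transposed, they become
  -- maps out of Spec B, which the epimorphism dual to the injection h separates.
  have e : F.op.map h.op ≫ homLine x = F.op.map h.op ≫ homLine y := by
    change (F.map h).op ≫ homLine x = (F.map h).op ≫ homLine y
    rw [comp_homLine, comp_homLine, hxy]
  have e' := congrArg (adj.homEquiv _ _) e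
  rw [adj.homEquiv_naturality_left, adj.homEquiv_naturality_left] at e'
  apply homLine_injective
  apply (adj.homEquiv _ _).injective
  apply Quiver.Hom.unop_inj
  apply CommAlgCat.hom_ext
  apply AlgHom.ext
  intro a
  apply hh
  exact congrArg (fun k => k.unop.hom a) e'

include adj in
/-- A functor on algebras with a left adjoint preserves powers of the base ring. -/
lemma exists_map_evalAlgHom_eq {ι : Type u} (x : ι → F.obj (.of R R)) :
    ∃ t : F.obj (.of R (ι → R)), ∀ i,
      (F.map (CommAlgCat.ofHom (Pi.evalAlgHom R (fun _ : ι => R) i))).hom t = x i := by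
  -- The transposes of the x i all start at Spec R, and the product algebra R^ι lets their duals be
  -- assembled into a single map.
  let g : ∀ i, (op (.of R R) : Aff R) ⟶ G.obj (op (.of R (Polynomial R))) :=
    fun i => adj.homEquiv _ _ (homLine (x i))
  let k : (op (.of R (ι → R)) : Aff R) ⟶ G.obj (op (.of R (Polynomial R))) :=
    (CommAlgCat.ofHom (AlgHom.pi fun i => (g i).unop.hom)).op
  have hk : ∀ i, (CommAlgCat.ofHom (Pi.evalAlgHom R (fun _ : ι => R) i)).op ≫ k = g i :=
    fun i => rfl
  refine ⟨((adj.homEquiv _ _).symm k).unop.hom (Polynomial.X : Polynomial R), fun i => ?_⟩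
  have e := congrArg (adj.homEquiv _ _).symm (hk i)
  rw [adj.homEquiv_naturality_left_symm, Equiv.symm_apply_apply] at e
  have := congrArg (fun k => k.unop.hom (Polynomial.X : Polynomial R)) e
  exact this.trans (homLine_X (x i))

end Adjoint

variable (R) in
/-- The functor `E ⊗ -` on commutative algebras. -/
def tensorFunctor (E : Type u) [CommRing E] [Algebra R E] :
    CommAlgCat.{u} R ⥤ CommAlgCat.{u} R where
  obj B := .of R (E ⊗[R] B)
  map h := CommAlgCat.ofHom (Algebra.TensorProduct.map (.id R E) h.hom)
  map_id B := by
    apply CommAlgCat.hom_ext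
    apply Algebra.TensorProduct.ext' ; intro a b; rfl
  map_comp f g := by
    apply CommAlgCat.hom_ext
    apply Algebra.TensorProduct.ext' ; intro a b; rfl

variable (R) in
/-- Taking the product with the spectrum of `E` is dual to `E ⊗ -`. -/
def tensorLeftIso (E : Type u) [CommRing E] [Algebra R E] :
    tensorLeft (op (.of R E) : Aff R) ≅ (tensorFunctor R E).op :=
  NatIso.ofComponents (fun _ => Iso.refl _) fun f => by
    refine (Category.comp_id _).trans (Eq.trans ?_ (Category.id_comp _).symm)
    rfl

variable {E : Type u} [CommRing E] [Algebra R E]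

/-- Take E itself as the index set: some t in E ⊗ R^E has every e ∈ E among its coordinates. But t
is a finite sum of pure tensors, so its coordinates lie in a finitely generated submodule, which
must be E. -/
lemma finite_of_adjunction {G : Aff R ⥤ Aff R} (adj : (tensorFunctor R E).op ⊣ G) :
    Module.Finite R E := by
  obtain ⟨t, ht⟩ := exists_map_evalAlgHom_eq adj (ι := E) (fun e => (e ⊗ₜ[R] (1 : R) : E ⊗[R] R))
  have key : ∀ s : E ⊗[R] (E → R), ∃ N : Submodule R E, N.FG ∧ ∀ i : E,
      TensorProduct.rid R E (Algebra.TensorProduct.map (.id R E)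
        (Pi.evalAlgHom R (fun _ : E => R) i) s) ∈ N := by
    intro s
    induction s with
    | zero => exact ⟨⊥, Submodule.fg_bot, fun i => by simp⟩
    | tmul e f =>
      refine ⟨Submodule.span R {e}, Submodule.fg_span_singleton e, fun i => ?_⟩
      simpa using Submodule.smul_mem _ (f i) (Submodule.mem_span_singleton_self e)
    | add s s' h h' =>
      obtain ⟨N, hN, h⟩ := h
      obtain ⟨N', hN', h'⟩ := h'
      refine ⟨N ⊔ N', hN.sup hN', fun i => ?_⟩
      rw [map_add, map_add]
      exact add_mem (Submodule.mem_sup_left (h i)) (Submodule.mem_sup_right (h' i))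
  obtain ⟨N, hN, h⟩ := key t
  have : N = ⊤ := by
    rw [eq_top_iff]
    intro e _
    have h1 := h e
    have h2 : Algebra.TensorProduct.map (.id R E) (Pi.evalAlgHom R (fun _ : E => R) e) t =
        e ⊗ₜ[R] (1 : R) := ht e
    rw [h2] at h1
    simpa using h1
  exact ⟨this ▸ hN⟩

/-- For r ≠ 0 the substitution X ↦ rX is injective on R[X], hence stays injective after E ⊗ -. It
sends e ⊗ X to re ⊗ X, so re = 0 forces e ⊗ X = 0. -/
lemma isTorsionFree_of_adjunction [IsDomain R] {G : Aff R ⥤ Aff R}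
    (adj : (tensorFunctor R E).op ⊣ G) : Module.IsTorsionFree R E := by
  rw [Module.isTorsionFree_iff_smul_eq_zero]
  intro r e hre
  by_contra! hne
  obtain ⟨hr, he⟩ := hne
  let h : Polynomial R →ₐ[R] Polynomial R := Polynomial.aeval (Polynomial.C r * Polynomial.X)
  have hh : Function.Injective h := by
    intro p q hpq
    ext n
    have := congrArg (fun s => Polynomial.coeff s n) hpq
    change (p.comp (Polynomial.C r * Polynomial.X)).coeff n =
      (q.comp (Polynomial.C r * Polynomial.X)).coeff n at this
    rw [Polynomial.comp_C_mul_X_coeff, Polynomial.comp_C_mul_X_coeff] at this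
    exact mul_right_cancel₀ (pow_ne_zero n hr) this
  have inj : Function.Injective (Algebra.TensorProduct.map (.id R E) h) :=
    map_injective_of_adjunction adj (CommAlgCat.ofHom h) hh
  have h0 : e ⊗ₜ[R] (Polynomial.X : Polynomial R) = 0 := by
    apply inj
    rw [Algebra.TensorProduct.map_tmul, map_zero]
    have : h Polynomial.X = r • Polynomial.X := by
      simp [h, Polynomial.smul_eq_C_mul]
    rw [this, TensorProduct.tmul_smul, AlgHom.id_apply, TensorProduct.smul_tmul', hre,
      TensorProduct.zero_tmul]
  -- Setting X = 1 recovers e from e ⊗ X.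
  have h1 := congrArg (fun s => TensorProduct.rid R E (Algebra.TensorProduct.map (.id R E)
    (Polynomial.aeval (1 : R)) s)) h0
  simp at h1
  exact he h1

end Exponentiable

/-! ### The augmentation and the vertical lift of the representing algebra -/

noncomputable section Augmentation

open TangentStructure
open scoped TensorProduct

variable {R : Type u} [CommRing R] {E : Type u} [CommRing E] [Algebra R E]
  {𝕋 : TangentStructure (Aff R)} (adj : (tensorFunctor R E).op ⊣ 𝕋.T)

/-- The algebra map dual to the mate of the projection. -/
def tProj (B : CommAlgCat.{u} R) : E ⊗[R] B →ₐ[R] B := aProj adj B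

lemma tProj_map {B B' : CommAlgCat.{u} R} (h : B →ₐ[R] B') (x : E ⊗[R] B) :
    tProj adj B' (Algebra.TensorProduct.map (.id R E) h x) = h (tProj adj B x) :=
  aProj_natural adj (CommAlgCat.ofHom h) x

/-- The augmentation of the algebra representing a tangent structure. -/
def aug : E →ₐ[R] R :=
  (tProj adj (.of R R)).comp Algebra.TensorProduct.includeLeft

lemma tProj_tmul_one (B : CommAlgCat.{u} R) (e : E) :
    tProj adj B (e ⊗ₜ 1) = algebraMap R B (aug adj e) := by
  have := tProj_map adj (B := .of R R) (B' := B) (Algebra.ofId R B) (e ⊗ₜ 1)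
  rw [Algebra.TensorProduct.map_tmul, map_one] at this
  exact this

lemma tProj_one_tmul_polynomial (p : Polynomial R) :
    tProj adj (.of R (Polynomial R)) (1 ⊗ₜ p) =
      p.comp (tProj adj (.of R (Polynomial R)) (1 ⊗ₜ (Polynomial.X : Polynomial R))) := by
  let f : Polynomial R →ₐ[R] Polynomial R :=
    (tProj adj (.of R (Polynomial R))).comp Algebra.TensorProduct.includeRight
  exact (DFunLike.congr_fun (Polynomial.algHom_ext (f := f) (g := Polynomial.aeval
    (f Polynomial.X)) (by simp)) p)

/-- Naturality alone does not suffice, since over 𝔽_p the Frobenius is a natural endomorphism of all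
algebras. The existence of a section forces the polynomial to have degree one, and preservation of 0
and 1 then leaves only X. -/
lemma tProj_one_tmul_X [IsDomain R] :
    tProj adj (.of R (Polynomial R)) (1 ⊗ₜ (Polynomial.X : Polynomial R)) = Polynomial.X := by
  set f : Polynomial R :=
    tProj adj (.of R (Polynomial R)) (1 ⊗ₜ (Polynomial.X : Polynomial R)) with hf
  let ψ : E ⊗[R] Polynomial R →ₐ[R] Polynomial R :=
    Algebra.TensorProduct.lift ((Algebra.ofId R (Polynomial R)).comp (aug adj)) (.id R _)
      fun _ _ => .all _ _
  have h1 : tProj adj (.of R (Polynomial R)) = (Polynomial.aeval f).comp ψ := by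
    apply Algebra.TensorProduct.ext'
    intro e p
    have : (e ⊗ₜ p : E ⊗[R] Polynomial R) = e ⊗ₜ 1 * 1 ⊗ₜ p := by simp
    rw [this, map_mul, map_mul]
    congr 1
    · rw [tProj_tmul_one]
      simp [ψ]
    · rw [tProj_one_tmul_polynomial]
      simp [ψ, Polynomial.aeval_def, Polynomial.comp, Polynomial.eval₂_eq_eval_map]
      rfl
  -- Applied to the zero section of X, this factorisation exhibits X as a composite with f, so the
  -- degree of f divides 1.
  have h2 : (ψ (aZero adj (.of R (Polynomial R)) Polynomial.X)).comp f = Polynomial.X := by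
    have := aProj_aZero adj (B := .of R (Polynomial R)) (Polynomial.X : Polynomial R)
    exact (DFunLike.congr_fun h1 _).symm.trans this
  have hd : f.natDegree ≤ 1 := by
    have := congrArg Polynomial.natDegree h2
    rw [Polynomial.natDegree_comp, Polynomial.natDegree_X] at this
    exact (Nat.eq_one_of_mul_eq_one_left this).le
  have he : ∀ r : R, f.eval r = tProj adj (.of R R) (1 ⊗ₜ r) := by
    intro r
    have := tProj_map adj (B := .of R (Polynomial R)) (B' := .of R R) (Polynomial.aeval r)
      (1 ⊗ₜ (Polynomial.X : Polynomial R))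
    rw [Algebra.TensorProduct.map_tmul, Polynomial.aeval_X, map_one] at this
    rw [this, ← hf, Polynomial.coe_aeval_eq_eval]
  have h0 : f.eval 0 = 0 := by rw [he]; simp
  have h1 : f.eval 1 = 1 := by rw [he]; exact map_one _
  rw [Polynomial.eq_X_add_C_of_natDegree_le_one hd] at h0 h1 ⊢
  simp at h0
  simp [h0] at h1
  simp [h0, h1]

lemma tProj_one_tmul [IsDomain R] (B : CommAlgCat.{u} R) (b : B) :
    tProj adj B (1 ⊗ₜ b) = b := by
  have := tProj_map adj (B := .of R (Polynomial R)) (B' := B) (Polynomial.aeval b)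
    (1 ⊗ₜ (Polynomial.X : Polynomial R))
  rw [Algebra.TensorProduct.map_tmul, tProj_one_tmul_X, Polynomial.aeval_X, map_one] at this
  exact this

lemma tProj_tmul [IsDomain R] (B : CommAlgCat.{u} R) (e : E) (b : B) :
    tProj adj B (e ⊗ₜ b) = aug adj e • b := by
  have : (e ⊗ₜ b : E ⊗[R] B) = e ⊗ₜ 1 * 1 ⊗ₜ b := by simp
  rw [this, map_mul, tProj_tmul_one, tProj_one_tmul, Algebra.smul_def]

lemma mul_eq_zero_of_aug {x y : E} (hx : aug adj x = 0) (hy : aug adj y = 0) : x * y = 0 := by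
  have h := mul_eq_zero_of_aProj adj (B := .of R R) (x := (x ⊗ₜ (1 : R) : E ⊗[R] R))
    (y := (y ⊗ₜ (1 : R) : E ⊗[R] R)) hx hy
  have h' : (x ⊗ₜ (1 : R) : E ⊗[R] R) * (y ⊗ₜ (1 : R)) = 0 := h
  rw [Algebra.TensorProduct.tmul_mul_tmul] at h'
  have := congrArg (TensorProduct.rid R E) h'
  simpa using this

/-- The algebra map dual to the mate of the zero morphism, on the base ring. -/
def tZero : R →ₐ[R] E ⊗[R] R := aZero adj (.of R R)

/-- The algebra map dual to the mate of the vertical lift, on the base ring. -/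
def tLift : E ⊗[R] R →ₐ[R] E ⊗[R] (E ⊗[R] R) := aLift adj (.of R R)

lemma existsUnique_tLift (t : E ⊗[R] (E ⊗[R] R)) (h : tProj adj (.of R (E ⊗[R] R)) t = 0) :
    ∃! x : (E ⊗[R] R) × (E ⊗[R] R),
      (tProj adj (.of R R) x.1 = 0 ∧ tProj adj (.of R R) x.2 = 0) ∧
        tLift adj x.1 + Algebra.TensorProduct.map (.id R E) (tZero adj) x.2 = t := by
  have h0 : aZero adj ((tensorFunctor R E).obj (.of R R)) (aZero adj (.of R R) (0 : R)) = 0 :=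
    (congrArg _ (map_zero _)).trans (map_zero _)
  have := existsUnique_lift adj (B := .of R R) t (0 : R) (Eq.trans h (map_zero _).symm)
  simp only [h0, sub_zero] at this
  exact this

/-- The vertical lift of the algebra representing a tangent structure. -/
def coLift : E →ₐ[R] E ⊗[R] E :=
  (Algebra.TensorProduct.map (.id R E) (Algebra.TensorProduct.rid R R E).toAlgHom).comp
    ((tLift adj).comp
      Algebra.TensorProduct.includeLeft)

lemma aLift_tmul_one (e : E) :
    tLift adj (e ⊗ₜ 1) =
      Algebra.TensorProduct.map (.id R E) (Algebra.TensorProduct.rid R R E).symm.toAlgHom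
        (coLift adj e) := by
  have : (Algebra.TensorProduct.map (.id R E)
      (Algebra.TensorProduct.rid R R E).symm.toAlgHom).comp
      (Algebra.TensorProduct.map (.id R E) (Algebra.TensorProduct.rid R R E).toAlgHom) =
      AlgHom.id R _ := by
    rw [← Algebra.TensorProduct.map_comp]
    simp
  exact (DFunLike.congr_fun this _).symm

lemma tProj_self [IsDomain R] (t : E ⊗[R] E) :
    tProj adj (.of R E) t = TensorProduct.lid R E ((aug adj).toLinearMap.rTensor E t) := by
  induction t with
  | zero => simp
  | tmul x y => exact (tProj_tmul adj (.of R E) x y).trans (by simp)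
  | add x y hx hy => simp only [map_add, hx, hy]

lemma aProj_map_rid_symm [IsDomain R] (t : E ⊗[R] E) :
    tProj adj (.of R (E ⊗[R] R)) (Algebra.TensorProduct.map (.id R E)
      (Algebra.TensorProduct.rid R R E).symm.toAlgHom t) =
    (Algebra.TensorProduct.rid R R E).symm
      (TensorProduct.lid R E ((aug adj).toLinearMap.rTensor E t)) := by
  rw [← tProj_self]
  exact tProj_map adj (B := .of R E) (B' := .of R (E ⊗[R] R)) _ t

lemma map_aProj_map_rid_symm (t : E ⊗[R] E) :
    Algebra.TensorProduct.map (.id R E) (tProj adj (.of R R))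
      (Algebra.TensorProduct.map (.id R E)
      (Algebra.TensorProduct.rid R R E).symm.toAlgHom t) =
    (aug adj).toLinearMap.lTensor E t := by
  induction t with
  | zero => simp
  | tmul x y => rfl
  | add x y hx hy => simp only [map_add, hx, hy]

lemma aZero_aug {e : E} (he : aug adj e = 0) :
    aZero adj (.of R R) (aProj adj (.of R R) (e ⊗ₜ (1 : R) : E ⊗[R] R)) = 0 := by
  change aZero adj (.of R R) (aug adj e) = 0
  rw [he, map_zero]

/-- Both partial augmentations of the lift of e equal the zero section at the augmentation of e,
which vanishes here. With `rTensor_coLift`, the lift thus carries the augmentation ideal I into the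
part of E ⊗ E killed on both sides. -/
lemma lTensor_coLift {e : E} (he : aug adj e = 0) :
    (aug adj).toLinearMap.lTensor E (coLift adj e) = 0 := by
  have h := (map_aProj_aLift adj (B := .of R R) (e ⊗ₜ (1 : R) : E ⊗[R] R)).trans
    (aZero_aug adj he)
  rw [← map_aProj_map_rid_symm, ← aLift_tmul_one]
  exact h

lemma rTensor_coLift [IsDomain R] {e : E} (he : aug adj e = 0) :
    (aug adj).toLinearMap.rTensor E (coLift adj e) = 0 := by
  have h := (aProj_aLift adj (B := .of R R) (e ⊗ₜ (1 : R) : E ⊗[R] R)).trans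
    (aZero_aug adj he)
  have h' := aProj_map_rid_symm adj (coLift adj e)
  rw [← aLift_tmul_one] at h'
  have h'' : (Algebra.TensorProduct.rid R R E).symm
      (TensorProduct.lid R E ((aug adj).toLinearMap.rTensor E (coLift adj e))) = (0 : E ⊗[R] R) :=
    h'.symm.trans h
  rwa [EmbeddingLike.map_eq_zero_iff, EmbeddingLike.map_eq_zero_iff] at h''

/-- The vertical lift identifies the augmentation ideal with its tensor square. -/
lemma existsUnique_coLift [IsDomain R] (t : E ⊗[R] E)
    (h1 : (aug adj).toLinearMap.rTensor E t = 0) (h2 : (aug adj).toLinearMap.lTensor E t = 0) :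
    ∃! e : E, aug adj e = 0 ∧ coLift adj e = t := by
  let i : E ⊗[R] E →ₐ[R] E ⊗[R] (E ⊗[R] R) := Algebra.TensorProduct.map (.id R E)
      (Algebra.TensorProduct.rid R R E).symm.toAlgHom
  have hi : Function.Injective i :=
    (Algebra.TensorProduct.congr (AlgEquiv.refl (R := R) (A₁ := E))
      (Algebra.TensorProduct.rid R R E).symm).injective
  have hr : ∀ x : E ⊗[R] R, x = (Algebra.TensorProduct.rid R R E x) ⊗ₜ (1 : R) := fun x =>
    ((Algebra.TensorProduct.rid R R E).symm_apply_apply x).symm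
  have hb : tProj adj (.of R (E ⊗[R] R)) (i t) = 0 := by
    refine (aProj_map_rid_symm adj t).trans ?_
    rw [h1, map_zero, map_zero]
  obtain ⟨⟨u, v⟩, ⟨⟨hu, hv⟩, huv⟩, huniq⟩ := existsUnique_tLift adj (i t) hb
  dsimp only at hu hv huv
  have hz : ∀ v : E ⊗[R] R, Algebra.TensorProduct.map (.id R E) (tProj adj (.of R R))
      (Algebra.TensorProduct.map (.id R E) (tZero adj) v) =
      v := by
    intro v
    have : (Algebra.TensorProduct.map (.id R E) (tProj adj (.of R R))).comp
      (Algebra.TensorProduct.map (.id R E) (tZero adj)) =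
      AlgHom.id R _ := by
      rw [← Algebra.TensorProduct.map_comp]
      exact Algebra.TensorProduct.ext' fun a b =>
        congrArg (a ⊗ₜ[R] ·) (aProj_aZero adj (B := .of R R) b)
    exact DFunLike.congr_fun this v
  -- Augmenting the second factor kills both t and the lift of u, while it recovers v because the
  -- zero section splits the projection. Hence the zero summand of the universal decomposition
  -- disappears.
  have hv0 : v = 0 := by
    have h := congrArg
      (Algebra.TensorProduct.map (.id R E) (tProj adj (.of R R))) huv
    have e1 : Algebra.TensorProduct.map (.id R E) (tProj adj (.of R R)) (tLift adj u) = 0 :=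
      (map_aProj_aLift adj (B := .of R R) u).trans
        ((congrArg (aZero adj (.of R R)) hu).trans (map_zero _))
    rw [map_add, e1, hz, _root_.zero_add] at h
    exact h.trans ((map_aProj_map_rid_symm adj t).trans h2)
  have hlift : ∀ x : E, tLift adj (x ⊗ₜ (1 : R)) = i (coLift adj x) :=
    fun x => aLift_tmul_one adj x
  refine ⟨Algebra.TensorProduct.rid R R E u, ⟨?_, ?_⟩, ?_⟩
  · rw [hr u] at hu
    exact hu
  · apply hi
    rw [← hlift, ← hr, ← huv, hv0, map_zero, _root_.add_zero]
  · rintro e ⟨he1, he2⟩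
    have := huniq ((e ⊗ₜ (1 : R) : E ⊗[R] R), 0) ⟨⟨he1, map_zero _⟩, by
      rw [hlift, he2, map_zero, _root_.add_zero]⟩
    have h3 := congrArg (fun x => Algebra.TensorProduct.rid R R E x.1) this
    simpa using h3

end Augmentation

/-! ### The rank of the augmentation ideal -/

noncomputable section Rank

open TangentStructure
open scoped TensorProduct

variable {R : Type u} [CommRing R] {E : Type u}

section LinearAlgebra

variable [AddCommGroup E] [Module R E] (φ : E →ₗ[R] R) (e₁ : E)

/-- The projection onto the kernel of a split linear form. -/
def kerProj (h : φ e₁ = 1) : E →ₗ[R] LinearMap.ker φ :=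
  (LinearMap.id - φ.smulRight e₁).codRestrict _ fun x => by simp [h]

variable {φ e₁}

lemma coe_kerProj (h : φ e₁ = 1) (x : E) : (kerProj φ e₁ h x : E) = x - φ x • e₁ := rfl

lemma kerProj_comp_subtype (h : φ e₁ = 1) :
    kerProj φ e₁ h ∘ₗ (LinearMap.ker φ).subtype = LinearMap.id := by
  ext x
  simp [coe_kerProj]

/-- Expanding (id - φ(·)e₁) ⊗ (id - φ(·)e₁) leaves t and corrections that factor through the two
partial contractions of t. The splitting, rather than flatness, thus identifies the tensors killed
on both sides with those coming from ker φ ⊗ ker φ. -/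
lemma map_subtype_map_kerProj (h : φ e₁ = 1) (t : E ⊗[R] E) (h1 : φ.rTensor E t = 0)
    (h2 : φ.lTensor E t = 0) :
    TensorProduct.map (LinearMap.ker φ).subtype (LinearMap.ker φ).subtype
      (TensorProduct.map (kerProj φ e₁ h) (kerProj φ e₁ h) t) = t := by
  have key : ∀ t : E ⊗[R] E, TensorProduct.map (LinearMap.ker φ).subtype (LinearMap.ker φ).subtype
      (TensorProduct.map (kerProj φ e₁ h) (kerProj φ e₁ h) t) =
      t - (LinearMap.toSpanSingleton R E e₁).rTensor E (φ.rTensor E t) -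
        (LinearMap.toSpanSingleton R E e₁).lTensor E (φ.lTensor E t) +
        (LinearMap.toSpanSingleton R E e₁).rTensor E ((LinearMap.toSpanSingleton R E e₁).lTensor R
          (φ.rTensor R (φ.lTensor E t))) := by
    intro t
    induction t with
    | zero => simp
    | tmul x y =>
      simp [coe_kerProj, TensorProduct.sub_tmul, TensorProduct.tmul_sub, smul_sub]
      abel
    | add x y hx hy => simp only [map_add, hx, hy]; abel
  rw [key, h1, h2]
  simp

/-- A module with a bijective coproduct on the kernel of a split linear form. -/
lemma finrank_ker_mul_self [IsDomain R] [IsPrincipalIdealRing R] [Module.Finite R E]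
    [Module.IsTorsionFree R E] (h : φ e₁ = 1) (l : E →ₗ[R] E ⊗[R] E)
    (h1 : ∀ x, φ x = 0 → φ.rTensor E (l x) = 0) (h2 : ∀ x, φ x = 0 → φ.lTensor E (l x) = 0)
    (h3 : ∀ t, φ.rTensor E t = 0 → φ.lTensor E t = 0 → ∃! x, φ x = 0 ∧ l x = t) :
    Module.finrank R (LinearMap.ker φ) =
      Module.finrank R (LinearMap.ker φ) * Module.finrank R (LinearMap.ker φ) := by
  have : Module.Free R E := Module.free_of_finite_type_torsion_free'
  let k : LinearMap.ker φ →ₗ[R] LinearMap.ker φ ⊗[R] LinearMap.ker φ :=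
    TensorProduct.map (kerProj φ e₁ h) (kerProj φ e₁ h) ∘ₗ l ∘ₗ (LinearMap.ker φ).subtype
  have hk : ∀ x, TensorProduct.map (LinearMap.ker φ).subtype (LinearMap.ker φ).subtype (k x) =
      l x := fun x => map_subtype_map_kerProj h _ (h1 x x.2) (h2 x x.2)
  have inj : Function.Injective k := by
    rw [injective_iff_map_eq_zero]
    intro x hx
    have hl : l x = 0 := by rw [← hk, hx, map_zero]
    exact Subtype.ext ((h3 0 (map_zero _) (map_zero _)).unique ⟨x.2, hl⟩ ⟨map_zero _, map_zero _⟩)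
  have surj : Function.Surjective k := by
    intro t
    let t' := TensorProduct.map (LinearMap.ker φ).subtype (LinearMap.ker φ).subtype t
    have e1 : φ.rTensor E t' = 0 := by
      rw [← LinearMap.comp_apply, LinearMap.rTensor_comp_map]
      have : φ ∘ₗ (LinearMap.ker φ).subtype = 0 := by ext x; exact x.2
      rw [this, TensorProduct.map_zero_left, LinearMap.zero_apply]
    have e2 : φ.lTensor E t' = 0 := by
      rw [← LinearMap.comp_apply, LinearMap.lTensor_comp_map]
      have : φ ∘ₗ (LinearMap.ker φ).subtype = 0 := by ext x; exact x.2
      rw [this, TensorProduct.map_zero_right, LinearMap.zero_apply]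
    obtain ⟨x, ⟨hx, hx'⟩, -⟩ := h3 t' e1 e2
    refine ⟨⟨x, hx⟩, ?_⟩
    change TensorProduct.map (kerProj φ e₁ h) (kerProj φ e₁ h) (l x) = t
    rw [hx', ← LinearMap.comp_apply, ← TensorProduct.map_comp, kerProj_comp_subtype,
      TensorProduct.map_id, LinearMap.id_apply]
  -- The isomorphism ker φ ≅ ker φ ⊗ ker φ gives n = n² for the rank.
  have := (LinearEquiv.ofBijective k ⟨inj, surj⟩).finrank_eq
  rwa [Module.finrank_tensorProduct] at this

end LinearAlgebra

variable [CommRing E] [Algebra R E] [IsDomain R] [IsPrincipalIdealRing R]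
  {𝕋 : TangentStructure (Aff R)} (adj : (tensorFunctor R E).op ⊣ 𝕋.T)

include adj in
/-- Either the augmentation is an isomorphism, or its kernel is free of rank one on an element
whose vertical lift is its tensor square. -/
theorem bijective_aug_or_exists_generator : Function.Bijective (aug adj) ∨
    ∃ e : E, aug adj e = 0 ∧ (∀ x, aug adj x = 0 → ∃ r : R, r • e = x) ∧
      (∀ r : R, r • e = 0 → r = 0) ∧ coLift adj e = e ⊗ₜ e := by
  have : Module.Finite R E := finite_of_adjunction adj
  have : Module.IsTorsionFree R E := isTorsionFree_of_adjunction adj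
  have : Module.Free R E := Module.free_of_finite_type_torsion_free'
  have h1 : (aug adj).toLinearMap 1 = 1 := map_one (aug adj)
  have hn := finrank_ker_mul_self (φ := (aug adj).toLinearMap) (e₁ := 1) h1
    (coLift adj).toLinearMap (fun _ => rTensor_coLift adj) (fun _ => lTensor_coLift adj)
    (existsUnique_coLift adj)
  obtain h0 | h0 := Nat.eq_zero_or_pos (Module.finrank R (LinearMap.ker (aug adj).toLinearMap))
  · left
    have hs : Subsingleton (LinearMap.ker (aug adj).toLinearMap) :=
      Module.finrank_zero_iff.mp h0
    refine ⟨(injective_iff_map_eq_zero _).2 fun x hx => ?_, fun r => ⟨algebraMap R E r, by simp⟩⟩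
    exact congrArg Subtype.val (Subsingleton.elim
      (⟨x, hx⟩ : LinearMap.ker (aug adj).toLinearMap) 0)
  · right
    have hn1 : Module.finrank R (LinearMap.ker (aug adj).toLinearMap) = 1 :=
      (Nat.eq_of_mul_eq_mul_left h0 (by rw [← hn, mul_one])).symm
    let b := Module.basisUnique Unit hn1
    let e₀ : E := (b () : LinearMap.ker (aug adj).toLinearMap)
    have he₀ : aug adj e₀ = 0 := (b ()).2
    have hgen : ∀ x, aug adj x = 0 → ∃ r : R, r • e₀ = x := by
      intro x hx
      refine ⟨b.repr ⟨x, hx⟩ (), ?_⟩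
      have := b.sum_repr ⟨x, hx⟩
      rw [Fintype.sum_unique] at this
      exact congrArg Subtype.val this
    have hfree : ∀ r : R, r • e₀ = 0 → r = 0 := by
      intro r hr
      have : r • b () = 0 := Subtype.ext hr
      have h := b.ne_zero ()
      exact (smul_eq_zero.mp this).resolve_right h
    have k1 : (aug adj).toLinearMap.rTensor E (e₀ ⊗ₜ e₀) = 0 := by
      simp [he₀]
    have k2 : (aug adj).toLinearMap.lTensor E (e₀ ⊗ₜ e₀) = 0 := by
      simp [he₀]
    -- The lift reaches e₀ ⊗ e₀, at some multiple a • e₀ of the generator; below, the lift of e₀ is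
    -- r • (e₀ ⊗ e₀).
    obtain ⟨u, ⟨hu, hu'⟩, -⟩ := existsUnique_coLift adj _ k1 k2
    obtain ⟨a, rfl⟩ := hgen u hu
    -- the lift of the generator is a multiple of its square
    have k3 := map_subtype_map_kerProj (φ := (aug adj).toLinearMap) h1 (coLift adj e₀)
      (rTensor_coLift adj he₀) (lTensor_coLift adj he₀)
    have k4 : ∀ t : LinearMap.ker (aug adj).toLinearMap ⊗[R] LinearMap.ker (aug adj).toLinearMap,
        ∃ r : R, TensorProduct.map (LinearMap.ker (aug adj).toLinearMap).subtype
          (LinearMap.ker (aug adj).toLinearMap).subtype t = r • (e₀ ⊗ₜ[R] e₀) := by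
      intro t
      induction t with
      | zero => exact ⟨0, by simp⟩
      | tmul x y =>
        obtain ⟨r, hr⟩ := hgen x x.2
        obtain ⟨s, hs⟩ := hgen y y.2
        refine ⟨r * s, ?_⟩
        rw [TensorProduct.map_tmul, Submodule.subtype_apply, Submodule.subtype_apply, ← hr, ← hs,
          TensorProduct.smul_tmul_smul]
      | add x y hx hy =>
        obtain ⟨r, hr⟩ := hx
        obtain ⟨s, hs⟩ := hy
        exact ⟨r + s, by rw [map_add, hr, hs, add_smul]⟩
    obtain ⟨r, hr⟩ := k4 (TensorProduct.map (kerProj _ _ h1) (kerProj _ _ h1) (coLift adj e₀))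
    rw [k3] at hr
    rw [map_smul, hr, smul_smul] at hu'
    -- The elements ra • e₀ and e₀ have the same lift, so uniqueness and freeness make r a unit with
    -- inverse a.
    have har : a * r = 1 := by
      have h5 : (r * a) • e₀ = e₀ :=
        (existsUnique_coLift adj _ (rTensor_coLift adj he₀) (lTensor_coLift adj he₀)).unique
          ⟨by rw [map_smul, he₀, smul_zero], by
            rw [mul_smul, map_smul, map_smul, hr, smul_smul a, hu']⟩ ⟨he₀, rfl⟩
      have h6 := hfree (r * a - 1) (by rw [sub_smul, h5, one_smul, sub_self])
      rw [mul_comm, ← sub_eq_zero, h6]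
    -- The scaling by r normalises the lift: r • e₀ lifts to r² • (e₀ ⊗ e₀), the tensor square of r
    -- • e₀.
    refine ⟨r • e₀, by rw [map_smul, he₀, smul_zero], ?_, ?_, ?_⟩
    · intro x hx
      obtain ⟨s, rfl⟩ := hgen x hx
      exact ⟨s * a, by rw [smul_smul, mul_assoc, har, mul_one]⟩
    · intro s hs
      rw [smul_smul] at hs
      have := hfree _ hs
      calc s = s * (a * r) := by rw [har, mul_one]
        _ = (s * r) * a := by ring
        _ = 0 := by rw [this, zero_mul]
    · rw [map_smul, hr, TensorProduct.smul_tmul_smul, smul_smul]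

end Rank

/-! ### Rigidity of tangent structures on dual numbers -/

noncomputable section DualModel

open TangentStructure

variable {R : Type u} [CommRing R]

/-- Comparing coefficients gives n_0 = 0 and n_{k+1} = 2 n_{2k+1}. For k = 0 this reads n_1 = 2 n_1;
for k > 0 the index on the right is larger, so the leading coefficient would vanish. No restriction
on the characteristic is needed. -/
lemma polynomial_eq_zero_of_comp_sq (n : Polynomial R)
    (h : n.comp (Polynomial.X ^ 2) = 2 * Polynomial.X * n) : n = 0 := by
  have hc : ∀ k, n.coeff k = (2 * Polynomial.X * n).coeff (2 * k) := by
    intro k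
    rw [← h, ← Polynomial.expand_eq_comp_X_pow, mul_comm 2 k,
      Polynomial.coeff_expand_mul two_pos]
  have hc' : ∀ k, n.coeff (k + 1) = 2 * n.coeff (2 * k + 1) := by
    intro k
    rw [hc, show 2 * (k + 1) = 2 * k + 1 + 1 by ring, mul_assoc, ← Polynomial.C_ofNat,
      Polynomial.coeff_C_mul, Polynomial.coeff_X_mul]
  have h0 : n.coeff 0 = 0 := by
    rw [hc, mul_zero, mul_assoc, ← Polynomial.C_ofNat, Polynomial.coeff_C_mul,
      Polynomial.coeff_X_mul_zero, mul_zero]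
  have h1 : n.coeff 1 = 0 := by
    have := hc' 0
    rw [mul_zero, _root_.zero_add, two_mul] at this
    simpa using this
  by_contra hn
  have hd : n.coeff n.natDegree ≠ 0 := Polynomial.leadingCoeff_ne_zero.mpr hn
  obtain hd0 | ⟨k, hk⟩ : n.natDegree = 0 ∨ ∃ k, n.natDegree = k + 1 := by
    cases n.natDegree with
    | zero => exact .inl rfl
    | succ k => exact .inr ⟨k, rfl⟩
  · exact hd (hd0 ▸ h0)
  · obtain rfl | hk0 := Nat.eq_zero_or_pos k
    · exact hd (hk ▸ h1)
    · apply hd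
      rw [hk, hc', Polynomial.coeff_eq_zero_of_natDegree_lt (by omega), mul_zero]

/-- A natural derivation of all commutative algebras vanishes. -/
lemma eq_zero_of_natural_derivation (δ : ∀ B : CommAlgCat.{u} R, B → B)
    (nat : ∀ {B B' : CommAlgCat.{u} R} (h : B →ₐ[R] B') (b : B), δ B' (h b) = h (δ B b))
    (leib : ∀ (B : CommAlgCat.{u} R) (a b : B), δ B (a * b) = a * δ B b + b * δ B a)
    (B : CommAlgCat.{u} R) (b : B) : δ B b = 0 := by
  let n : Polynomial R := δ (.of R (Polynomial R)) (Polynomial.X : Polynomial R)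
  -- The value at X² is computed twice: by naturality along X ↦ X² it is n(X²), by the Leibniz rule
  -- it is 2Xn.
  have h0 : n = 0 := by
    apply polynomial_eq_zero_of_comp_sq
    have h1 : δ (.of R (Polynomial R)) (Polynomial.aeval (Polynomial.X ^ 2 : Polynomial R)
        (Polynomial.X : Polynomial R)) = n.comp (Polynomial.X ^ 2) :=
      nat (B := .of R (Polynomial R)) (B' := .of R (Polynomial R)) _ _
    have h2 : δ (.of R (Polynomial R)) ((Polynomial.X : Polynomial R) * Polynomial.X) =
        Polynomial.X * n + Polynomial.X * n := leib (.of R (Polynomial R)) _ _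
    rw [Polynomial.aeval_X, pow_two, h2] at h1
    rw [pow_two, ← h1]
    ring
  have h1 := nat (B := .of R (Polynomial R)) (B' := B) (Polynomial.aeval b)
    (Polynomial.X : Polynomial R)
  rw [Polynomial.aeval_X] at h1
  exact h1.trans ((congrArg _ h0).trans (map_zero _))

variable {𝕋 : TangentStructure (Aff R)} (adj : (dualFunctor R).op ⊣ 𝕋.T)

/-- The projection and the vertical lift of a tangent structure whose tangent bundle functor is
right adjoint to the dual of the dual numbers are the standard ones. -/
structure IsStandard : Prop where
  proj : ∀ (B : CommAlgCat.{u} R) (x : B[ε]), aProj adj B x = x.fst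
  lift : aLift adj (.of R R) (DualNumber.eps : R[ε]) =
    (TrivSqZeroExt.inr (TrivSqZeroExt.inr 1) : R[ε][ε])

/-- The zero section with values in dual numbers. -/
def dZero (B : CommAlgCat.{u} R) : B →ₐ[R] B[ε] := aZero adj B

/-- The vertical lift on dual numbers. -/
def dLift (B : CommAlgCat.{u} R) : B[ε] →ₐ[R] B[ε][ε] := aLift adj B

/-- The canonical flip on iterated dual numbers. -/
def dFlip (B : CommAlgCat.{u} R) : B[ε][ε] →ₐ[R] B[ε][ε] := aFlip adj B

variable {adj}

namespace IsStandard

open TrivSqZeroExt TanAlg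

variable (H : IsStandard adj) (B : CommAlgCat.{u} R)

include H

/-- The ε-component of a natural section of B[ε] → B is a natural derivation of B, hence zero. -/
lemma dZero_eq (b : B) : dZero adj B b = inl b := by
  have hfst : ∀ (B : CommAlgCat.{u} R) (b : B), (dZero adj B b).fst = b := fun B b =>
    (H.proj B _).symm.trans (aProj_aZero adj b)
  refine TrivSqZeroExt.ext (hfst B b) ?_
  refine eq_zero_of_natural_derivation (fun B b => (dZero adj B b).snd) ?_ ?_ B b
  · intro B B' h b
    have : dZero adj B' (h b) = dualMap h (dZero adj B b) :=
      aZero_natural adj (CommAlgCat.ofHom h) b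
    change (dZero adj B' (h b)).snd = _
    rw [this, snd_dualMap]
  · intro B a b
    simp only [map_mul, snd_mul, hfst, smul_eq_mul, op_smul_eq_smul]

lemma fst_dLift (x : B[ε]) : (dLift adj B x).fst = inl x.fst := by
  have h := aProj_aLift adj (B := B) x
  rw [H.proj] at h
  refine ((H.proj (.of R B[ε]) _).symm.trans h).trans (H.dZero_eq B _)

lemma fst_snd_dLift (x : B[ε]) : (dLift adj B x).snd.fst = 0 := by
  have h := map_aProj_aLift adj (B := B) x
  have h1 := congrArg (TrivSqZeroExt.snd (R := B) (M := B)) h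
  rw [H.proj] at h1
  have h2 : (dZero adj B x.fst).snd = 0 := by rw [H.dZero_eq, snd_inl]
  refine ((H.proj B _).symm.trans ?_).trans (h1.trans h2)
  exact (snd_dualMap (R := R) (aProj adj B) (dLift adj B x)).symm

omit H in
lemma dLift_natural {B B' : CommAlgCat.{u} R} (h : B →ₐ[R] B') (x : B[ε]) :
    dLift adj B' (dualMap h x) = dualMap (dualMap h) (dLift adj B x) :=
  aLift_natural adj (CommAlgCat.ofHom h) x

/-- The two projections determine every component except the one at the product of the two
infinitesimals. On B that last component is a natural derivation, because the mixed first-order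
terms vanish. -/
lemma dLift_inl (b : B) : dLift adj B (inl b) = inl (inl b) := by
  refine TrivSqZeroExt.ext (H.fst_dLift B _)
    (TrivSqZeroExt.ext (H.fst_snd_dLift B _) ?_)
  refine eq_zero_of_natural_derivation (fun B b => (dLift adj B (inl b)).snd.snd) ?_ ?_ B b
  · intro B B' h b
    have e : (inl (h b) : B'[ε]) = dualMap h (inl b) := by ext <;> simp
    change (dLift adj B' (inl (h b))).snd.snd = _
    rw [e, dLift_natural, snd_dualMap, snd_dualMap]
  · intro B a b
    have : (inl (a * b) : B[ε]) = inl a * inl b := by simp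
    rw [this, map_mul]
    simp only [snd_mul, snd_add, H.fst_dLift, fst_inl, smul_eq_mul, op_smul_eq_smul,
      snd_inl, H.fst_snd_dLift, mul_zero, _root_.add_zero]

/-- Naturality along R → B carries the normalisation over the base ring to every B. -/
lemma dLift_eps : dLift adj B DualNumber.eps = inr (inr 1) := by
  have e : (DualNumber.eps : B[ε]) = dualMap (Algebra.ofId R B) (DualNumber.eps : R[ε]) :=
    TrivSqZeroExt.ext (by rw [fst_dualMap, DualNumber.fst_eps, DualNumber.fst_eps, map_zero])
      (by rw [snd_dualMap, DualNumber.snd_eps, DualNumber.snd_eps, map_one])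
  have e2 : dLift adj (.of R R) (DualNumber.eps : R[ε]) = (inr (inr 1) : R[ε][ε]) := H.lift
  have e3 := dLift_natural (adj := adj) (B := .of R R) (B' := B) (Algebra.ofId R B)
    (DualNumber.eps : R[ε])
  rw [e]
  refine e3.trans ((congrArg _ e2).trans ?_)
  ext <;> simp

lemma dLift_eq (x : B[ε]) : dLift adj B x = inl (inl x.fst) + inr (inr x.snd) := by
  have : x = inl x.fst + inl x.snd * DualNumber.eps := by ext <;> simp
  conv_lhs => rw [this, map_add, map_mul, H.dLift_inl, H.dLift_inl, H.dLift_eps]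
  ext <;> simp

lemma fst_dFlip (x : B[ε][ε]) : (dFlip adj B x).fst = dualMap (fstHom R B B) x := by
  have h := aProj_aFlip adj (B := B) x
  have e : aProj adj B = fstHom R B B := AlgHom.ext (H.proj B)
  rw [e] at h
  exact (H.proj (.of R B[ε]) _).symm.trans h

lemma fst_snd_dFlip (x : B[ε][ε]) : (dFlip adj B x).snd.fst = x.fst.snd := by
  have h := map_aProj_aFlip adj (B := B) x
  have e : aProj adj B = fstHom R B B := AlgHom.ext (H.proj B)
  rw [e] at h
  have h1 := congrArg (TrivSqZeroExt.snd (R := B) (M := B))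
    (h.trans (H.proj (.of R B[ε]) x))
  exact (snd_dualMap (R := R) (fstHom R B B) (dFlip adj B x)).symm.trans h1

lemma dFlip_inl_inl (b : B) : dFlip adj B (inl (inl b)) = inl (inl b) := by
  refine TrivSqZeroExt.ext ((H.fst_dFlip B _).trans ?_)
    (TrivSqZeroExt.ext (H.fst_snd_dFlip B _) ?_)
  · ext <;> simp
  refine eq_zero_of_natural_derivation (fun B b => (dFlip adj B (inl (inl b))).snd.snd) ?_ ?_ B b
  · intro B B' h b
    have e : (inl (inl (h b)) : B'[ε][ε]) = dualMap (dualMap h) (inl (inl b)) := by ext <;> simp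
    have e' : dFlip adj B' (dualMap (dualMap h) (inl (inl b))) =
      dualMap (dualMap h) (dFlip adj B (inl (inl b))) := aFlip_natural adj (CommAlgCat.ofHom h) _
    change (dFlip adj B' (inl (inl (h b)))).snd.snd = _
    rw [e, e', snd_dualMap, snd_dualMap]
  · intro B a b
    have : (inl (inl (a * b)) : B[ε][ε]) = inl (inl a) * inl (inl b) := by simp
    rw [this, map_mul]
    simp only [snd_mul, snd_add, H.fst_dFlip, fst_dualMap, snd_dualMap, fst_inl,
      smul_eq_mul, op_smul_eq_smul, snd_inl, H.fst_snd_dFlip, mul_zero, _root_.add_zero,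
      fstHom_apply, map_zero]

/-- The flip intertwines the two zero sections of the tangent bundle; involutivity then settles the
other infinitesimal direction. -/
lemma dFlip_inr_inl (b : B) : dFlip adj B (inr (inl b)) = inl (inr b) := by
  have h := aFlip_map_aZero adj (B := B) (inr b : B[ε])
  have e : (inr (inl b) : B[ε][ε]) = dualMap (dZero adj B) (inr b) := by
    ext <;> simp [H.dZero_eq]
  rw [e]
  exact h.trans (H.dZero_eq (.of R B[ε]) _)

omit H in
lemma dFlip_dFlip (x : B[ε][ε]) : dFlip adj B (dFlip adj B x) = x := aFlip_aFlip adj x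

lemma dFlip_inl_inr (b : B) : dFlip adj B (inl (inr b)) = inr (inl b) := by
  rw [← H.dFlip_inr_inl, dFlip_dFlip]

lemma dFlip_eq (x : B[ε][ε]) : dFlip adj B x =
    inl (inl x.fst.fst) + inl (inr x.snd.fst) + inr (inl x.fst.snd) + inr (inr x.snd.snd) := by
  -- The top component is a product of elements from the two first-order directions, so
  -- multiplicativity determines the flip there.
  have : x = inl (inl x.fst.fst) + inr (inl x.snd.fst) + inl (inr x.fst.snd) +
      inr (inl x.snd.snd) * inl (inr 1) := by ext <;> simp
  conv_lhs => rw [this, map_add, map_add, map_add, map_mul, H.dFlip_inl_inl, H.dFlip_inr_inl,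
    H.dFlip_inl_inr, H.dFlip_inr_inl, H.dFlip_inl_inr]
  ext <;> simp

end IsStandard

/-- Two tangent structures with standard projection and vertical lift are isomorphic. -/
lemma IsStandard.nonempty_iso {𝕊 : TangentStructure (Aff R)} {adj' : (dualFunctor R).op ⊣ 𝕊.T}
    (H : IsStandard adj) (H' : IsStandard adj') : Nonempty (TangentStructure.Iso 𝕋 𝕊) := by
  have hp : ∀ X, mp adj X = mp adj' X := fun X => Quiver.Hom.unop_inj (CommAlgCat.hom_ext
    (AlgHom.ext fun x => (H.proj X.unop x).trans (H'.proj X.unop x).symm))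
  have hz : ∀ X, mz adj X = mz adj' X := fun X => Quiver.Hom.unop_inj (CommAlgCat.hom_ext
    (AlgHom.ext fun x => (H.dZero_eq X.unop x).trans (H'.dZero_eq X.unop x).symm))
  refine ⟨isoOfMates adj adj' hp hz ?_ ?_ ?_⟩
  · intro X M a b w w'
    apply Quiver.Hom.unop_inj
    apply CommAlgCat.hom_ext
    apply AlgHom.ext
    intro x
    rw [msum_apply, msum_apply]
    unfold aZero aProj
    rw [hp, hz]
  · exact fun X => Quiver.Hom.unop_inj (CommAlgCat.hom_ext
      (AlgHom.ext fun x => (H.dLift_eq X.unop x).trans (H'.dLift_eq X.unop x).symm))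
  · exact fun X => Quiver.Hom.unop_inj (CommAlgCat.hom_ext
      (AlgHom.ext fun x => (H.dFlip_eq X.unop x).trans (H'.dFlip_eq X.unop x).symm))

end DualModel

/-! ### Mates under a change of the left adjoint -/

noncomputable section Transport

namespace TangentStructure

variable {C : Type u} [Category.{v} C] {𝕋 : TangentStructure C} {L L' : C ⥤ C}
  (adj : L ⊣ 𝕋.T) (α : L ≅ L')

lemma tr_ofNatIsoLeft {X M : C} (f : X ⟶ 𝕋.T.obj M) :
    tr (adj.ofNatIsoLeft α) f = α.inv.app X ≫ tr adj f :=
  adj.homEquiv_ofNatIsoLeft_symm_apply α f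

lemma pt_ofNatIsoLeft {X M : C} (a : L'.obj X ⟶ M) :
    pt (adj.ofNatIsoLeft α) a = pt adj (α.hom.app X ≫ a) :=
  adj.homEquiv_ofNatIsoLeft_apply α a

/-- Only the mates of the projection and the lift need transporting, as `IsStandard` refers to no
others. -/
lemma mp_ofNatIsoLeft (X : C) : mp (adj.ofNatIsoLeft α) X = mp adj X ≫ α.hom.app X := by
  rw [mp, pt_ofNatIsoLeft, Category.comp_id, comp_p adj, tr_pt]

lemma ml_ofNatIsoLeft (X : C) : ml (adj.ofNatIsoLeft α) X =
    α.inv.app (L'.obj X) ≫ L.map (α.inv.app X) ≫ ml adj X ≫ α.hom.app X := by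
  rw [ml, pt_ofNatIsoLeft, Category.comp_id, tr2, tr_ofNatIsoLeft, tr_ofNatIsoLeft, tr_comp]
  congr 2
  exact (tr2_comp_l adj _).trans (by rw [tr_pt])

end TangentStructure

end Transport

/-! ### Dual numbers as a tensor functor, and the Kähler adjunction -/

noncomputable section DualTensor

open TangentStructure TrivSqZeroExt TanAlg
open scoped TensorProduct

variable {R : Type u} [CommRing R]

/-- An augmented algebra whose augmentation ideal is free on an element of square zero is the
algebra of dual numbers. -/
def dualEquiv {E : Type u} [CommRing E] [Algebra R E] (φ : E →ₐ[R] R) (e : E) (he : φ e = 0)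
    (hee : e * e = 0) (hgen : ∀ x, φ x = 0 → ∃ r : R, r • e = x)
    (hfree : ∀ r : R, r • e = 0 → r = 0) : R[ε] ≃ₐ[R] E :=
  AlgEquiv.ofBijective (DualNumber.lift ⟨(Algebra.ofId R E, e), hee, fun r => .all _ _⟩) <| by
    have key : ∀ x : R[ε], DualNumber.lift (A := R) (B := E)
        ⟨(Algebra.ofId R E, e), hee, fun r => .all _ _⟩ x = algebraMap R E x.fst + x.snd • e := by
      intro x
      rw [DualNumber.lift_apply_apply, Algebra.smul_def]
      rfl
    have hφ : ∀ x : R[ε], φ (algebraMap R E x.fst + x.snd • e) = x.fst := by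
      intro x
      rw [map_add, map_smul, he, smul_zero, _root_.add_zero, AlgHom.commutes]
      rfl
    constructor
    · rw [injective_iff_map_eq_zero]
      intro x hx
      rw [key] at hx
      have h1 : x.fst = 0 := by rw [← hφ x, hx, map_zero]
      rw [h1, map_zero, _root_.zero_add] at hx
      exact TrivSqZeroExt.ext h1 (hfree _ hx)
    · intro y
      obtain ⟨r, hr⟩ := hgen (y - algebraMap R E (φ y)) (by
        rw [map_sub, AlgHom.commutes]; exact sub_self _)
      refine ⟨inl (φ y) + inr r, ?_⟩
      rw [key]
      simp [hr]

variable (R) in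
/-- The base change of the dual numbers. -/
def dualTensorEquiv (B : Type u) [CommRing B] [Algebra R B] : R[ε] ⊗[R] B ≃ₐ[R] B[ε] :=
  AlgEquiv.ofAlgHom
    (Algebra.TensorProduct.lift (dualMap (Algebra.ofId R B)) (inlAlgHom R B B)
      fun _ _ => .all _ _)
    (DualNumber.lift (R := R) (A := B) (B := R[ε] ⊗[R] B)
      ⟨(Algebra.TensorProduct.includeRight, DualNumber.eps ⊗ₜ 1), by
      simp [Algebra.TensorProduct.tmul_mul_tmul],
      fun b => by
      simp [commute_iff_eq, Algebra.TensorProduct.tmul_mul_tmul]⟩)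
    (by
      apply DualNumber.algHom_ext'
      · apply AlgHom.ext
        intro b
        simp
      · apply LinearMap.ext
        intro b
        ext <;> simp)
    (by
      apply Algebra.TensorProduct.ext
      · apply DualNumber.algHom_ext
        simp [DualNumber.lift_apply_apply]
      · ext b
        simp)

lemma dualTensorEquiv_symm_apply (B : Type u) [CommRing B] [Algebra R B] (x : B[ε]) :
    (dualTensorEquiv R B).symm x = 1 ⊗ₜ x.fst + DualNumber.eps ⊗ₜ x.snd := by
  refine (DualNumber.lift_apply_apply (R := R) (A := B) (B := R[ε] ⊗[R] B) _ x).trans ?_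
  simp [Algebra.TensorProduct.tmul_mul_tmul]

variable (R) in
/-- The functor `R[ε] ⊗ -` is the functor of dual numbers. -/
def dualFunctorIso : tensorFunctor R R[ε] ≅ dualFunctor R :=
  NatIso.ofComponents (fun B => CommAlgCat.isoMk (dualTensorEquiv R B)) fun {B B'} f => by
    apply CommAlgCat.hom_ext
    apply Algebra.TensorProduct.ext'
    intro x b
    change dualTensorEquiv R B' (x ⊗ₜ f.hom b) = dualMap f.hom (dualTensorEquiv R B (x ⊗ₜ b))
    simp only [dualTensorEquiv, AlgEquiv.ofAlgHom_apply, Algebra.TensorProduct.lift_tmul, map_mul]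
    ext <;> simp

/-- Isomorphic algebras define isomorphic functors. -/
def tensorFunctorCongr {E E' : Type u} [CommRing E] [Algebra R E] [CommRing E'] [Algebra R E']
    (e : E ≃ₐ[R] E') : tensorFunctor R E ≅ tensorFunctor R E' :=
  NatIso.ofComponents
    (fun _ => CommAlgCat.isoMk (Algebra.TensorProduct.congr e AlgEquiv.refl)) fun f => by
    apply CommAlgCat.hom_ext
    apply Algebra.TensorProduct.ext'
    intro x b
    rfl

variable (R) in
/-- The dual of the functor of dual numbers is left adjoint to the Kähler tangent bundle. -/
def kaehlerAdj : (dualFunctor R).op ⊣ (kaehlerTangentStructure R).T := (tanAdj R).op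

lemma tr_kaehlerAdj {A B : CommAlgCat.{u} R}
    (f : (op B : Aff R) ⟶ (kaehlerTangentStructure R).T.obj (op A)) (a : A) :
    (tr (kaehlerAdj R) f).unop.hom a =
      toDual (show TanAlg R A →ₐ[R] B from f.unop.hom) a := by
  have h : (tr (kaehlerAdj R) f).unop.hom =
      (dualMap (show TanAlg R A →ₐ[R] B from f.unop.hom)).comp (toDual (AlgHom.id R _)) := by
    rw [tr, Adjunction.homEquiv_counit]
    rfl
  rw [h, ← toDual_comp]
  rfl

lemma pt_kaehlerAdj_id (B : CommAlgCat.{u} R) :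
    (pt (kaehlerAdj R) (𝟙 ((dualFunctor R).op.obj (op B)))).unop.hom =
      liftDual (AlgHom.id R B[ε]) := by
  have h : pt (kaehlerAdj R) (𝟙 ((dualFunctor R).op.obj (op B))) =
      (kaehlerAdj R).unit.app (op B) := by
    rw [pt, Adjunction.homEquiv_unit, CategoryTheory.Functor.map_id]
    exact Category.comp_id _
  rw [h]
  rfl

/-- The generic point corresponds to `liftDual` of the identity. The four components of the
transposed lift at ε are its values after `vlift` on ε, dε, d'ε and d'dε, and only the last is
nonzero: d'dε ↦ dε ↦ 1. -/
lemma isStandard_kaehlerAdj : IsStandard (kaehlerAdj R) where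
  proj B x := by
    change (pt (kaehlerAdj R) (𝟙 ((dualFunctor R).op.obj (op B)))).unop.hom
      (incl R B[ε] x) = _
    rw [pt_kaehlerAdj_id]
    exact liftDual_incl _ _
  lift := by
    have h : ∀ x : TanAlg R (TanAlg R R[ε]), (pt (kaehlerAdj R) (𝟙 ((dualFunctor R).op.obj
        (op (.of R R)))) ≫ (kaehlerTangentStructure R).l.app _).unop.hom x =
        liftDual (AlgHom.id R R[ε]) (vlift R R[ε] x) := fun x =>
      DFunLike.congr_fun (pt_kaehlerAdj_id (.of R R)) (vlift R R[ε] x)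
    let g : TanAlg R (TanAlg R R[ε]) →ₐ[R] R :=
      (pt (kaehlerAdj R) (𝟙 ((dualFunctor R).op.obj (op (.of R R)))) ≫
        (kaehlerTangentStructure R).l.app _).unop.hom
    let u : TanAlg R R[ε] →ₐ[R] R[ε] := (tr (kaehlerAdj R)
      (pt (kaehlerAdj R) (𝟙 ((dualFunctor R).op.obj (op (.of R R)))) ≫
        (kaehlerTangentStructure R).l.app _)).unop.hom
    have hg : ∀ x, g x = liftDual (AlgHom.id R R[ε]) (vlift R R[ε] x) := h
    have hu : ∀ x, u x = toDual g x := tr_kaehlerAdj (A := .of R (TanAlg R R[ε])) (B := .of R R) _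
    refine (tr_kaehlerAdj (A := .of R R[ε]) (B := .of R R[ε]) _ DualNumber.eps).trans ?_
    change toDual u DualNumber.eps = _
    apply TrivSqZeroExt.ext <;> apply TrivSqZeroExt.ext <;> simp [hu, hg]

end DualTensor

/-! ### Fibre powers and square-zero extensions -/

noncomputable section FiberPowers

open TangentStructure TrivSqZeroExt TanAlg
open scoped TensorProduct

variable {R : Type u} [CommRing R]

/-- The square-zero extension of an algebra by the free module of rank `n`. -/
abbrev SqZ (n : ℕ) (B : Type u) [CommRing B] : Type u := TrivSqZeroExt B (Fin n → B)

variable {A B B' : Type u} [CommRing A] [Algebra R A] [CommRing B] [Algebra R B]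
  [CommRing B'] [Algebra R B']

/-- The algebra map into a square-zero extension given by derivations. -/
def mkSqZ {n : ℕ} (f : A →ₐ[R] B) (δ : Fin n → A →ₗ[R] B) (h : ∀ i, IsDer f (δ i)) :
    A →ₐ[R] SqZ n B :=
  AlgHom.ofLinearMap
    ((inlAlgHom R B (Fin n → B)).toLinearMap.comp f.toLinearMap +
      ((inrHom B (Fin n → B)).restrictScalars R).comp (LinearMap.pi δ))
    (by
      have h2 : ∀ i, δ i 1 = 0 := fun i => by simpa using (h i).leibniz 1 1
      ext <;> simp [h2])
    (fun a b => by ext <;> simp [(h _).leibniz])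

@[simp] lemma fst_mkSqZ {n : ℕ} (f : A →ₐ[R] B) (δ : Fin n → A →ₗ[R] B)
    (h : ∀ i, IsDer f (δ i)) (a : A) : (mkSqZ f δ h a).fst = f a := by
  simp [mkSqZ]

@[simp] lemma snd_mkSqZ {n : ℕ} (f : A →ₐ[R] B) (δ : Fin n → A →ₗ[R] B)
    (h : ∀ i, IsDer f (δ i)) (a : A) (i : Fin n) : (mkSqZ f δ h a).snd i = δ i a := by
  simp [mkSqZ]

/-- The functoriality of square-zero extensions. -/
def sqZMap (n : ℕ) (f : B →ₐ[R] B') : SqZ n B →ₐ[R] SqZ n B' :=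
  mkSqZ (f.comp (fstHom R B (Fin n → B)))
    (fun i => f.toLinearMap.comp
      ((LinearMap.proj i).comp ((sndHom B (Fin n → B)).restrictScalars R)))
    fun i => ⟨by intro a b; simp⟩

@[simp] lemma fst_sqZMap {n : ℕ} (f : B →ₐ[R] B') (x : SqZ n B) :
    (sqZMap n f x).fst = f x.fst := by simp [sqZMap]

@[simp] lemma snd_sqZMap {n : ℕ} (f : B →ₐ[R] B') (x : SqZ n B) (i : Fin n) :
    (sqZMap n f x).snd i = f (x.snd i) := by simp [sqZMap]

variable (R) in
/-- The functor of square-zero extensions by free modules of rank `n`. -/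
def sqZFunctor (n : ℕ) : CommAlgCat.{u} R ⥤ CommAlgCat.{u} R where
  obj B := .of R (SqZ n B)
  map f := CommAlgCat.ofHom (sqZMap n f.hom)
  map_id _ := CommAlgCat.hom_ext (AlgHom.ext fun x => by ext <;> simp)
  map_comp f g := CommAlgCat.hom_ext (AlgHom.ext fun x => by ext <;> simp)

variable (R) in
/-- The coordinate maps from a square-zero extension to dual numbers. -/
def sqZToDual {n : ℕ} (i : Fin n) (B : Type u) [CommRing B] [Algebra R B] : SqZ n B →ₐ[R] B[ε] :=
  mkDual (fstHom R B (Fin n → B))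
    ((LinearMap.proj i).comp ((sndHom B (Fin n → B)).restrictScalars R))
    ⟨by intro a b; simp⟩

@[simp] lemma fst_sqZToDual {n : ℕ} (i : Fin n) (x : SqZ n B) :
    (sqZToDual R i B x).fst = x.fst := by simp [sqZToDual]

@[simp] lemma snd_sqZToDual {n : ℕ} (i : Fin n) (x : SqZ n B) :
    (sqZToDual R i B x).snd = x.snd i := by simp [sqZToDual]

variable (R) in
/-- The coordinate maps from square-zero extensions to dual numbers, as natural transformations. -/
def sqZCoord (n : ℕ) (i : Fin n) : sqZFunctor R n ⟶ dualFunctor R where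
  app B := CommAlgCat.ofHom (sqZToDual R i B)
  naturality B B' f := by
    apply CommAlgCat.hom_ext
    apply AlgHom.ext
    intro (x : SqZ n B)
    change sqZToDual R i B' (sqZMap n f.hom x) = dualMap f.hom (sqZToDual R i B x)
    ext <;> simp

variable (R) in
/-- The base maps from square-zero extensions. -/
def sqZBase (n : ℕ) : sqZFunctor R n ⟶ 𝟭 (CommAlgCat.{u} R) where
  app B := CommAlgCat.ofHom (fstHom R B (Fin n → B))
  naturality B B' f := by
    apply CommAlgCat.hom_ext
    apply AlgHom.ext
    intro x
    exact fst_sqZMap f.hom x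

lemma sqZMap_inr {n : ℕ} (f : B →ₐ[R] B') (v : Fin n → B) :
    sqZMap n f (inr v) = inr (fun i => f (v i)) := by
  ext <;> simp

lemma sum_inr_single_mul_inl {n : ℕ} (v : Fin n → B) :
    ∑ i, (inr (Pi.single i 1) : SqZ n B) * inl (v i) = inr v := by
  have h : ∀ i, (inr (Pi.single i 1) : SqZ n B) * inl (v i) =
      inrHom B (Fin n → B) (Pi.single i (v i)) := by
    intro i
    rw [inr_mul_inl, op_smul_eq_smul, ← Pi.single_smul, smul_eq_mul, mul_one]
    rfl
  rw [Finset.sum_congr rfl fun i _ => h i, ← map_sum, Finset.univ_sum_single]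
  rfl

variable (R) in
/-- The base change of square-zero extensions. -/
def sqZTensorEquiv (n : ℕ) (B : Type u) [CommRing B] [Algebra R B] :
    SqZ n R ⊗[R] B ≃ₐ[R] SqZ n B :=
  AlgEquiv.ofAlgHom
    (Algebra.TensorProduct.lift (sqZMap n (Algebra.ofId R B)) (inlAlgHom R B (Fin n → B))
      fun _ _ => .all _ _)
    (TrivSqZeroExt.lift (S := R) (R := B) (M := Fin n → B) (A := SqZ n R ⊗[R] B)
      Algebra.TensorProduct.includeRight
      (∑ i, (TensorProduct.mk R (SqZ n R) B (inr (Pi.single i 1))).comp (LinearMap.proj i))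
      (by
        intro x y
        simp [Finset.sum_mul_sum, Algebra.TensorProduct.tmul_mul_tmul])
      (by
        intro r x
        simp [Finset.mul_sum, Algebra.TensorProduct.tmul_mul_tmul])
      (by
        intro r x
        simp [Finset.sum_mul, Algebra.TensorProduct.tmul_mul_tmul, mul_comm]))
    (by
      apply TrivSqZeroExt.algHom_ext'
      · apply AlgHom.ext
        intro b
        simp
      · apply LinearMap.ext
        intro v
        refine Eq.trans ?_ (sum_inr_single_mul_inl v)
        have h : ∀ i : Fin n, (fun j => algebraMap R B ((Pi.single i 1 : Fin n → R) j)) =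
            Pi.single i 1 := by
          intro i
          ext j
          by_cases hij : j = i <;> simp [hij]
        simp [sqZMap_inr, Algebra.ofId_apply, h])
    (by
      apply Algebra.TensorProduct.ext
      · apply TrivSqZeroExt.algHom_ext
        intro v
        have h : ∀ i, (inr (Pi.single i 1) : SqZ n R) ⊗ₜ[R] algebraMap R B (v i) =
            ((inr (Pi.single i 1) : SqZ n R) * inl (v i)) ⊗ₜ[R] (1 : B) := by
          intro i
          rw [Algebra.algebraMap_eq_smul_one, TensorProduct.tmul_smul, TensorProduct.smul_tmul',
            mul_inl_eq_op_smul, op_smul_eq_smul]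
        simp [sqZMap_inr, Algebra.ofId_apply, h, ← TensorProduct.sum_tmul,
          sum_inr_single_mul_inl]
      · ext b
        simp)

variable (R) in
/-- The functor `(R ⋉ Rⁿ) ⊗ -` is the functor of square-zero extensions. -/
def sqZFunctorIso (n : ℕ) : tensorFunctor R (SqZ n R) ≅ sqZFunctor R n :=
  NatIso.ofComponents (fun B => CommAlgCat.isoMk (sqZTensorEquiv R n B)) fun {B B'} f => by
    apply CommAlgCat.hom_ext
    apply Algebra.TensorProduct.ext'
    intro x b
    change sqZTensorEquiv R n B' (x ⊗ₜ f.hom b) = sqZMap n f.hom (sqZTensorEquiv R n B (x ⊗ₜ b))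
    simp only [sqZTensorEquiv, AlgEquiv.ofAlgHom_apply, Algebra.TensorProduct.lift_tmul, map_mul]
    ext <;> simp

section Adjunction

variable {𝕋 : TangentStructure (Aff R)} {adj : (dualFunctor R).op ⊣ 𝕋.T} (H : IsStandard adj)

include H in
lemma mp_sqZCoord (n : ℕ) (i : Fin n) (X : Aff R) :
    mp adj X ≫ (NatTrans.op (sqZCoord R n i)).app X = (NatTrans.op (sqZBase R n)).app X := by
  apply Quiver.Hom.unop_inj
  apply CommAlgCat.hom_ext
  apply AlgHom.ext
  intro (x : SqZ n X.unop)
  exact (H.proj X.unop (sqZToDual R i X.unop x)).trans (fst_sqZToDual i x)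

/-- The generalized point of a fiber power of the tangent bundle with given transpose. -/
def ptn (n : ℕ) {X Y : Aff R} (f : (sqZFunctor R n).op.obj X ⟶ Y) :
    X ⟶ (fiberPower 𝕋.p n).obj Y :=
  limit.lift (fiberDiagram 𝕋.p n Y) (fiberCone 𝕋.p
    ((NatTrans.op (sqZBase R n)).app X ≫ f)
    (fun i => pt adj ((NatTrans.op (sqZCoord R n i)).app X ≫ f)) fun i => by
      rw [comp_p adj, tr_pt, ← Category.assoc]
      exact congrArg (· ≫ f) (mp_sqZCoord H n i X))

lemma ptn_base (n : ℕ) {X Y : Aff R} (f : (sqZFunctor R n).op.obj X ⟶ Y) :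
    ptn H n f ≫ base 𝕋.p n Y = (NatTrans.op (sqZBase R n)).app X ≫ f :=
  limit.lift_π (F := fiberDiagram 𝕋.p n Y) _ none

lemma ptn_proj (n : ℕ) {X Y : Aff R} (f : (sqZFunctor R n).op.obj X ⟶ Y) (i : Fin n) :
    ptn H n f ≫ proj 𝕋.p i Y = pt adj ((NatTrans.op (sqZCoord R n i)).app X ≫ f) :=
  limit.lift_π (F := fiberDiagram 𝕋.p n Y) _ (some i)

lemma ptn_comp (n : ℕ) {X Y Z : Aff R} (f : (sqZFunctor R n).op.obj X ⟶ Y) (g : Y ⟶ Z) :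
    ptn H n (f ≫ g) = ptn H n f ≫ (fiberPower 𝕋.p n).map g := by
  apply fiberPower_hom_ext
  · rw [Category.assoc, fiberPower_map_base, ptn_base, ← Category.assoc (ptn H n f), ptn_base,
      Category.assoc]
  · intro i
    rw [Category.assoc, fiberPower_map_proj, ptn_proj, ← Category.assoc (ptn H n f), ptn_proj, ← pt_comp,
      Category.assoc]

lemma map_ptn (n : ℕ) {X X' Y : Aff R} (g : X' ⟶ X) (f : (sqZFunctor R n).op.obj X ⟶ Y) :
    ptn H n ((sqZFunctor R n).op.map g ≫ f) = g ≫ ptn H n f := by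
  apply fiberPower_hom_ext
  · rw [Category.assoc, ptn_base, ptn_base, ← Category.assoc, ← NatTrans.naturality,
      Category.assoc]
    rfl
  · intro i
    rw [Category.assoc, ptn_proj, ptn_proj, ← Category.assoc, ← NatTrans.naturality,
      Category.assoc, map_pt]

/-- A point of the n-fold fibre power is n algebra maps into dual numbers with a common first
component, that is, one algebra map with n derivations along it. This is the same as an algebra map
into the square-zero extension by a free module of rank n. -/
lemma ptn_bijective (n : ℕ) (X Y : Aff R) :
    Function.Bijective (ptn H n : ((sqZFunctor R n).op.obj X ⟶ Y) → _) := by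
  constructor
  · intro f g h
    have hb := congrArg (· ≫ base 𝕋.p n Y) h
    have hp := fun i => congrArg (fun k => tr adj (k ≫ proj 𝕋.p i Y)) h
    simp only [ptn_base, ptn_proj, tr_pt] at hb hp
    apply Quiver.Hom.unop_inj
    apply CommAlgCat.hom_ext
    apply AlgHom.ext
    intro a
    apply TrivSqZeroExt.ext
    · exact congrArg (fun k => k.unop.hom a) hb
    · funext i
      have h1 : sqZToDual R i X.unop (f.unop.hom a) = sqZToDual R i X.unop (g.unop.hom a) :=
        congrArg (fun k => k.unop.hom a) (hp i)
      exact (snd_sqZToDual (R := R) i _).symm.trans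
        ((congrArg TrivSqZeroExt.snd h1).trans (snd_sqZToDual (R := R) i _))
  · intro k
    let b : Y.unop →ₐ[R] X.unop := (k ≫ base 𝕋.p n Y).unop.hom
    let g : Fin n → (Y.unop →ₐ[R] X.unop[ε]) := fun i => (tr adj (k ≫ proj 𝕋.p i Y)).unop.hom
    have hg : ∀ i a, (g i a).fst = b a := by
      intro i a
      have h1 : mp adj X ≫ tr adj (k ≫ proj 𝕋.p i Y) = k ≫ base 𝕋.p n Y := by
        rw [← comp_p, Category.assoc, proj_p]
      exact (H.proj X.unop (g i a)).symm.trans (congrArg (fun h => h.unop.hom a) h1)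
    have hδ : ∀ i, IsDer b (((sndHom X.unop X.unop).restrictScalars R).comp (g i).toLinearMap) :=
      fun i => ⟨by
        intro a a'
        simp [hg, mul_comm]⟩
    let u : Y.unop →ₐ[R] SqZ n X.unop := mkSqZ b _ hδ
    refine ⟨(CommAlgCat.ofHom u).op, ?_⟩
    apply fiberPower_hom_ext
    · refine (ptn_base H n _).trans ?_
      apply Quiver.Hom.unop_inj
      apply CommAlgCat.hom_ext
      apply AlgHom.ext
      intro a
      exact fst_mkSqZ b _ hδ a
    · intro i
      refine (ptn_proj H n _ i).trans ?_
      apply tr_injective adj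
      rw [tr_pt]
      apply Quiver.Hom.unop_inj
      apply CommAlgCat.hom_ext
      apply AlgHom.ext
      intro a
      change sqZToDual R i X.unop (u a) = g i a
      apply TrivSqZeroExt.ext
      · rw [fst_sqZToDual, hg]
        exact fst_mkSqZ b _ hδ a
      · rw [snd_sqZToDual]
        exact snd_mkSqZ b _ hδ a i

/-- The fiber powers of a standard tangent bundle are right adjoint to the duals of square-zero
extensions. -/
def sqZAdj (n : ℕ) : (sqZFunctor R n).op ⊣ fiberPower 𝕋.p n :=
  Adjunction.mkOfHomEquiv
    { homEquiv := fun X Y => Equiv.ofBijective (ptn H n) (ptn_bijective H n X Y)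
      homEquiv_naturality_left_symm := fun f g => by
        rw [Equiv.symm_apply_eq, Equiv.ofBijective_apply, map_ptn]
        exact congrArg (f ≫ ·) ((Equiv.ofBijective _ (ptn_bijective H n _ _)).apply_symm_apply g).symm
      homEquiv_naturality_right := fun f g => ptn_comp H n f g }

end Adjunction

end FiberPowers

/-! ### The first fibre power and the fibre powers of the identity -/

noncomputable section FiberPowerOne

variable {C : Type u} [Category.{v} C] {T : C ⥤ C} (p : T ⟶ 𝟭 C) [HasFiberPowers p]

/-- The canonical map from the tangent bundle to its first fiber power. -/
def toFiberPowerOne (M : C) : T.obj M ⟶ (fiberPower p 1).obj M :=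
  limit.lift (fiberDiagram p 1 M) (fiberCone p (p.app M) (fun _ => 𝟙 _)
    fun _ => Category.id_comp _)

lemma toFiberPowerOne_base (M : C) : toFiberPowerOne p M ≫ base p 1 M = p.app M :=
  limit.lift_π (F := fiberDiagram p 1 M) _ none

lemma toFiberPowerOne_proj (M : C) : toFiberPowerOne p M ≫ proj p 0 M = 𝟙 _ :=
  limit.lift_π (F := fiberDiagram p 1 M) _ (some 0)

/-- The first fiber power of a tangent bundle is the tangent bundle. -/
def fiberPowerOneIso : fiberPower p 1 ≅ T :=
  NatIso.ofComponents (fun M =>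
    { hom := proj p 0 M
      inv := toFiberPowerOne p M
      hom_inv_id := by
        apply fiberPower_hom_ext
        · rw [Category.assoc, toFiberPowerOne_base]
          exact (proj_p p 0 M).trans (Category.id_comp _).symm
        · intro i
          rw [Subsingleton.elim i 0, Category.assoc, toFiberPowerOne_proj, Category.comp_id,
            Category.id_comp]
      inv_hom_id := toFiberPowerOne_proj p M })
    fun f => fiberPower_map_proj p 0 f

variable (C) in
/-- The fiber powers of the identity functor are the identity functor. -/
def trivialFiberPowerIso (n : ℕ) : fiberPower (𝟙 (𝟭 C)) n ≅ 𝟭 C :=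
  NatIso.ofComponents (fun M =>
    { hom := base (𝟙 (𝟭 C)) n M
      inv := limit.lift (fiberDiagram (𝟙 (𝟭 C)) n M) (fiberCone (𝟙 (𝟭 C)) (𝟙 M) (fun _ => 𝟙 M)
        fun _ => Category.id_comp _)
      hom_inv_id := by
        have hb : (base (𝟙 (𝟭 C)) n M ≫ limit.lift (fiberDiagram (𝟙 (𝟭 C)) n M)
            (fiberCone (𝟙 (𝟭 C)) (𝟙 M) (fun _ => 𝟙 M) fun _ => Category.id_comp _)) ≫
            base (𝟙 (𝟭 C)) n M = 𝟙 _ ≫ base (𝟙 (𝟭 C)) n M := by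
          refine (Category.assoc _ _ _).trans (Eq.trans ?_ (Category.id_comp _).symm)
          exact (congrArg (base (𝟙 (𝟭 C)) n M ≫ ·)
            (limit.lift_π (F := fiberDiagram (𝟙 (𝟭 C)) n M) _ none)).trans (Category.comp_id _)
        exact fiberPower_hom_ext _ hb fun i => by rw [trivial_proj]; exact hb
      inv_hom_id := limit.lift_π (F := fiberDiagram (𝟙 (𝟭 C)) n M) _ none })
    fun f => fiberPower_map_base _ f

end FiberPowerOne

/-! ### Classification of representable tangent structures -/

noncomputable section Classification

open TangentStructure TrivSqZeroExt TanAlg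
open scoped TensorProduct

variable {R : Type u} [CommRing R]

section Standard

variable {E : Type u} [CommRing E] [Algebra R E] {𝕋 : TangentStructure (Aff R)}
  (adj : (tensorFunctor R E).op ⊣ 𝕋.T) (e : E)

/-- The isomorphism θ identifies e with ε, so an augmentation killing e becomes the first component
and the lift e ⊗ e becomes the product of the two infinitesimals. -/
lemma isStandard_ofNatIsoLeft [IsDomain R] (he : aug adj e = 0) (hl : coLift adj e = e ⊗ₜ e)
    (θ : tensorFunctor R E ≅ dualFunctor R)
    (hθ : ∀ (B : CommAlgCat.{u} R) (x : B[ε]),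
      (θ.inv.app B).hom x = (1 ⊗ₜ x.fst + e ⊗ₜ x.snd : E ⊗[R] B)) :
    IsStandard (adj.ofNatIsoLeft (NatIso.op θ.symm)) where
  proj B x := by
    have h : aProj (adj.ofNatIsoLeft (NatIso.op θ.symm)) B x =
        tProj adj B ((θ.inv.app B).hom x) :=
      congrArg (fun k => k.unop.hom x) (mp_ofNatIsoLeft adj (NatIso.op θ.symm) (op B))
    rw [h, hθ, map_add, tProj_tmul, tProj_tmul, he, map_one, one_smul, zero_smul]
    exact _root_.add_zero _
  lift := by
    have h : aLift (adj.ofNatIsoLeft (NatIso.op θ.symm)) (.of R R) (DualNumber.eps : R[ε]) =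
        (θ.hom.app (.of R R[ε])).hom (Algebra.TensorProduct.map (.id R E)
          (θ.hom.app (.of R R)).hom
            (tLift adj ((θ.inv.app (.of R R)).hom (DualNumber.eps : R[ε])))) :=
      congrArg (fun k => k.unop.hom (DualNumber.eps : R[ε]))
        (ml_ofNatIsoLeft adj (NatIso.op θ.symm) (op (.of R R)))
    have hε : ∀ (B : CommAlgCat.{u} R) (b : B),
        (θ.hom.app B).hom (e ⊗ₜ b : E ⊗[R] B) = (inr b : B[ε]) := by
      intro B b
      have h1 := hθ B (inr b : B[ε])
      rw [fst_inr, snd_inr, TensorProduct.tmul_zero, _root_.zero_add] at h1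
      rw [← h1]
      exact congrArg (fun k => k.hom (inr b : B[ε])) (θ.inv_hom_id_app B)
    have h0 : (θ.inv.app (.of R R)).hom (DualNumber.eps : R[ε]) = (e ⊗ₜ (1 : R) : E ⊗[R] R) := by
      refine (hθ (.of R R) _).trans ?_
      rw [DualNumber.fst_eps, DualNumber.snd_eps, TensorProduct.tmul_zero, _root_.zero_add]
    rw [h, h0, aLift_tmul_one, hl, Algebra.TensorProduct.map_tmul]
    have h2 : (Algebra.TensorProduct.rid R R E).symm.toAlgHom e = e ⊗ₜ (1 : R) := by simp
    rw [h2]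
    exact (hε (.of R R[ε]) _).trans (congrArg inr (hε (.of R R) (1 : R)))

end Standard

variable (R) in
lemma dualFunctorIso_inv_app (B : CommAlgCat.{u} R) (x : B[ε]) :
    ((dualFunctorIso R).inv.app B).hom x = (1 ⊗ₜ x.fst + DualNumber.eps ⊗ₜ x.snd : R[ε] ⊗[R] B) :=
  dualTensorEquiv_symm_apply B x

/-- A bijective augmentation makes every element of E a multiple of 1, so every tensor is of the
form 1 ⊗ b, and the projection returns b. -/
lemma bijective_aProj [IsDomain R] {E : Type u} [CommRing E] [Algebra R E]
    {𝕋 : TangentStructure (Aff R)} (adj : (tensorFunctor R E).op ⊣ 𝕋.T)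
    (h : Function.Bijective (aug adj)) (B : CommAlgCat.{u} R) :
    Function.Bijective (aProj adj B) := by
  have hs : ∀ t : E ⊗[R] B, ∃ b : B, 1 ⊗ₜ b = t := by
    intro t
    induction t with
    | zero => exact ⟨0, TensorProduct.tmul_zero _ _⟩
    | tmul x b =>
      refine ⟨aug adj x • b, ?_⟩
      rw [TensorProduct.tmul_smul, TensorProduct.smul_tmul']
      congr 1
      apply h.1
      rw [map_smul, map_one, smul_eq_mul, mul_one]
    | add x y hx hy =>
      obtain ⟨a, rfl⟩ := hx
      obtain ⟨b, rfl⟩ := hy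
      exact ⟨a + b, TensorProduct.tmul_add _ _ _⟩
  constructor
  · intro s t hst
    obtain ⟨a, rfl⟩ := hs s
    obtain ⟨b, rfl⟩ := hs t
    have : a = b := (tProj_one_tmul adj B a).symm.trans (hst.trans (tProj_one_tmul adj B b))
    rw [this]
  · exact fun b => ⟨1 ⊗ₜ b, tProj_one_tmul adj B b⟩

/-- A representable tangent structure on affine schemes over a principal ideal domain is
isomorphic to the trivial one or to the one of Kähler differentials. -/
theorem nonempty_iso_of_isRepresentable [IsDomain R] [IsPrincipalIdealRing R]
    (𝕋 : TangentStructure (Aff R)) (h : 𝕋.IsRepresentable) :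
    Nonempty (TangentStructure.Iso 𝕋 (trivialTangentStructure (Aff R))) ∨
      Nonempty (TangentStructure.Iso 𝕋 (kaehlerTangentStructure R)) := by
  -- Representability in degree one suffices, because `T₁` is canonically `T`.
  obtain ⟨D, ⟨adjD⟩⟩ := h 1 one_pos
  let adj : (tensorFunctor R D.unop).op ⊣ 𝕋.T :=
    (adjD.ofNatIsoLeft (tensorLeftIso R D.unop)).ofNatIsoRight (fiberPowerOneIso 𝕋.p)
  obtain hb | ⟨e, he, hgen, hfree, hl⟩ := bijective_aug_or_exists_generator adj
  · exact .inl ⟨isoTrivial 𝕋 (isIso_p_of_bijective adj (bijective_aProj adj hb))⟩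
  · right
    let f := dualEquiv (aug adj) e he (mul_eq_zero_of_aug adj he he) hgen hfree
    have hf : f DualNumber.eps = e := by
      refine (DualNumber.lift_apply_apply (R := R) (A := R) (B := D.unop) _ _).trans ?_
      simp
    refine (isStandard_ofNatIsoLeft adj e he hl
      (tensorFunctorCongr f.symm ≪≫ dualFunctorIso R) fun B x => ?_).nonempty_iso
        isStandard_kaehlerAdj
    have h1 : ((tensorFunctorCongr f.symm ≪≫ dualFunctorIso R).inv.app B).hom x =
        Algebra.TensorProduct.map (f : R[ε] →ₐ[R] D.unop) (.id R B)
          (((dualFunctorIso R).inv.app B).hom x) := rfl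
    rw [h1, dualFunctorIso_inv_app, map_add, Algebra.TensorProduct.map_tmul,
      Algebra.TensorProduct.map_tmul, map_one]
    congr 2

end Classification

/-! ### Representability and distinctness of the two structures -/

noncomputable section Existence

open TangentStructure TrivSqZeroExt TanAlg
open scoped TensorProduct

variable (R : Type u) [CommRing R]

/-- The product with the spectrum of the base ring is trivial. -/
def tensorLeftUnitAdj : tensorLeft (op (.of R R) : Aff R) ⊣ 𝟭 (Aff R) :=
  Adjunction.id.ofNatIsoLeft (leftUnitorNatIso (Aff R)).symm

theorem isRepresentable_trivialTangentStructure :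
    (trivialTangentStructure (Aff R)).IsRepresentable := fun n _ =>
  ⟨op (.of R R), ⟨(tensorLeftUnitAdj R).ofNatIsoRight (trivialFiberPowerIso (Aff R) n).symm⟩⟩

theorem isRepresentable_kaehlerTangentStructure :
    (kaehlerTangentStructure R).IsRepresentable := fun n _ =>
  ⟨op (.of R (SqZ n R)), ⟨(sqZAdj isStandard_kaehlerAdj n).ofNatIsoLeft
    ((NatIso.op (sqZFunctorIso R n)) ≪≫ (tensorLeftIso R (SqZ n R)).symm)⟩⟩

theorem represents_kaehlerTangentStructure :
    Represents (op (.of R R[ε])) (kaehlerTangentStructure R).T :=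
  ⟨(kaehlerAdj R).ofNatIsoLeft
    ((NatIso.op (dualFunctorIso R)) ≪≫ (tensorLeftIso R R[ε]).symm)⟩

variable {R} in
-- The algebra map induced by the formal derivative sends dX to 1.
lemma d_polynomial_X_ne_zero [Nontrivial R] :
    d R (Polynomial R) (Polynomial.X : Polynomial R) ≠ 0 := by
  intro h
  have hd : IsDer (AlgHom.id R (Polynomial R)) Polynomial.derivative :=
    ⟨fun a b => by simp [Polynomial.derivative_mul]; ring⟩
  have := congrArg (lift (AlgHom.id R (Polynomial R)) Polynomial.derivative hd) h
  simp at this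

/-- An isomorphism would provide a one-sided inverse of p, making every element of the tangent
algebra of R[X] come from R[X]. The zero section kills dX and is the identity on R[X], so dX would
be 0. -/
theorem isEmpty_iso_trivial_kaehler [Nontrivial R] :
    IsEmpty (TangentStructure.Iso (trivialTangentStructure (Aff R)) (kaehlerTangentStructure R)) := by
  refine ⟨fun φ => d_polynomial_X_ne_zero (R := R) ?_⟩
  let M : Aff R := op (.of R (Polynomial R))
  have h1 : (kaehlerTangentStructure R).p.app M ≫ φ.iso.hom.app M = 𝟙 _ := by
    refine (cancel_epi (φ.iso.hom.app M)).1 ((Category.assoc _ _ _).symm.trans ?_)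
    exact (congrArg (· ≫ φ.iso.hom.app M) (φ.p M)).trans
      ((Category.id_comp _).trans (Category.comp_id _).symm)
  let g : TanAlg R (Polynomial R) →ₐ[R] Polynomial R := (φ.iso.hom.app M).unop.hom
  have hg : ∀ t, incl R (Polynomial R) (g t) = t := fun t =>
    congrArg (fun k => k.unop.hom t) h1
  have h2 := hg (d R (Polynomial R) Polynomial.X)
  have h3 := congrArg (zero R (Polynomial R)) h2
  simp at h3
  rw [h3, map_zero] at h2
  exact h2.symm

theorem isRepresentable_and_isEmpty_iso_and_nonempty_iso [IsDomain R] [IsPrincipalIdealRing R] :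
    (trivialTangentStructure (Aff R)).IsRepresentable ∧
      Represents (op (CommAlgCat.of R R)) (trivialTangentStructure (Aff R)).T ∧
      (kaehlerTangentStructure R).IsRepresentable ∧
      Represents (op (CommAlgCat.of R R[ε])) (kaehlerTangentStructure R).T ∧
      IsEmpty (TangentStructure.Iso (trivialTangentStructure (Aff R)) (kaehlerTangentStructure R)) ∧
      ∀ 𝕋 : TangentStructure (Aff R), 𝕋.IsRepresentable →
        Nonempty (TangentStructure.Iso 𝕋 (trivialTangentStructure (Aff R))) ∨
        Nonempty (TangentStructure.Iso 𝕋 (kaehlerTangentStructure R)) :=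
  ⟨isRepresentable_trivialTangentStructure R, ⟨tensorLeftUnitAdj R⟩,
    isRepresentable_kaehlerTangentStructure R, represents_kaehlerTangentStructure R,
    isEmpty_iso_trivial_kaehler R, nonempty_iso_of_isRepresentable⟩

end Existence

end TangentCategory

theorem mainTheorem4 :
    (∀ (R : Type u) [CommRing R] [IsDomain R] [IsPrincipalIdealRing R],
      -- the trivial tangent structure is representable, represented by the terminal object
      (TangentCategory.trivialTangentStructure (TangentCategory.Aff R)).IsRepresentable ∧
      TangentCategory.TangentStructure.Represents (op (CommAlgCat.of R R))
        (TangentCategory.trivialTangentStructure (TangentCategory.Aff R)).T ∧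
      -- the Kähler tangent structure is representable, represented by the dual numbers
      (TangentCategory.kaehlerTangentStructure R).IsRepresentable ∧
      TangentCategory.TangentStructure.Represents (op (CommAlgCat.of R R[ε]))
        (TangentCategory.kaehlerTangentStructure R).T ∧
      -- these two are different
      IsEmpty (TangentCategory.TangentStructure.Iso
        (TangentCategory.trivialTangentStructure (TangentCategory.Aff R))
        (TangentCategory.kaehlerTangentStructure R)) ∧
      -- and there is no other one
      ∀ 𝕋 : TangentCategory.TangentStructure (TangentCategory.Aff R), 𝕋.IsRepresentable →
        Nonempty (TangentCategory.TangentStructure.Iso 𝕋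
          (TangentCategory.trivialTangentStructure (TangentCategory.Aff R))) ∨
        Nonempty (TangentCategory.TangentStructure.Iso 𝕋
          (TangentCategory.kaehlerTangentStructure R))) ∧
    -- the case of all affine schemes, i.e. of the base ring `ℤ`
    ((TangentCategory.trivialTangentStructure (TangentCategory.Aff ℤ)).IsRepresentable ∧
      TangentCategory.TangentStructure.Represents (op (CommAlgCat.of ℤ ℤ))
        (TangentCategory.trivialTangentStructure (TangentCategory.Aff ℤ)).T ∧
      (TangentCategory.kaehlerTangentStructure ℤ).IsRepresentable ∧
      TangentCategory.TangentStructure.Represents (op (CommAlgCat.of ℤ ℤ[ε]))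
        (TangentCategory.kaehlerTangentStructure ℤ).T ∧
      IsEmpty (TangentCategory.TangentStructure.Iso
        (TangentCategory.trivialTangentStructure (TangentCategory.Aff ℤ))
        (TangentCategory.kaehlerTangentStructure ℤ)) ∧
      ∀ 𝕋 : TangentCategory.TangentStructure (TangentCategory.Aff ℤ), 𝕋.IsRepresentable →
        Nonempty (TangentCategory.TangentStructure.Iso 𝕋
          (TangentCategory.trivialTangentStructure (TangentCategory.Aff ℤ))) ∨
        Nonempty (TangentCategory.TangentStructure.Iso 𝕋
          (TangentCategory.kaehlerTangentStructure ℤ))) :=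
  ⟨fun R => TangentCategory.isRepresentable_and_isEmpty_iso_and_nonempty_iso R,
    TangentCategory.isRepresentable_and_isEmpty_iso_and_nonempty_iso ℤ⟩
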